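/- Fix $1<p<\infty$ and let $L_p=L_p[0,1]$ be the real Lebesgue space (Borel sets, Lebesgue measure $|\cdot|$), $L_p^0=\{f\in L_p:\int f=0\}$ and $\langle f,g\rangle=\int_0^1 fg$. Let $\mathcal D^i$ be the set of the $2^i$ dyadic intervals $[\frac{j}{2^i},\frac{j+1}{2^i})\subset[0,1)$, let $h_I=\chi_{I^+}-\chi_{I^-}$ ($I^+$, $I^-$ the left and right half of the dyadic interval $I$), and let $L_p^{n,0}$ be the linear span of the $h_I$ with $I\in\mathcal D^0\cup\dots\cup\mathcal D^{n-1}$. Write $\mathrm{dist}(f)$ for the distribution of $f$. A linear operator $T$ between subspaces of $L_p$ is a distributional embedding if $\mathrm{dist}(Tf)=\mathrm{dist}(f)$ for all $f$ in its domain, and, for $0<\theta\le1$, a $\theta$-compression if $\mathrm{dist}(Tf)=\theta\,\mathrm{dist}(f)+(1-\theta)\delta_0$ for all such $f$. The support of a subspace of $L_p$ is the essentially smallest measurable set outside of which all its members vanish almost everywhere; operators have disjointly supported ranges if the supports of their ranges are pairwise essentially disjoint. For a finite-dimensional space $Y$ of bounded functions, the orthogonal projection $E:L_p\to Y$ is the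 bounded operator onto $Y$ that agrees on $L_p\cap L_2$ with the orthogonal projection of $L_2$ onto $Y$. **Proposition.** Let $n,m\in\mathbb N=\{1,2,\dots\}$, $\Gamma>0$ and $0<\epsilon<1$. There exists $k_0''=k_0''(n,m,\Gamma,\epsilon)\in\mathbb N$ (depending also on the fixed $p$) such that for every $k\ge k_0''$ and (a) every bounded linear operator $T:X\to L_p$ with $\|T\|\le\Gamma$, where $X$ is a (not necessarily closed) subspace of $L_p$, (b) all bounded linear operators $Q_1:Z\to L_p^0$ and $Q_2:X\to W$ of norm at most $\Gamma$ and rank at most $m$, where $Z$ and $W$ are real normed spaces, and (c) all $N\ge 1$ and all operators $S_1,\dots,S_N:L_p^{k,0}\to X$ with disjointly supported ranges such that, for $1\le l\le N$, $S_l$ is a $\theta_l$-compression for some $\theta_l\in(0,1]$, there exist distributional embeddings $J_l:L_p^{n,0}\to L_p^{k,0}$, $1\le l\le N$, such that $S=\sum_{l=1}^N S_lJ_l:L_p^{n,0}\to X$ is a $\theta$-compression with $\theta=\sum_{l=1}^N\theta_l$ and, denoting by $Y\subset X$ the range of $S$ (that is, the span of the functions $Sh_I$, $I\in\mathcal D^0\cup\dots\cup\mathcal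 D^{n-1}$) and by $E:L_p\to Y$ the orthogonal projection, the following hold. (i) For some $0\le i\le k-1$ and $$r=\theta^{-1}\sum_{l=1}^N\sum_{K\in\mathcal D^i}\langle S_lh_K,\,TS_lh_K\rangle,$$ we have $\big\|(ET-r\cdot\mathrm{id})|_Y\big\|<\epsilon$. (ii) $\|EQ_1\|<\epsilon$ and $\|Q_2E|_{L_p^0}\|<\epsilon$. -/

import Mathlib

open MeasureTheory
open scoped ENNReal

noncomputable section

/-- Lebesgue measure on the unit interval `[0,1]`. -/
abbrev leb01 : Measure ℝ := volume.restrict (Set.Icc (0 : ℝ) 1)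

/-- The real space `L_p = L_p[0,1]`. -/
abbrev LpI (p : ℝ≥0∞) : Type := Lp ℝ p leb01

/-- The subspace `L_p^0` of mean-zero functions. -/
def LpZero (p : ℝ≥0∞) [Fact (1 ≤ p)] : Submodule ℝ (LpI p) where
  carrier := {f | ∫ x, f x ∂leb01 = 0}
  zero_mem' := by
    have h : ∫ x, (0 : LpI p) x ∂leb01 = ∫ _, (0 : ℝ) ∂leb01 :=
      integral_congr_ae (Lp.coeFn_zero ℝ p leb01)
    simpa using h
  add_mem' := by
    intro f g hf hg
    have hi : ∀ u : LpI p, Integrable u leb01 := fun u => (Lp.memLp u).integrable Fact.out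
    have h : ∫ x, (f + g : LpI p) x ∂leb01 = ∫ x, (f x + g x) ∂leb01 :=
      integral_congr_ae (Lp.coeFn_add f g)
    have h2 := integral_add (hi f) (hi g)
    simp only [Set.mem_ofPred_eq] at hf hg ⊢
    rw [h, h2, hf, hg, add_zero]
  smul_mem' := by
    intro c f hf
    have h : ∫ x, (c • f : LpI p) x ∂leb01 = ∫ x, c * f x ∂leb01 :=
      integral_congr_ae (Lp.coeFn_smul c f)
    simp only [Set.mem_ofPred_eq] at hf ⊢
    rw [h, integral_const_mul, hf, mul_zero]

/-- The dyadic interval `[j / 2^i, (j+1) / 2^i)`; the members of `𝒟^i` are those with `j < 2^i`. -/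
def dyadic (i j : ℕ) : Set ℝ := Set.Ico ((j : ℝ) / 2 ^ i) (((j : ℝ) + 1) / 2 ^ i)

/-- The characteristic function of a dyadic interval, as an element of `L_p`. -/
def dyadicChi (p : ℝ≥0∞) (i j : ℕ) : LpI p :=
  indicatorConstLp p (s := dyadic i j) (μ := leb01) measurableSet_Ico (measure_ne_top _ _) (1 : ℝ)

/-- The Haar function `h_I = χ_{I⁺} - χ_{I⁻}` of `I = [j / 2^i, (j+1) / 2^i)`, where `I⁺` and `I⁻`
are the left and the right half of `I`. -/
def haar (p : ℝ≥0∞) (i j : ℕ) : LpI p :=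
  dyadicChi p (i + 1) (2 * j) - dyadicChi p (i + 1) (2 * j + 1)

/-- `L_p^{n,0}`, the linear span of the Haar functions `h_I`, `I ∈ 𝒟_{n-1} = 𝒟^0 ∪ ⋯ ∪ 𝒟^{n-1}`. -/
def LpHaar (p : ℝ≥0∞) (n : ℕ) : Submodule ℝ (LpI p) :=
  Submodule.span ℝ {h | ∃ i j : ℕ, i < n ∧ j < 2 ^ i ∧ h = haar p i j}

/-- The Haar function `h_K`, `K ∈ 𝒟^i`, `i < n`, as an element of `L_p^{n,0}`. -/
def haarIn (p : ℝ≥0∞) (n : ℕ) (i : Fin n) (j : Fin (2 ^ (i : ℕ))) : LpHaar p n :=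
  ⟨haar p i j, Submodule.subset_span ⟨i, j, i.2, j.2, rfl⟩⟩

/-- The distribution of a function on `[0,1]`. -/
def distr {p : ℝ≥0∞} (f : LpI p) : Measure ℝ := leb01.map f

/-- The pairing `⟨f, g⟩ = ∫ f g`. -/
def pairing {p : ℝ≥0∞} (f g : LpI p) : ℝ := ∫ x, f x * g x ∂leb01

/-- Distributional embeddings: linear operators with `dist (T f) = dist f`. -/
def IsDistEmbedding {p : ℝ≥0∞} {X Y : Submodule ℝ (LpI p)} (T : X →ₗ[ℝ] Y) : Prop :=
  ∀ f : X, distr (T f : LpI p) = distr (f : LpI p)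

/-- `θ`-compressions, `0 < θ ≤ 1`: linear operators with
`dist (T f) = θ dist f + (1 - θ) δ_0`. -/
def IsCompression {p : ℝ≥0∞} {X Y : Submodule ℝ (LpI p)} (θ : ℝ) (T : X →ₗ[ℝ] Y) : Prop :=
  0 < θ ∧ θ ≤ 1 ∧ ∀ f : X, distr (T f : LpI p) =
    ENNReal.ofReal θ • distr (f : LpI p) + ENNReal.ofReal (1 - θ) • Measure.dirac 0

/-- The range of an operator `S : V → X`, as a subspace of `L_p`. -/
def rangeLp {p : ℝ≥0∞} {V X : Submodule ℝ (LpI p)} (S : V →ₗ[ℝ] X) : Submodule ℝ (LpI p) :=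
  LinearMap.range (X.subtype ∘ₗ S)

theorem rangeLp_le {p : ℝ≥0∞} {V X : Submodule ℝ (LpI p)} (S : V →ₗ[ℝ] X) : rangeLp S ≤ X := by
  rintro _ ⟨v, rfl⟩
  exact (S v).2

/-- The inclusion of the range of `S : V → X` into `X`. -/
def rangeIncl {p : ℝ≥0∞} [Fact (1 ≤ p)] {V X : Submodule ℝ (LpI p)} (S : V →ₗ[ℝ] X) :
    rangeLp S →L[ℝ] X :=
  (rangeLp S).subtypeL.codRestrict X (fun y => rangeLp_le S y.2)

/-- `supp X ⊂ A`, in the essential sense. -/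
def SuppIn {p : ℝ≥0∞} (X : Submodule ℝ (LpI p)) (A : Set ℝ) : Prop :=
  ∀ f ∈ X, ∀ᵐ x ∂leb01, f x ≠ 0 → x ∈ A

/-- `supp X = A`: the set `A` is the essentially smallest measurable set with `supp X ⊂ A`. -/
def IsSupp {p : ℝ≥0∞} (X : Submodule ℝ (LpI p)) (A : Set ℝ) : Prop :=
  MeasurableSet A ∧ SuppIn X A ∧
    ∀ B : Set ℝ, MeasurableSet B → SuppIn X B → ∀ᵐ x ∂leb01, x ∈ A → x ∈ B

/-- The operators `S_l` have disjointly supported ranges: the supports of their ranges are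
pairwise essentially disjoint. -/
def DisjointRanges {p : ℝ≥0∞} {V X : Submodule ℝ (LpI p)} {N : ℕ}
    (S : Fin N → (V →ₗ[ℝ] X)) : Prop :=
  ∃ A : Fin N → Set ℝ, (∀ l, IsSupp (rangeLp (S l)) (A l)) ∧
    ∀ l l', l ≠ l' → leb01 (A l ∩ A l') = 0

/-- `E : L_p → Y` is the orthogonal projection onto `Y`: it is onto `Y` and, on `L_p ∩ L_2`, it is
given by a self-adjoint idempotent operator `P` of `L_2`. -/
def IsOrthProj {p : ℝ≥0∞} [Fact (1 ≤ p)] (Y : Submodule ℝ (LpI p)) (E : LpI p →L[ℝ] Y) : Prop :=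
  Function.Surjective E ∧ ∃ P : LpI 2 →L[ℝ] LpI 2, IsStarProjection P ∧
    ∀ (f : LpI p) (g : LpI 2), (f : ℝ → ℝ) =ᵐ[leb01] g →
      ((E f : LpI p) : ℝ → ℝ) =ᵐ[leb01] (P g : LpI 2)

/-- The operator `S = ∑_l S_l J_l`. -/
def assembled {p : ℝ≥0∞} {U V X : Submodule ℝ (LpI p)} {N : ℕ}
    (S : Fin N → (V →ₗ[ℝ] X)) (J : Fin N → (U →ₗ[ℝ] V)) : U →ₗ[ℝ] X :=
  ∑ l, S l ∘ₗ J l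

/-- The average `r = θ⁻¹ ∑_l ∑_{K ∈ 𝒟^i} ⟨S_l h_K, T S_l h_K⟩`. -/
def diagAverage {p : ℝ≥0∞} [Fact (1 ≤ p)] {k N : ℕ} {X : Submodule ℝ (LpI p)} (T : X →L[ℝ] LpI p)
    (S : Fin N → (LpHaar p k →ₗ[ℝ] X)) (θ : ℝ) (i : Fin k) : ℝ :=
  θ⁻¹ * ∑ l, ∑ j : Fin (2 ^ (i : ℕ)),
    pairing (S l (haarIn p k i j) : LpI p) (T (S l (haarIn p k i j)))

end

/-! The embeddings are block bases of the Haar system with random signs. Fix levels g 0 < ... < g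
(n-1), all large. In each copy l, the image of h_I, with I of level t and index j, is a signed sum
of the Haar functions of level g t that live where the images chosen at earlier levels take the sign
pattern coded by j. For every choice of signs these images have the joint distribution of the Haar
system, so each J_l is a distributional embedding. Disjointness of the ranges then makes S a
compression. The levels and the signs remain free.

Write u_I = S h_I, Θ for the sum of the θ_l and β(u, v) = ⟨u, Tv⟩ / Θ. Three things are needed:
finitely many functionals, coming from Q_1 and Q_2, are small at all u_I; β(u_I, u_J) is small for I
≠ J; and β(u_I, u_I) is close to r |I|. The orthogonal projection has the explicit formula f ↦ Σ ⟨f,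
u_I⟩ u_I / ⟨u_I, u_I⟩, so (i) and (ii) follow by summing matrix entries.

A combination of Haar functions of one level with coefficients in [-1, 1] is bounded by 1 and lives
on a set whose measure is the weight of the nodes involved. Hölder's inequality therefore bounds
functionals by a positive power of the weight and β by weights with exponents 1 - 1/p and 1/p
(`formBound_jointForm`). These bounds make the sum of the squared coefficients at level i at most C²
2^(-iκ), with κ = min(1 - 1/p, 1/p) > 0 (`sum_sq_functional_le`, `FormBound.sum_sq_le`). By second
moments over the signs (`exists_signs`), finitely many linear and off-diagonal quadratic expressions
are simultaneously small once i is large.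

For random signs, β(u_I, u_I) concentrates at the sum of the diagonal entries of β over the block of
I. This block arises by successive halvings, each governed by the signs of one earlier level. The
difference between the two halves is linear in these signs, so it is small as well, and the diagonal
at level g t is nearly equidistributed over the 2^t blocks (`BalancedSigns.exists_succ`). Finally,
the total diagonal sum of a level is a bounded sequence, so the pigeonhole principle yields n levels
at which it is nearly constant (`exists_nearly_constant_levels`). That constant is r.

Dividing by powers of Θ turns the θ_l into weights of sum 1, which makes every bound independent of
N and of the θ_l. -/

/-- A sign, as a real number. -/
def realSign (e : ℤˣ) : ℝ := ((e : ℤ) : ℝ)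

theorem realSign_mul (e f : ℤˣ) : realSign (e * f) = realSign e * realSign f := by
  simp [realSign]

@[simp] theorem realSign_one : realSign 1 = 1 := by simp [realSign]

@[simp] theorem realSign_neg (e : ℤˣ) : realSign (-e) = -realSign e := by simp [realSign]

theorem realSign_mul_self (e : ℤˣ) : realSign e * realSign e = 1 := by
  rw [← realSign_mul]; simp

theorem abs_realSign (e : ℤˣ) : |realSign e| = 1 := by
  rcases Int.units_eq_one_or e with h | h <;> simp [h]

/-! ### Second moments of random signs -/

section Signs

variable {α : Type*} [Fintype α] [DecidableEq α]

theorem sum_signs_eq_zero (f : (α → ℤˣ) → ℝ) (a : α)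
    (h : ∀ e, f (Function.update e a (-e a)) = -f e) : ∑ e, f e = 0 := by
  have hinv : Function.Involutive (fun e : α → ℤˣ => Function.update e a (-e a)) := by
    intro e; ext b; by_cases hb : b = a
    · subst hb; simp
    · simp [hb]
  have h1 := Equiv.sum_comp (Function.Involutive.toPerm _ hinv) f
  have h2 : ∑ e, f (Function.Involutive.toPerm _ hinv e) = -∑ e, f e := by
    rw [← Finset.sum_neg_distrib]
    exact Finset.sum_congr rfl fun e _ => h e
  linarith

theorem sum_signs_mul (a b : α) :
    ∑ e : α → ℤˣ, realSign (e a) * realSign (e b) =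
      if a = b then (Fintype.card (α → ℤˣ) : ℝ) else 0 := by
  split_ifs with h
  · subst h; simp [realSign_mul_self]
  · exact sum_signs_eq_zero _ a fun e => by simp [Function.update_of_ne (Ne.symm h)]

/-- If `c` or `d` equals `a`, two equal signs cancel and two factors remain. Otherwise the product
is odd in the sign at `a`. -/
theorem sum_signs_mul_mul {a b c d : α} (hab : a ≠ b) (hcd : c ≠ d) :
    ∑ e : α → ℤˣ, realSign (e a) * realSign (e b) * (realSign (e c) * realSign (e d)) =
      Fintype.card (α → ℤˣ) *
        ((if (c, d) = (a, b) then 1 else 0) + (if (c, d) = (b, a) then 1 else 0)) := by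
  by_cases hc : c = a
  · subst hc
    have h1 : ∀ e : α → ℤˣ, realSign (e c) * realSign (e b) * (realSign (e c) * realSign (e d)) =
        realSign (e b) * realSign (e d) := fun e => by
      linear_combination realSign (e b) * realSign (e d) * realSign_mul_self (e c)
    rw [Finset.sum_congr rfl fun e _ => h1 e, sum_signs_mul]
    by_cases hbd : b = d
    · subst hbd; simp [hab]
    · simp [hbd, Ne.symm hbd, hab]
  · by_cases hd : d = a
    · subst hd
      have h1 : ∀ e : α → ℤˣ,
          realSign (e d) * realSign (e b) * (realSign (e c) * realSign (e d)) =
          realSign (e b) * realSign (e c) := fun e => by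
        linear_combination realSign (e b) * realSign (e c) * realSign_mul_self (e d)
      rw [Finset.sum_congr rfl fun e _ => h1 e, sum_signs_mul]
      by_cases hbd : b = c
      · subst hbd; simp [hab]
      · simp [hbd, Ne.symm hbd, hc]
    · rw [sum_signs_eq_zero _ a]
      · simp [hc, hd]
      · intro e
        simp [Function.update_of_ne (Ne.symm hab), Function.update_of_ne hc,
          Function.update_of_ne hd]

theorem sum_signs_linear_sq (x : α → ℝ) :
    ∑ e : α → ℤˣ, (∑ a, realSign (e a) * x a) ^ 2 =
      Fintype.card (α → ℤˣ) * ∑ a, x a ^ 2 := by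
  simp_rw [sq, Finset.sum_mul_sum]
  rw [Finset.sum_comm, Finset.mul_sum]
  refine Finset.sum_congr rfl fun a _ => ?_
  rw [Finset.sum_comm]
  have : ∀ b, ∑ e : α → ℤˣ, realSign (e a) * x a * (realSign (e b) * x b) =
      if a = b then (Fintype.card (α → ℤˣ) : ℝ) * (x a * x b) else 0 := by
    intro b
    have h := sum_signs_mul a b
    rw [Finset.sum_congr rfl fun e _ => show realSign (e a) * x a * (realSign (e b) * x b) =
      realSign (e a) * realSign (e b) * (x a * x b) by ring, ← Finset.sum_mul, h]
    split_ifs <;> simp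
  simp [this]

/-- Products of signs at distinct indices are orthogonal, except that (a, b) and (b, a) give the
same product. The resulting mixed terms c a b * c b a are absorbed by the inequality of the means,
whence the factor 2. -/
theorem sum_signs_quadratic_sq_le (c : α → α → ℝ) (hc : ∀ a, c a a = 0) :
    ∑ e : α → ℤˣ, (∑ a, ∑ b, realSign (e a) * realSign (e b) * c a b) ^ 2 ≤
      Fintype.card (α → ℤˣ) * (2 * ∑ a, ∑ b, c a b ^ 2) := by
  have key : ∑ e : α → ℤˣ, (∑ a, ∑ b, realSign (e a) * realSign (e b) * c a b) ^ 2 =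
      Fintype.card (α → ℤˣ) * ∑ q : α × α, (c q.1 q.2 * c q.1 q.2 + c q.1 q.2 * c q.2 q.1) := by
    have h1 : ∀ e : α → ℤˣ, ∑ a, ∑ b, realSign (e a) * realSign (e b) * c a b =
        ∑ q : α × α, realSign (e q.1) * realSign (e q.2) * c q.1 q.2 := fun e =>
      (Fintype.sum_prod_type fun q : α × α =>
        realSign (e q.1) * realSign (e q.2) * c q.1 q.2).symm
    simp_rw [h1, sq, Finset.sum_mul_sum]
    rw [Finset.sum_comm, Finset.mul_sum]
    refine Finset.sum_congr rfl fun q _ => ?_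
    rw [Finset.sum_comm]
    have h2 : ∀ q' : α × α, ∑ e : α → ℤˣ, realSign (e q.1) * realSign (e q.2) * c q.1 q.2 *
        (realSign (e q'.1) * realSign (e q'.2) * c q'.1 q'.2) =
        (Fintype.card (α → ℤˣ) : ℝ) * ((if q' = q then c q.1 q.2 * c q'.1 q'.2 else 0) +
          (if q' = (q.2, q.1) then c q.1 q.2 * c q'.1 q'.2 else 0)) := by
      rintro ⟨c', d⟩
      obtain ⟨a, b⟩ := q
      by_cases hab : a = b
      · subst hab; simp [hc]
      by_cases hcd : c' = d
      · subst hcd; simp [hc]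
      rw [Finset.sum_congr rfl fun e _ => show
        realSign (e a) * realSign (e b) * c a b * (realSign (e c') * realSign (e d) * c c' d) =
        realSign (e a) * realSign (e b) * (realSign (e c') * realSign (e d)) * (c a b * c c' d)
        by ring, ← Finset.sum_mul, sum_signs_mul_mul hab hcd]
      simp only
      split_ifs <;> ring
    rw [Finset.sum_congr rfl fun q' _ => h2 q', ← Finset.mul_sum, Finset.sum_add_distrib]
    simp
  rw [key]
  refine mul_le_mul_of_nonneg_left ?_ (Nat.cast_nonneg _)
  have hs : ∑ q : α × α, c q.2 q.1 ^ 2 = ∑ q : α × α, c q.1 q.2 ^ 2 :=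
    Equiv.sum_comp (Equiv.prodComm α α) fun q : α × α => c q.1 q.2 ^ 2
  have hle : ∑ q : α × α, (c q.1 q.2 * c q.1 q.2 + c q.1 q.2 * c q.2 q.1) ≤
      ∑ q : α × α, (c q.1 q.2 ^ 2 + (c q.1 q.2 ^ 2 + c q.2 q.1 ^ 2) / 2) := by
    refine Finset.sum_le_sum fun q _ => ?_
    nlinarith [sq_nonneg (c q.1 q.2 - c q.2 q.1)]
  refine hle.trans (le_of_eq ?_)
  rw [Finset.sum_add_distrib, ← Finset.sum_div, Finset.sum_add_distrib, hs,
    ← Fintype.sum_prod_type (fun q : α × α => c q.1 q.2 ^ 2)]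
  ring

/-- Some choice of signs makes the sum of all the squares at most its average, and then every single
square obeys the same bound. The constant counts the forms, not the signs. -/
theorem exists_signs_fintype {ι₁ ι₂ : Type*} [Fintype ι₁] [Fintype ι₂] (x : ι₁ → α → ℝ)
    (c : ι₂ → α → α → ℝ) (hc : ∀ i a, c i a a = 0) (η : ℝ) (hx : ∀ i, ∑ a, x i a ^ 2 ≤ η)
    (hq : ∀ i, ∑ a, ∑ b, c i a b ^ 2 ≤ η) :
    ∃ e : α → ℤˣ,
      (∀ i, (∑ a, realSign (e a) * x i a) ^ 2 ≤
        (Fintype.card ι₁ + 2 * Fintype.card ι₂) * η) ∧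
      ∀ i, (∑ a, ∑ b, realSign (e a) * realSign (e b) * c i a b) ^ 2 ≤
        (Fintype.card ι₁ + 2 * Fintype.card ι₂) * η := by
  set F : (α → ℤˣ) → ℝ := fun e => ∑ i, (∑ a, realSign (e a) * x i a) ^ 2 +
    ∑ i, (∑ a, ∑ b, realSign (e a) * realSign (e b) * c i a b) ^ 2 with hF
  have hsum : ∑ e, F e ≤ ∑ _e : α → ℤˣ, (Fintype.card ι₁ + 2 * Fintype.card ι₂) * η := by
    rw [hF, Finset.sum_add_distrib, Finset.sum_comm,
      Finset.sum_comm (γ := α → ℤˣ) (α := ι₂)]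
    have h1 : ∑ i, ∑ e : α → ℤˣ, (∑ a, realSign (e a) * x i a) ^ 2 ≤
        ∑ _i : ι₁, Fintype.card (α → ℤˣ) * η := Finset.sum_le_sum fun i _ => by
      rw [sum_signs_linear_sq]
      exact mul_le_mul_of_nonneg_left (hx i) (Nat.cast_nonneg _)
    have h2 : ∑ i, ∑ e : α → ℤˣ, (∑ a, ∑ b, realSign (e a) * realSign (e b) * c i a b) ^ 2 ≤
        ∑ _i : ι₂, Fintype.card (α → ℤˣ) * (2 * η) := Finset.sum_le_sum fun i _ => by
      refine (sum_signs_quadratic_sq_le _ (hc i)).trans ?_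
      have := hq i
      gcongr
    refine (add_le_add h1 h2).trans (le_of_eq ?_)
    simp only [Finset.sum_const, Finset.card_univ, nsmul_eq_mul]
    ring
  obtain ⟨e, -, he⟩ := Finset.exists_le_of_sum_le (Finset.univ_nonempty) hsum
  have hn1 : 0 ≤ ∑ i, (∑ a, realSign (e a) * x i a) ^ 2 :=
    Finset.sum_nonneg fun _ _ => sq_nonneg _
  have hn2 : 0 ≤ ∑ i, (∑ a, ∑ b, realSign (e a) * realSign (e b) * c i a b) ^ 2 :=
    Finset.sum_nonneg fun _ _ => sq_nonneg _
  refine ⟨e, fun i => ?_, fun i => ?_⟩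
  · have := Finset.single_le_sum (f := fun i => (∑ a, realSign (e a) * x i a) ^ 2)
      (fun _ _ => sq_nonneg _) (Finset.mem_univ i)
    simp only [hF] at he this
    linarith
  · have := Finset.single_le_sum
      (f := fun i => (∑ a, ∑ b, realSign (e a) * realSign (e b) * c i a b) ^ 2)
      (fun _ _ => sq_nonneg _) (Finset.mem_univ i)
    simp only [hF] at he this
    linarith

end Signs

theorem exists_signs {α : Type*} [DecidableEq α] (A : Finset α) {ι₁ ι₂ : Type*} [Fintype ι₁]
    [Fintype ι₂] (x : ι₁ → α → ℝ) (c : ι₂ → α → α → ℝ) (hc : ∀ i a, c i a a = 0) (η : ℝ)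
    (hx : ∀ i, ∑ a ∈ A, x i a ^ 2 ≤ η) (hq : ∀ i, ∑ a ∈ A, ∑ b ∈ A, c i a b ^ 2 ≤ η) :
    ∃ e : α → ℤˣ,
      (∀ i, (∑ a ∈ A, realSign (e a) * x i a) ^ 2 ≤
        (Fintype.card ι₁ + 2 * Fintype.card ι₂) * η) ∧
      ∀ i, (∑ a ∈ A, ∑ b ∈ A, realSign (e a) * realSign (e b) * c i a b) ^ 2 ≤
        (Fintype.card ι₁ + 2 * Fintype.card ι₂) * η := by
  obtain ⟨e, h1, h2⟩ := exists_signs_fintype (α := A) (fun i a => x i a) (fun i a b => c i a b)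
    (fun i a => hc i a) η (fun i => by rw [Finset.sum_coe_sort A fun a => x i a ^ 2]; exact hx i)
    (fun i => by
      rw [Finset.sum_coe_sort A fun a => ∑ b : A, c i a b ^ 2]
      have h3 : ∀ a, ∑ b : A, c i a b ^ 2 = ∑ b ∈ A, c i a b ^ 2 := fun a =>
        Finset.sum_coe_sort A fun b => c i a b ^ 2
      simp_rw [h3]
      exact hq i)
  set e' : α → ℤˣ := fun a => if h : a ∈ A then e ⟨a, h⟩ else 1
  have he : ∀ a : A, e' a = e a := fun a => by simp [e']
  simp_rw [← he] at h1 h2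
  refine ⟨e', fun i => ?_, fun i => ?_⟩
  · rw [← Finset.sum_coe_sort A fun a => realSign (e' a) * x i a]; exact h1 i
  · rw [← Finset.sum_coe_sort A fun a => ∑ b ∈ A, realSign (e' a) * realSign (e' b) * c i a b]
    have h3 : ∀ a, ∑ b ∈ A, realSign (e' a) * realSign (e' b) * c i a b =
        ∑ b : A, realSign (e' a) * realSign (e' b) * c i a b := fun a =>
      (Finset.sum_coe_sort A fun b => realSign (e' a) * realSign (e' b) * c i a b).symm
    simp_rw [h3]
    exact h2 i

/-! ### Copies of the dyadic tree, and labels of nodes -/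

/-- The nodes of level `i` in `N` copies of the dyadic tree. -/
def nodes (N i : ℕ) : Finset (Fin N × ℕ) := Finset.univ ×ˢ Finset.range (2 ^ i)

/-- The ancestor of a node, `d` levels up. -/
def ancestor {N : ℕ} (d : ℕ) (a : Fin N × ℕ) : Fin N × ℕ := (a.1, a.2 / 2 ^ d)

/-- The sign on a node of the Haar function of its ancestor `d + 1` levels up. -/
def halfSign {N : ℕ} (d : ℕ) (a : Fin N × ℕ) : ℤˣ := (-1) ^ (a.2 / 2 ^ d)

theorem mem_nodes {N i : ℕ} {a : Fin N × ℕ} : a ∈ nodes N i ↔ a.2 < 2 ^ i := by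
  simp [nodes]

theorem ancestor_mem {N i i' : ℕ} (h : i ≤ i') {a : Fin N × ℕ} (ha : a ∈ nodes N i') :
    ancestor (i' - i) a ∈ nodes N i := by
  rw [mem_nodes] at ha ⊢
  rw [ancestor, Nat.div_lt_iff_lt_mul (by positivity), ← pow_add]
  rwa [Nat.add_sub_of_le h]

@[simp] theorem ancestor_zero {N : ℕ} (a : Fin N × ℕ) : ancestor 0 a = a := by simp [ancestor]

theorem ancestor_ancestor {N : ℕ} (d d' : ℕ) (a : Fin N × ℕ) :
    ancestor d (ancestor d' a) = ancestor (d' + d) a := by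
  simp [ancestor, Nat.div_div_eq_div_mul, pow_add]

theorem halfSign_ancestor {N : ℕ} (d d' : ℕ) (a : Fin N × ℕ) :
    halfSign d (ancestor d' a) = halfSign (d' + d) a := by
  simp [ancestor, halfSign, Nat.div_div_eq_div_mul, pow_add]

/-- The label of a node of level `g s`: the binary word of length `s` given by the signs on this
node of the signed Haar functions of the levels `g 0, …, g (s - 1)`. -/
def label {N : ℕ} (g : ℕ → ℕ) (ε : ℕ → Fin N × ℕ → ℤˣ) : ℕ → Fin N × ℕ → ℕ
  | 0 => fun _ => 0
  | s + 1 => fun a => 2 * label g ε s (ancestor (g (s + 1) - g s) a) +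
      if halfSign (g (s + 1) - g s - 1) a * ε s (ancestor (g (s + 1) - g s) a) = 1 then 0 else 1

theorem label_congr {N : ℕ} (g : ℕ → ℕ) {ε ε' : ℕ → Fin N × ℕ → ℤˣ} (s : ℕ)
    (h : ∀ t < s, ε t = ε' t) : label g ε s = label g ε' s := by
  induction s with
  | zero => rfl
  | succ s ih =>
    funext a
    simp only [label]
    rw [ih fun t ht => h t (by omega), h s (by omega)]

theorem label_lt {N : ℕ} (g : ℕ → ℕ) (ε : ℕ → Fin N × ℕ → ℤˣ) (s : ℕ) (a : Fin N × ℕ) :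
    label g ε s a < 2 ^ s := by
  induction s generalizing a with
  | zero => simp [label]
  | succ s ih =>
    have := ih (ancestor (g (s + 1) - g s) a)
    simp only [label, pow_succ]
    split_ifs <;> omega

/-! ### Choice of balanced signs for abstract forms and functionals -/

section Core

variable {N : ℕ} {V : Type*} [AddCommGroup V] [Module ℝ V]

/-- The total weight of a set of nodes of level `i`. -/
noncomputable def nodeWeight (w : Fin N → ℝ) (i : ℕ) (B : Finset (Fin N × ℕ)) : ℝ := ∑ a ∈ B, w a.1 / 2 ^ i

/-- A linear combination of the vectors attached to the nodes of level `i`. -/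
def nodeComb (e : ℕ → Fin N × ℕ → V) (i : ℕ) (B : Finset (Fin N × ℕ)) (ξ : Fin N × ℕ → ℝ) : V :=
  ∑ a ∈ B, ξ a • e i a

/-- The set of nodes of level `g s` with label `j`. -/
def block (g : ℕ → ℕ) (ε : ℕ → Fin N × ℕ → ℤˣ) (s j : ℕ) : Finset (Fin N × ℕ) :=
  (nodes N (g s)).filter fun a => label g ε s a = j

/-- The signed sum of the vectors attached to a block. -/
def blockVec (g : ℕ → ℕ) (ε : ℕ → Fin N × ℕ → ℤˣ) (e : ℕ → Fin N × ℕ → V) (s j : ℕ) : V :=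
  nodeComb e (g s) (block g ε s j) fun a => realSign (ε s a)

theorem nodeWeight_nonneg {w : Fin N → ℝ} (hw : ∀ l, 0 ≤ w l) (i : ℕ) (B : Finset (Fin N × ℕ)) :
    0 ≤ nodeWeight w i B :=
  Finset.sum_nonneg fun a _ => div_nonneg (hw a.1) (by positivity)

theorem nodeWeight_mono {w : Fin N → ℝ} (hw : ∀ l, 0 ≤ w l) (i : ℕ) {B B' : Finset (Fin N × ℕ)}
    (h : B ⊆ B') : nodeWeight w i B ≤ nodeWeight w i B' :=
  Finset.sum_le_sum_of_subset_of_nonneg h fun a _ _ => div_nonneg (hw a.1) (by positivity)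

theorem nodeWeight_nodes {w : Fin N → ℝ} (hw1 : ∑ l, w l = 1) (i : ℕ) :
    nodeWeight w i (nodes N i) = 1 := by
  rw [nodeWeight, nodes, Finset.sum_product]
  simp only [Finset.sum_const, Finset.card_range, nsmul_eq_mul]
  rw [← hw1]
  refine Finset.sum_congr rfl fun l _ => ?_
  push_cast
  field_simp

theorem nodeWeight_le_one {w : Fin N → ℝ} (hw : ∀ l, 0 ≤ w l) (hw1 : ∑ l, w l = 1) (i : ℕ)
    {B : Finset (Fin N × ℕ)} (h : B ⊆ nodes N i) : nodeWeight w i B ≤ 1 :=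
  (nodeWeight_mono hw i h).trans (nodeWeight_nodes hw1 i).le

theorem nodeWeight_fiber (w : Fin N → ℝ) {i i' : ℕ} (h : i ≤ i') {b : Fin N × ℕ}
    (hb : b ∈ nodes N i) :
    nodeWeight w i' ((nodes N i').filter fun a => ancestor (i' - i) a = b) = w b.1 / 2 ^ i := by
  obtain ⟨d, rfl⟩ := Nat.exists_eq_add_of_le h
  have hd : i + d - i = d := by omega
  rw [hd]
  -- The descendants of index K, d levels below, are K * 2^d + r with r < 2^d.
  have himg : ((nodes N (i + d)).filter fun a => ancestor d a = b) =
      (Finset.range (2 ^ d)).image fun r => (b.1, b.2 * 2 ^ d + r) := by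
    ext ⟨l, K⟩
    obtain ⟨l', K'⟩ := b
    rw [mem_nodes] at hb
    simp only [Finset.mem_filter, mem_nodes, ancestor, Prod.mk.injEq, Finset.mem_image,
      Finset.mem_range] at hb ⊢
    constructor
    · rintro ⟨-, rfl, rfl⟩
      exact ⟨K % 2 ^ d, Nat.mod_lt _ (by positivity), rfl, Nat.div_add_mod' K (2 ^ d)⟩
    · rintro ⟨r, hr, rfl, rfl⟩
      refine ⟨?_, rfl, ?_⟩
      · rw [pow_add]
        nlinarith [Nat.mul_le_mul_right (2 ^ d) (Nat.succ_le_of_lt hb)]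
      · rw [mul_comm, Nat.mul_add_div (by positivity), Nat.div_eq_of_lt hr, add_zero]
  rw [nodeWeight, himg, Finset.sum_image]
  · simp only [Finset.sum_const, Finset.card_range, nsmul_eq_mul]
    push_cast
    rw [pow_add]
    field_simp
  · intro r _ r' _ hrr
    simpa using hrr

/-- The coefficients are taken to be the signs of the values of `Λ`. -/
theorem sum_abs_functional_le (w : Fin N → ℝ) (e : ℕ → Fin N × ℕ → V) (i : ℕ) (Λ : V →ₗ[ℝ] ℝ)
    (C κ : ℝ)
    (hΛ : ∀ B ⊆ nodes N i, ∀ ξ : Fin N × ℕ → ℝ, (∀ a, |ξ a| ≤ 1) →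
      |Λ (nodeComb e i B ξ)| ≤ C * nodeWeight w i B ^ κ)
    {B : Finset (Fin N × ℕ)} (hB : B ⊆ nodes N i) :
    ∑ a ∈ B, |Λ (e i a)| ≤ C * nodeWeight w i B ^ κ := by
  have h := hΛ B hB (fun a => if 0 ≤ Λ (e i a) then 1 else -1) fun a => by split_ifs <;> simp
  refine le_trans (le_of_eq ?_) ((le_abs_self _).trans h)
  rw [nodeComb, map_sum]
  refine Finset.sum_congr rfl fun a _ => ?_
  rw [map_smul, smul_eq_mul]
  split_ifs with h0
  · rw [abs_of_nonneg h0, one_mul]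
  · rw [abs_of_neg (not_le.mp h0)]; ring

/-- The sum of squares is at most the maximum times the sum of the absolute values. A single node
has weight at most 2^(-i), which bounds the maximum; all nodes together have weight 1, which bounds
the sum. -/
theorem sum_sq_functional_le {w : Fin N → ℝ} (hw : ∀ l, 0 ≤ w l) (hw1 : ∑ l, w l = 1) (i : ℕ)
    (x : Fin N × ℕ → ℝ) {C κ : ℝ} (hC : 0 ≤ C) (hκ : 0 ≤ κ)
    (hx : ∀ B ⊆ nodes N i, ∑ a ∈ B, |x a| ≤ C * nodeWeight w i B ^ κ) :
    ∑ a ∈ nodes N i, x a ^ 2 ≤ C ^ 2 * ((1 / 2 : ℝ) ^ i) ^ κ := by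
  have hw' : ∀ l, w l ≤ 1 := fun l => by
    rw [← hw1]; exact Finset.single_le_sum (fun l _ => hw l) (Finset.mem_univ l)
  have h1 : ∀ a ∈ nodes N i, |x a| ≤ C * ((1 / 2 : ℝ) ^ i) ^ κ := by
    intro a ha
    have h := hx {a} (Finset.singleton_subset_iff.mpr ha)
    simp only [Finset.sum_singleton, nodeWeight] at h
    refine h.trans (mul_le_mul_of_nonneg_left ?_ hC)
    refine Real.rpow_le_rpow (div_nonneg (hw _) (by positivity)) ?_ hκ
    rw [one_div, inv_pow, ← one_div]
    exact div_le_div_of_nonneg_right (hw' _) (by positivity)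
  have h2 := hx (nodes N i) subset_rfl
  rw [nodeWeight_nodes hw1, Real.one_rpow, mul_one] at h2
  calc ∑ a ∈ nodes N i, x a ^ 2 ≤ ∑ a ∈ nodes N i, C * ((1 / 2 : ℝ) ^ i) ^ κ * |x a| := by
        refine Finset.sum_le_sum fun a ha => ?_
        rw [← sq_abs, sq]
        exact mul_le_mul_of_nonneg_right (h1 a ha) (abs_nonneg _)
    _ = C * ((1 / 2 : ℝ) ^ i) ^ κ * ∑ a ∈ nodes N i, |x a| := by rw [Finset.mul_sum]
    _ ≤ C * ((1 / 2 : ℝ) ^ i) ^ κ * C := by gcongr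
    _ = _ := by ring

/-- Bilinear forms with `|β(u, v)| ≤ C |supp u|^x |supp v|^y` on combinations with coefficients
in `[-1, 1]` of the vectors attached to the nodes of one level. -/
def FormBound (k : ℕ) (w : Fin N → ℝ) (e : ℕ → Fin N × ℕ → V) (β : V →ₗ[ℝ] V →ₗ[ℝ] ℝ)
    (C x y : ℝ) : Prop :=
  ∀ i < k, ∀ i' < k, ∀ B ⊆ nodes N i, ∀ B' ⊆ nodes N i', ∀ ξ ζ : Fin N × ℕ → ℝ,
    (∀ a, |ξ a| ≤ 1) → (∀ a, |ζ a| ≤ 1) →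
    |β (nodeComb e i B ξ) (nodeComb e i' B' ζ)| ≤
      C * nodeWeight w i B ^ x * nodeWeight w i' B' ^ y

theorem FormBound.flip {k : ℕ} {w : Fin N → ℝ} {e : ℕ → Fin N × ℕ → V}
    {β : V →ₗ[ℝ] V →ₗ[ℝ] ℝ} {C x y : ℝ} (h : FormBound k w e β C x y) :
    FormBound k w e β.flip C y x := by
  intro i hi i' hi' B hB B' hB' ξ ζ hξ hζ
  rw [LinearMap.flip_apply]
  refine (h i' hi' i hi B' hB' B hB ζ ξ hζ hξ).trans (le_of_eq (by ring))

theorem nodeComb_singleton (e : ℕ → Fin N × ℕ → V) (i : ℕ) (a : Fin N × ℕ) :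
    nodeComb e i {a} (fun _ => 1) = e i a := by simp [nodeComb]

theorem FormBound.sum_abs_le {k : ℕ} {w : Fin N → ℝ} {e : ℕ → Fin N × ℕ → V}
    {β : V →ₗ[ℝ] V →ₗ[ℝ] ℝ} {C x y : ℝ} (h : FormBound k w e β C x y) {i : ℕ} (hi : i < k)
    {a : Fin N × ℕ} (ha : a ∈ nodes N i) {B : Finset (Fin N × ℕ)} (hB : B ⊆ nodes N i) :
    ∑ b ∈ B, |β (e i a) (e i b)| ≤ C * (w a.1 / 2 ^ i) ^ x * nodeWeight w i B ^ y := by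
  refine sum_abs_functional_le w e i (β (e i a)) _ y (fun B' hB' ξ hξ => ?_) hB
  have := h i hi i hi {a} (Finset.singleton_subset_iff.mpr ha) B' hB' (fun _ => 1) ξ
    (fun _ => by simp) hξ
  rw [nodeComb_singleton] at this
  simpa [nodeWeight] using this

/-- For a node `a` of weight μ, the row of `a` is a functional with constant C μ^x, so its squares
sum to at most C² μ^(2x) 2^(-iy). Since 2x ≥ 1 and μ ≤ 1, μ^(2x) ≤ μ, and the weights μ add up to 1.
-/
theorem FormBound.sum_sq_le_of_half_le {k : ℕ} {w : Fin N → ℝ} (hw : ∀ l, 0 ≤ w l)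
    (hw1 : ∑ l, w l = 1) {e : ℕ → Fin N × ℕ → V} {β : V →ₗ[ℝ] V →ₗ[ℝ] ℝ} {C x y : ℝ}
    (hC : 0 ≤ C) (hx : 1 / 2 ≤ x) (hy : 0 ≤ y) (h : FormBound k w e β C x y) {i : ℕ}
    (hi : i < k) :
    ∑ a ∈ nodes N i, ∑ b ∈ nodes N i, β (e i a) (e i b) ^ 2 ≤ C ^ 2 * ((1 / 2 : ℝ) ^ i) ^ y := by
  have h1 : ∀ a ∈ nodes N i, ∑ b ∈ nodes N i, β (e i a) (e i b) ^ 2 ≤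
      C ^ 2 * ((1 / 2 : ℝ) ^ i) ^ y * (w a.1 / 2 ^ i) := by
    intro a ha
    have hμ : 0 ≤ w a.1 / 2 ^ i := div_nonneg (hw _) (by positivity)
    have hμ1 : w a.1 / 2 ^ i ≤ 1 := by
      have := nodeWeight_le_one hw hw1 i (Finset.singleton_subset_iff.mpr ha)
      simpa [nodeWeight] using this
    have := sum_sq_functional_le hw hw1 i (fun b => β (e i a) (e i b))
      (C := C * (w a.1 / 2 ^ i) ^ x) (by positivity) hy fun B hB => h.sum_abs_le hi ha hB
    refine this.trans ?_
    have h2 : ((w a.1 / 2 ^ i) ^ x) ^ 2 ≤ w a.1 / 2 ^ i := by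
      rw [← Real.rpow_natCast, ← Real.rpow_mul hμ]
      rcases hμ.eq_or_lt with h0 | h0
      · rw [← h0, Real.zero_rpow]; push_cast; linarith
      · calc (w a.1 / 2 ^ i) ^ (x * (2 : ℕ)) ≤ (w a.1 / 2 ^ i) ^ (1 : ℝ) :=
              Real.rpow_le_rpow_of_exponent_ge h0 hμ1 (by push_cast; linarith)
          _ = _ := Real.rpow_one _
    rw [mul_pow]
    calc C ^ 2 * ((w a.1 / 2 ^ i) ^ x) ^ 2 * ((1 / 2 : ℝ) ^ i) ^ y
        ≤ C ^ 2 * (w a.1 / 2 ^ i) * ((1 / 2 : ℝ) ^ i) ^ y := by gcongr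
      _ = _ := by ring
  refine (Finset.sum_le_sum h1).trans ?_
  rw [← Finset.mul_sum]
  have := nodeWeight_nodes hw1 i
  rw [nodeWeight] at this
  rw [this, mul_one]

theorem rpow_half_pow_mono {i : ℕ} {κ y : ℝ} (h : κ ≤ y) :
    ((1 / 2 : ℝ) ^ i) ^ y ≤ ((1 / 2 : ℝ) ^ i) ^ κ :=
  Real.rpow_le_rpow_of_exponent_ge (by positivity)
    (pow_le_one₀ (by norm_num) (by norm_num)) h

/-- One of the two exponents is at least 1/2; rows are used if it is x, columns if it is y. -/
theorem FormBound.sum_sq_le {k : ℕ} {w : Fin N → ℝ} (hw : ∀ l, 0 ≤ w l)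
    (hw1 : ∑ l, w l = 1) {e : ℕ → Fin N × ℕ → V} {β : V →ₗ[ℝ] V →ₗ[ℝ] ℝ} {C x y κ : ℝ}
    (hC : 0 ≤ C) (hκ : 0 ≤ κ) (hx : κ ≤ x) (hy : κ ≤ y) (hxy : x + y = 1)
    (h : FormBound k w e β C x y) {i : ℕ} (hi : i < k) :
    ∑ a ∈ nodes N i, ∑ b ∈ nodes N i, β (e i a) (e i b) ^ 2 ≤
      C ^ 2 * ((1 / 2 : ℝ) ^ i) ^ κ := by
  rcases le_total (1 / 2) x with hx2 | hx2
  · refine (h.sum_sq_le_of_half_le hw hw1 hC hx2 (hκ.trans hy) hi).trans ?_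
    have := rpow_half_pow_mono (i := i) hy
    gcongr
  · have h2 := h.flip.sum_sq_le_of_half_le hw hw1 hC (by linarith) (hκ.trans hx) hi
    rw [Finset.sum_comm] at h2
    simp only [LinearMap.flip_apply] at h2
    refine h2.trans ?_
    have := rpow_half_pow_mono (i := i) hx
    gcongr

/-- With η a the sign of the diagonal entry at `a`, the average over signs s of β(Σ s_a η_a e_a, Σ
s_b e_b) retains only the absolute values of the diagonal entries. Each term of the average obeys
the form bound, which is linear in the weight because x + y = 1. -/
theorem FormBound.sum_abs_diag_le {k : ℕ} {w : Fin N → ℝ} (hw : ∀ l, 0 ≤ w l)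
    {e : ℕ → Fin N × ℕ → V} {β : V →ₗ[ℝ] V →ₗ[ℝ] ℝ} {C x y : ℝ} (hx : 0 ≤ x) (hy : 0 ≤ y)
    (hxy : x + y = 1) (h : FormBound k w e β C x y) {i : ℕ} (hi : i < k)
    {B : Finset (Fin N × ℕ)} (hB : B ⊆ nodes N i) :
    ∑ a ∈ B, |β (e i a) (e i a)| ≤ C * nodeWeight w i B := by
  set η : Fin N × ℕ → ℝ := fun a => if 0 ≤ β (e i a) (e i a) then 1 else -1
  have hη : ∀ a, |η a| ≤ 1 := fun a => by simp only [η]; split_ifs <;> simp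
  have hη2 : ∀ a, η a * β (e i a) (e i a) = |β (e i a) (e i a)| := fun a => by
    simp only [η]
    split_ifs with h0
    · rw [abs_of_nonneg h0, one_mul]
    · rw [abs_of_neg (not_le.mp h0)]; ring
  have hW : nodeWeight w i B ^ x * nodeWeight w i B ^ y = nodeWeight w i B := by
    rw [← Real.rpow_add_of_nonneg (nodeWeight_nonneg hw i B) hx hy, hxy, Real.rpow_one]
  set K : ℝ := ((Fintype.card (B → ℤˣ) : ℕ) : ℝ)
  have hK : 0 < K := by
    have : 0 < Fintype.card (B → ℤˣ) := Fintype.card_pos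
    exact Nat.cast_pos.mpr this
  have h1 : ∀ s : B → ℤˣ, ∑ a : B, ∑ b : B, realSign (s a) * realSign (s b) *
      (η a * β (e i a) (e i b)) ≤ C * nodeWeight w i B := by
    intro s
    set s' : Fin N × ℕ → ℝ := fun a => if h : a ∈ B then realSign (s ⟨a, h⟩) else 1
    have hs : ∀ a : B, s' a = realSign (s a) := fun a => by simp [s']
    have hs1 : ∀ a, |s' a| ≤ 1 := fun a => by
      simp only [s']; split_ifs <;> simp [abs_realSign]
    have hb := h i hi i hi B hB B hB (fun a => s' a * η a) s'
      (fun a => by rw [abs_mul]; exact mul_le_one₀ (hs1 a) (abs_nonneg _) (hη a)) hs1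
    rw [mul_assoc, hW] at hb
    refine le_trans (le_of_eq ?_) ((le_abs_self _).trans hb)
    simp only [nodeComb, map_sum, LinearMap.sum_apply, map_smul, LinearMap.smul_apply,
      smul_eq_mul]
    rw [Finset.sum_comm, ← Finset.sum_coe_sort B]
    refine Finset.sum_congr rfl fun b _ => ?_
    rw [Finset.mul_sum, ← Finset.sum_coe_sort B]
    refine Finset.sum_congr rfl fun a _ => ?_
    rw [hs, hs]; ring
  have h2 : ∑ s : B → ℤˣ, ∑ a : B, ∑ b : B, realSign (s a) * realSign (s b) *
      (η a * β (e i a) (e i b)) = K * ∑ a ∈ B, |β (e i a) (e i a)| := by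
    rw [Finset.sum_comm, ← Finset.sum_coe_sort B, Finset.mul_sum]
    refine Finset.sum_congr rfl fun a _ => ?_
    rw [Finset.sum_comm]
    simp_rw [← Finset.sum_mul, sum_signs_mul]
    simp [hη2, K]
  have h3 := Finset.sum_le_sum fun s (_ : s ∈ (Finset.univ : Finset (B → ℤˣ))) => h1 s
  rw [h2] at h3
  simp only [Finset.sum_const, Finset.card_univ, nsmul_eq_mul] at h3
  exact le_of_mul_le_mul_left h3 hK

/-- Linear functionals with `|Λ u| ≤ C |supp u|^κ` on combinations with coefficients in `[-1, 1]` of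
the vectors attached to the nodes of one level. -/
def FunctionalBound (k : ℕ) (w : Fin N → ℝ) (e : ℕ → Fin N × ℕ → V) (Λ : V →ₗ[ℝ] ℝ)
    (C κ : ℝ) : Prop :=
  ∀ i < k, ∀ B ⊆ nodes N i, ∀ ξ : Fin N × ℕ → ℝ, (∀ a, |ξ a| ≤ 1) →
    |Λ (nodeComb e i B ξ)| ≤ C * nodeWeight w i B ^ κ

theorem form_nodeComb (e : ℕ → Fin N × ℕ → V) (β : V →ₗ[ℝ] V →ₗ[ℝ] ℝ) (i i' : ℕ)
    (B B' : Finset (Fin N × ℕ)) (ξ ζ : Fin N × ℕ → ℝ) :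
    β (nodeComb e i B ξ) (nodeComb e i' B' ζ) =
      ∑ a ∈ B, ∑ b ∈ B', ξ a * ζ b * β (e i a) (e i' b) := by
  simp only [nodeComb, map_sum, LinearMap.sum_apply, map_smul, LinearMap.smul_apply, smul_eq_mul,
    Finset.mul_sum]
  rw [Finset.sum_comm]
  exact Finset.sum_congr rfl fun a _ => Finset.sum_congr rfl fun b _ => by ring

theorem form_nodeComb_filter (e : ℕ → Fin N × ℕ → V) (β : V →ₗ[ℝ] V →ₗ[ℝ] ℝ) (i : ℕ)
    (lb : Fin N × ℕ → ℕ) (ε : Fin N × ℕ → ℤˣ) (j j' : ℕ) :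
    β (nodeComb e i ((nodes N i).filter fun a => lb a = j) fun a => realSign (ε a))
      (nodeComb e i ((nodes N i).filter fun a => lb a = j') fun a => realSign (ε a)) =
    ∑ a ∈ nodes N i, ∑ b ∈ nodes N i, realSign (ε a) * realSign (ε b) *
      (if a ≠ b ∧ lb a = j ∧ lb b = j' then β (e i a) (e i b) else 0) +
    ∑ a ∈ nodes N i, if lb a = j ∧ lb a = j' then β (e i a) (e i a) else 0 := by
  rw [form_nodeComb, Finset.sum_filter, ← Finset.sum_add_distrib]
  refine Finset.sum_congr rfl fun a ha => ?_
  have h0 : (if lb a = j ∧ lb a = j' then β (e i a) (e i a) else 0) =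
      ∑ b ∈ nodes N i, if a = b then
        (if lb a = j ∧ lb a = j' then β (e i a) (e i a) else 0) else 0 := by
    rw [Finset.sum_ite_eq, if_pos ha]
  rw [h0, ← Finset.sum_add_distrib, Finset.sum_filter]
  by_cases hj : lb a = j
  · rw [if_pos hj]
    refine Finset.sum_congr rfl fun b _ => ?_
    by_cases hab : a = b
    · subst hab
      by_cases hj' : lb a = j'
      · simp [hj, realSign_mul_self]
      · simp [hj']
    · by_cases hj' : lb b = j'
      · simp [hj, hj', hab]
      · simp [hj', hab]
  · rw [if_neg hj]
    symm
    refine Finset.sum_eq_zero fun b _ => ?_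
    simp [hj]

/-- The second moment argument at one level, with the label indicators built into the coefficients:
there is one linear form for each label and each member of ι or ι', and one quadratic form for each
pair of labels. The terms with a = b of the quadratic form do not depend on the signs, so they are
subtracted. -/
theorem exists_signs_level {ι ι' : Type*} [Fintype ι] [Fintype ι'] {k : ℕ} {w : Fin N → ℝ}
    (hw : ∀ l, 0 ≤ w l) (hw1 : ∑ l, w l = 1) {e : ℕ → Fin N × ℕ → V} {β : V →ₗ[ℝ] V →ₗ[ℝ] ℝ}
    {C x y κ : ℝ} (hC : 0 ≤ C) (hκ : 0 ≤ κ) (hx : κ ≤ x) (hy : κ ≤ y) (hxy : x + y = 1)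
    (hβ : FormBound k w e β C x y) {i : ℕ} (hi : i < k) (ψ : ι → V →ₗ[ℝ] ℝ)
    (hψ : ∀ r, FunctionalBound k w e (ψ r) C κ) (γ : ι' → Fin N × ℕ → ℝ)
    (hγ : ∀ r, ∀ a ∈ nodes N i, |γ r a| ≤ C * (w a.1 / 2 ^ i)) (lb : Fin N × ℕ → ℕ) (J : ℕ)
    {δ : ℝ} (hδ : 0 ≤ δ)
    (hsmall : ((J * (Fintype.card ι + Fintype.card ι') : ℕ) + 2 * (J * J : ℕ)) *
      (C ^ 2 * ((1 / 2 : ℝ) ^ i) ^ κ) ≤ δ ^ 2) :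
    ∃ ε : Fin N × ℕ → ℤˣ,
      (∀ j < J, ∀ r, |ψ r (nodeComb e i ((nodes N i).filter fun a => lb a = j)
        fun a => realSign (ε a))| ≤ δ) ∧
      (∀ j < J, ∀ r, |∑ a ∈ (nodes N i).filter fun a => lb a = j, realSign (ε a) * γ r a| ≤ δ) ∧
      ∀ j < J, ∀ j' < J,
        |β (nodeComb e i ((nodes N i).filter fun a => lb a = j) fun a => realSign (ε a))
          (nodeComb e i ((nodes N i).filter fun a => lb a = j') fun a => realSign (ε a)) -
        ∑ a ∈ nodes N i, if lb a = j ∧ lb a = j' then β (e i a) (e i a) else 0| ≤ δ := by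
  set η := C ^ 2 * ((1 / 2 : ℝ) ^ i) ^ κ
  set X : ι ⊕ ι' → Fin N × ℕ → ℝ := fun r a => Sum.elim (fun r => ψ r (e i a)) (fun r => γ r a) r
  have hX : ∀ r, ∑ a ∈ nodes N i, X r a ^ 2 ≤ η := by
    rintro (r | r)
    · exact sum_sq_functional_le hw hw1 i _ hC hκ fun B hB =>
        sum_abs_functional_le w e i (ψ r) C κ (hψ r i hi) hB
    · have h1 := sum_sq_functional_le (κ := 1) hw hw1 i (γ r) hC zero_le_one fun B hB => by
        rw [Real.rpow_one, nodeWeight, Finset.mul_sum]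
        exact Finset.sum_le_sum fun a ha => hγ r a (hB ha)
      refine h1.trans ?_
      have := rpow_half_pow_mono (i := i) (show κ ≤ 1 by linarith)
      simp only [η]
      gcongr
  obtain ⟨ε, h1, h2⟩ := exists_signs (nodes N i) (ι₁ := Fin J × (ι ⊕ ι')) (ι₂ := Fin J × Fin J)
    (fun r a => if lb a = r.1 then X r.2 a else 0)
    (fun r a b => if a ≠ b ∧ lb a = r.1 ∧ lb b = r.2 then β (e i a) (e i b) else 0)
    (fun r a => by simp) η
    (fun r => by
      refine le_trans (Finset.sum_le_sum fun a _ => ?_) (hX r.2)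
      split_ifs
      · exact le_rfl
      · rw [zero_pow two_ne_zero]; exact sq_nonneg _)
    (fun r => by
      refine le_trans (Finset.sum_le_sum fun a _ => Finset.sum_le_sum fun b _ => ?_)
        (hβ.sum_sq_le hw hw1 hC hκ hx hy hxy hi)
      split_ifs
      · exact le_rfl
      · rw [zero_pow two_ne_zero]; exact sq_nonneg _)
  have hcard : ((Fintype.card (Fin J × (ι ⊕ ι')) : ℝ) + 2 * Fintype.card (Fin J × Fin J)) * η ≤
      δ ^ 2 := by
    simpa [Fintype.card_prod, Fintype.card_sum] using hsmall
  have hlin : ∀ j < J, ∀ r, |∑ a ∈ (nodes N i).filter fun a => lb a = j,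
      realSign (ε a) * X r a| ≤ δ := by
    intro j hj r
    have h := abs_le_of_sq_le_sq ((h1 (⟨j, hj⟩, r)).trans hcard) hδ
    rw [Finset.sum_filter]
    refine le_trans (le_of_eq ?_) h
    congr 1
    exact Finset.sum_congr rfl fun a _ => by simp
  refine ⟨ε, fun j hj r => ?_, fun j hj r => hlin j hj (Sum.inr r), fun j hj j' hj' => ?_⟩
  · have := hlin j hj (Sum.inl r)
    simpa [nodeComb, X] using this
  · rw [form_nodeComb_filter, add_sub_cancel_right]
    exact abs_le_of_sq_le_sq ((h2 (⟨j, hj⟩, ⟨j', hj'⟩)).trans hcard) hδ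

/-- The sum of the diagonal entries of a form at level `i`. -/
def diagSum (e : ℕ → Fin N × ℕ → V) (β : V →ₗ[ℝ] V →ₗ[ℝ] ℝ) (i : ℕ) : ℝ :=
  ∑ a ∈ nodes N i, β (e i a) (e i a)

/-- The sum of the diagonal entries of a form at level `g t` over the descendants of a block of
level `g s`. -/
def blockDiagSum (g : ℕ → ℕ) (ε : ℕ → Fin N × ℕ → ℤˣ) (e : ℕ → Fin N × ℕ → V)
    (β : V →ₗ[ℝ] V →ₗ[ℝ] ℝ) (t s j : ℕ) : ℝ :=
  ∑ a ∈ nodes N (g t), if label g ε s (ancestor (g t - g s) a) = j then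
    β (e (g t) a) (e (g t) a) else 0

/-- The signed difference of the diagonal sums at level `g t` over the two halves of a node of
level `g s`. -/
def halfDiff (g : ℕ → ℕ) (e : ℕ → Fin N × ℕ → V) (β : V →ₗ[ℝ] V →ₗ[ℝ] ℝ) (t s : ℕ)
    (b : Fin N × ℕ) : ℝ :=
  ∑ a ∈ (nodes N (g t)).filter fun a => ancestor (g t - g s) a = b,
    realSign (halfSign (g t - g s - 1) a) * β (e (g t) a) (e (g t) a)

/-- The descendants of `b` have the same total weight as `b`, and the absolute diagonal sum is
linear in the weight. -/
theorem abs_halfDiff_le {k : ℕ} {w : Fin N → ℝ} (hw : ∀ l, 0 ≤ w l) {e : ℕ → Fin N × ℕ → V}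
    {β : V →ₗ[ℝ] V →ₗ[ℝ] ℝ} {C x y : ℝ} (hx : 0 ≤ x) (hy : 0 ≤ y) (hxy : x + y = 1)
    (h : FormBound k w e β C x y) (g : ℕ → ℕ) {t s : ℕ} (ht : g t < k) (hst : g s ≤ g t)
    {b : Fin N × ℕ} (hb : b ∈ nodes N (g s)) :
    |halfDiff g e β t s b| ≤ C * (w b.1 / 2 ^ (g s)) := by
  rw [halfDiff, ← nodeWeight_fiber w hst hb]
  refine (Finset.abs_sum_le_sum_abs _ _).trans ?_
  refine le_trans (le_of_eq ?_) (h.sum_abs_diag_le hw hx hy hxy ht (Finset.filter_subset _ _))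
  exact Finset.sum_congr rfl fun a _ => by rw [abs_mul, abs_realSign, one_mul]

/-- The descendants of block j / 2 are split into two parts by the sign of the signed Haar functions
of level g s. Each part carries half of the sum, plus or minus half of the difference of the parts;
the last binary digit of j selects the part. The difference is linear in the signs of level s. -/
theorem blockDiagSum_succ (g : ℕ → ℕ) (ε : ℕ → Fin N × ℕ → ℤˣ) (e : ℕ → Fin N × ℕ → V)
    (β : V →ₗ[ℝ] V →ₗ[ℝ] ℝ) {t s : ℕ} (h1 : g s < g (s + 1)) (h2 : g (s + 1) ≤ g t) (j : ℕ) :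
    blockDiagSum g ε e β t (s + 1) j = (blockDiagSum g ε e β t s (j / 2) +
      (if j % 2 = 0 then 1 else -1) *
        ∑ b ∈ block g ε s (j / 2), realSign (ε s b) * halfDiff g e β t s b) / 2 := by
  -- The nodes of level g t are grouped by their ancestors of level g s.
  have hfib : ∑ b ∈ block g ε s (j / 2), realSign (ε s b) * halfDiff g e β t s b =
      ∑ a ∈ nodes N (g t), if label g ε s (ancestor (g t - g s) a) = j / 2 then
        realSign (ε s (ancestor (g t - g s) a)) *
          (realSign (halfSign (g t - g s - 1) a) * β (e (g t) a) (e (g t) a)) else 0 := by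
    rw [block, Finset.sum_filter, ← Finset.sum_fiberwise_of_maps_to
      (t := nodes N (g s)) (g := ancestor (g t - g s)) fun a ha => ancestor_mem (by omega) ha]
    refine Finset.sum_congr rfl fun b _ => ?_
    rw [halfDiff, Finset.mul_sum]
    split_ifs with hb
    · refine Finset.sum_congr rfl fun a ha => ?_
      rw [(Finset.mem_filter.mp ha).2, if_pos hb]
    · symm
      refine Finset.sum_eq_zero fun a ha => ?_
      rw [(Finset.mem_filter.mp ha).2, if_neg hb]
  rw [hfib, blockDiagSum, blockDiagSum, Finset.mul_sum, ← Finset.sum_add_distrib,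
    Finset.sum_div]
  refine Finset.sum_congr rfl fun a _ => ?_
  have hl : label g ε (s + 1) (ancestor (g t - g (s + 1)) a) =
      2 * label g ε s (ancestor (g t - g s) a) +
      if halfSign (g t - g s - 1) a * ε s (ancestor (g t - g s) a) = 1 then 0 else 1 := by
    simp only [label, ancestor_ancestor, halfSign_ancestor]
    rw [show g t - g (s + 1) + (g (s + 1) - g s) = g t - g s by omega,
      show g t - g (s + 1) + (g (s + 1) - g s - 1) = g t - g s - 1 by omega]
  rw [hl]
  set q := label g ε s (ancestor (g t - g s) a)
  rcases Int.units_eq_one_or (halfSign (g t - g s - 1) a) with hh | hh <;>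
  rcases Int.units_eq_one_or (ε s (ancestor (g t - g s) a)) with he | he <;>
  rw [hh, he] <;>
  rcases Nat.mod_two_eq_zero_or_one j with hj | hj <;>
  by_cases hq : q = j / 2 <;>
  simp [hj, hq] <;> omega

theorem block_congr (g : ℕ → ℕ) {ε ε' : ℕ → Fin N × ℕ → ℤˣ} (s : ℕ)
    (h : ∀ t < s, ε t = ε' t) (j : ℕ) : block g ε s j = block g ε' s j := by
  rw [block, block, label_congr g s h]

theorem blockVec_congr (g : ℕ → ℕ) {ε ε' : ℕ → Fin N × ℕ → ℤˣ} (e : ℕ → Fin N × ℕ → V) (s : ℕ)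
    (h : ∀ t ≤ s, ε t = ε' t) (j : ℕ) : blockVec g ε e s j = blockVec g ε' e s j := by
  rw [blockVec, blockVec, block_congr g s fun t ht => h t ht.le, h s le_rfl]

theorem blockDiagSum_congr (g : ℕ → ℕ) {ε ε' : ℕ → Fin N × ℕ → ℤˣ} (e : ℕ → Fin N × ℕ → V)
    (β : V →ₗ[ℝ] V →ₗ[ℝ] ℝ) (t s : ℕ) (h : ∀ t < s, ε t = ε' t) (j : ℕ) :
    blockDiagSum g ε e β t s j = blockDiagSum g ε' e β t s j := by
  rw [blockDiagSum, blockDiagSum, label_congr g s h]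

/-- Evaluating the form against a block vector that is already fixed gives one more functional of
the same kind, since a block has weight at most 1. Smallness of β between different levels thus
becomes a linear condition on the newer signs. -/
theorem FormBound.functionalBound_flip {k : ℕ} {w : Fin N → ℝ} (hw : ∀ l, 0 ≤ w l)
    (hw1 : ∑ l, w l = 1) {e : ℕ → Fin N × ℕ → V} {β : V →ₗ[ℝ] V →ₗ[ℝ] ℝ} {C x y κ : ℝ}
    (hC : 0 ≤ C) (hκ : 0 ≤ κ) (hx : κ ≤ x) (hy : 0 ≤ y) (h : FormBound k w e β C x y) (g : ℕ → ℕ)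
    (ε : ℕ → Fin N × ℕ → ℤˣ) {t : ℕ} (ht : g t < k) (j : ℕ) :
    FunctionalBound k w e (β.flip (blockVec g ε e t j)) C κ := by
  intro i hi B hB ξ hξ
  rw [LinearMap.flip_apply]
  have hB' : block g ε t j ⊆ nodes N (g t) := Finset.filter_subset _ _
  refine (h i hi (g t) ht B hB _ hB' ξ _ hξ fun a => (abs_realSign _).le).trans ?_
  have h1 : nodeWeight w (g t) (block g ε t j) ^ y ≤ 1 :=
    Real.rpow_le_one (nodeWeight_nonneg hw _ _) (nodeWeight_le_one hw hw1 _ hB') hy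
  have h2 : nodeWeight w i B ^ x ≤ nodeWeight w i B ^ κ :=
    Real.rpow_le_rpow_of_exponent_ge' (nodeWeight_nonneg hw _ _) (nodeWeight_le_one hw hw1 _ hB)
      hκ hx
  have h3 : 0 ≤ nodeWeight w i B ^ κ := Real.rpow_nonneg (nodeWeight_nonneg hw _ _) _
  calc C * nodeWeight w i B ^ x * nodeWeight w (g t) (block g ε t j) ^ y
      ≤ C * nodeWeight w i B ^ κ * 1 := by
        gcongr
        exact Real.rpow_nonneg (nodeWeight_nonneg hw _ _) _
    _ = _ := mul_one _

theorem functionalBound_zero {k : ℕ} {w : Fin N → ℝ} (hw : ∀ l, 0 ≤ w l)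
    (e : ℕ → Fin N × ℕ → V) {C : ℝ} (hC : 0 ≤ C) (κ : ℝ) : FunctionalBound k w e 0 C κ := by
  intro i hi B hB ξ hξ
  have := Real.rpow_nonneg (nodeWeight_nonneg hw i B) κ
  simp only [LinearMap.zero_apply, abs_zero]
  positivity

/-- The block vectors of the first `s` levels are nearly annihilated by the functionals `Λ`, they
nearly diagonalize `β`, and the diagonal of `β` is nearly equidistributed over the blocks of level
`g s`. -/
structure BalancedSigns {ι : Type*} (n : ℕ) (g : ℕ → ℕ) (e : ℕ → Fin N × ℕ → V)
    (β : V →ₗ[ℝ] V →ₗ[ℝ] ℝ) (Λ : ι → V →ₗ[ℝ] ℝ) (δ : ℝ) (s : ℕ) (ε : ℕ → Fin N × ℕ → ℤˣ) :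
    Prop where
  functional : ∀ t < s, ∀ j < 2 ^ t, ∀ r, |Λ r (blockVec g ε e t j)| ≤ δ
  offDiag : ∀ t < s, ∀ j < 2 ^ t, ∀ t' < s, ∀ j' < 2 ^ t', (t, j) ≠ (t', j') →
    |β (blockVec g ε e t j) (blockVec g ε e t' j')| ≤ δ
  diag : ∀ t < s, ∀ j < 2 ^ t,
    |β (blockVec g ε e t j) (blockVec g ε e t j) - diagSum e β (g t) / 2 ^ t| ≤ (t + 1) * δ
  equidistributed : ∀ t, s ≤ t → t < n → ∀ j < 2 ^ s,
    |blockDiagSum g ε e β t s j - diagSum e β (g t) / 2 ^ s| ≤ s * δ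

/-- The labels at level g s involve only earlier signs, so the blocks of level s are fixed before
the signs of level s are drawn. The new signs must meet linear conditions (the functionals `Λ`, both
orders of β against old block vectors, the half differences for every later level) and quadratic
ones (β between blocks of level s). A diagonal value deviates by δ from a block sum that is itself s
δ off; halving turns an error s δ into at most (s δ + δ) / 2. -/
theorem BalancedSigns.exists_succ {ι : Type*} [Fintype ι] {n k : ℕ} {g : ℕ → ℕ}
    (hg : ∀ s < n, g s < g (s + 1)) (hgk : ∀ s < n, g s < k) {w : Fin N → ℝ}
    (hw : ∀ l, 0 ≤ w l) (hw1 : ∑ l, w l = 1) {e : ℕ → Fin N × ℕ → V} {β : V →ₗ[ℝ] V →ₗ[ℝ] ℝ}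
    {C x y κ : ℝ} (hC : 0 ≤ C) (hκ : 0 ≤ κ) (hx : κ ≤ x) (hy : κ ≤ y) (hxy : x + y = 1)
    (hβ : FormBound k w e β C x y) {Λ : ι → V →ₗ[ℝ] ℝ}
    (hΛ : ∀ r, FunctionalBound k w e (Λ r) C κ) {δ : ℝ} (hδ : 0 ≤ δ) {s : ℕ} (hs : s < n)
    (hsmall : ((2 ^ n * (Fintype.card ι + (n * 2 ^ n + n * 2 ^ n) + n) : ℕ) +
      2 * (2 ^ n * 2 ^ n : ℕ)) * (C ^ 2 * ((1 / 2 : ℝ) ^ (g s)) ^ κ) ≤ δ ^ 2)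
    {ε : ℕ → Fin N × ℕ → ℤˣ} (h : BalancedSigns n g e β Λ δ s ε) :
    ∃ ε', BalancedSigns n g e β Λ δ (s + 1) ε' := by
  classical
  have hmono : ∀ t, s < t → t < n → g (s + 1) ≤ g t := by
    intro t ht
    induction t, ht using Nat.le_induction with
    | base => intro _; exact le_rfl
    | succ t _ ih => intro ht; exact (ih (by omega)).trans (hg t (by omega)).le
  -- Block vectors of levels not yet treated are replaced by 0, so that the number of functionals
  -- does not depend on s.
  set ψ : ι ⊕ ((Fin n × Fin (2 ^ n)) ⊕ (Fin n × Fin (2 ^ n))) → V →ₗ[ℝ] ℝ :=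
    Sum.elim Λ (Sum.elim
      (fun r => if r.1 < s then β (blockVec g ε e r.1 r.2) else 0)
      (fun r => if r.1 < s then β.flip (blockVec g ε e r.1 r.2) else 0)) with hψdef
  have hψ : ∀ r, FunctionalBound k w e (ψ r) C κ := by
    rintro (r | r | r)
    · exact hΛ r
    · simp only [hψdef, Sum.elim_inr, Sum.elim_inl]
      split_ifs with hr
      · have := hβ.flip.functionalBound_flip hw hw1 hC hκ hy (hκ.trans hx) g ε
          (hgk r.1 r.1.2) r.2
        rwa [LinearMap.flip_flip] at this
      · exact functionalBound_zero hw e hC κ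
    · simp only [hψdef, Sum.elim_inr]
      split_ifs with hr
      · exact hβ.functionalBound_flip hw hw1 hC hκ hx (hκ.trans hy) g ε (hgk r.1 r.1.2) r.2
      · exact functionalBound_zero hw e hC κ
  set γ : Fin n → Fin N × ℕ → ℝ := fun t b => if s < t then halfDiff g e β t s b else 0
  have hγ : ∀ r, ∀ a ∈ nodes N (g s), |γ r a| ≤ C * (w a.1 / 2 ^ (g s)) := by
    intro r a ha
    simp only [γ]
    split_ifs with hr
    · exact abs_halfDiff_le hw (hκ.trans hx) (hκ.trans hy) hxy hβ g (hgk r r.2)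
        ((hg s hs).le.trans (hmono r hr r.2)) ha
    · rw [abs_zero]
      exact mul_nonneg hC (div_nonneg (hw _) (by positivity))
  have hpow : 2 ^ s ≤ 2 ^ n := Nat.pow_le_pow_right (by norm_num) hs.le
  obtain ⟨σ, h1, h2, h3⟩ := exists_signs_level hw hw1 hC hκ hx hy hxy hβ (hgk s hs) ψ hψ γ hγ
    (label g ε s) (2 ^ s) hδ (by
      refine le_trans ?_ hsmall
      simp only [Fintype.card_sum, Fintype.card_prod, Fintype.card_fin]
      gcongr)
  set ε' := Function.update ε s σ with hε'
  have hcong : ∀ t < s, ε' t = ε t := fun t ht => Function.update_of_ne (by omega) _ _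
  have hεs : ε' s = σ := Function.update_self _ _ _
  have hold : ∀ t < s, ∀ j, blockVec g ε' e t j = blockVec g ε e t j := fun t ht j =>
    blockVec_congr g e t (fun t' ht' => hcong t' (by omega)) j
  have hnew : ∀ j, blockVec g ε' e s j = nodeComb e (g s)
      ((nodes N (g s)).filter fun a => label g ε s a = j) fun a => realSign (σ a) := fun j => by
    rw [blockVec, hεs, block_congr g s hcong j, block]
  have hlt : ∀ {t j : ℕ}, t < s → j < 2 ^ t → j < 2 ^ n := fun ht hj =>
    hj.trans_le (Nat.pow_le_pow_right (by norm_num) (by omega))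
  refine ⟨ε', ⟨?_, ?_, ?_, ?_⟩⟩
  · intro t ht j hj r
    rcases Nat.lt_succ_iff_lt_or_eq.mp ht with ht | rfl
    · rw [hold t ht]; exact h.functional t ht j hj r
    · rw [hnew]; exact h1 j hj (Sum.inl r)
  · intro t ht j hj t' ht' j' hj' hne
    rcases Nat.lt_succ_iff_lt_or_eq.mp ht with ht | rfl
    · rw [hold t ht]
      rcases Nat.lt_succ_iff_lt_or_eq.mp ht' with ht' | rfl
      · rw [hold t' ht']; exact h.offDiag t ht j hj t' ht' j' hj' hne
      · rw [hnew]
        have := h1 j' hj' (Sum.inr (Sum.inl (⟨t, by omega⟩, ⟨j, hlt ht hj⟩)))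
        simpa only [hψdef, Sum.elim_inr, Sum.elim_inl, if_pos ht] using this
    · rw [hnew]
      rcases Nat.lt_succ_iff_lt_or_eq.mp ht' with ht' | rfl
      · rw [hold t' ht']
        have := h1 j hj (Sum.inr (Sum.inr (⟨t', by omega⟩, ⟨j', hlt ht' hj'⟩)))
        simpa only [hψdef, Sum.elim_inr, if_pos ht', LinearMap.flip_apply] using this
      · rw [hnew]
        have hjj : j ≠ j' := fun h => hne (by rw [h])
        have := h3 j hj j' hj'
        -- A node has only one label, so there is no diagonal contribution for j ≠ j'.
        rw [Finset.sum_eq_zero, sub_zero] at this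
        · exact this
        · intro a _
          rw [if_neg]
          rintro ⟨rfl, h'⟩
          exact hjj h'
  · intro t ht j hj
    rcases Nat.lt_succ_iff_lt_or_eq.mp ht with ht | rfl
    · rw [hold t ht]; exact h.diag t ht j hj
    · rw [hnew]
      have h4 := h3 j hj j hj
      have h5 := h.equidistributed t le_rfl hs j hj
      rw [blockDiagSum] at h5
      simp only [Nat.sub_self, ancestor_zero] at h5
      simp only [and_self] at h4
      have := abs_add_le _ _ |>.trans (add_le_add h4 h5)
      rw [sub_add_sub_cancel] at this
      linarith
  · intro t ht hn j hj
    rw [blockDiagSum_succ g ε' e β (hg s hs) (hmono t (by omega) hn),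
      blockDiagSum_congr g e β t s hcong, block_congr g s hcong, hεs]
    have hj2 : j / 2 < 2 ^ s := by rw [pow_succ] at hj; omega
    have h5 := h.equidistributed t (by omega) hn (j / 2) hj2
    have h6 := h2 (j / 2) hj2 ⟨t, hn⟩
    -- The level t is later than s, so the member t of γ is the half difference and not the default
    -- 0.
    simp only [γ, if_pos (show s < t by omega)] at h6
    have h7 : |(if j % 2 = 0 then (1 : ℝ) else -1) *
        ∑ b ∈ block g ε s (j / 2), realSign (σ b) * halfDiff g e β t s b| ≤ δ := by
      rw [abs_mul]
      have : |(if j % 2 = 0 then (1 : ℝ) else -1)| = 1 := by split_ifs <;> simp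
      rw [this, one_mul]
      exact h6
    have h8 := (abs_add_le _ _).trans (add_le_add h5 h7)
    have h9 : 0 ≤ (s : ℝ) * δ := by positivity
    rw [pow_succ, ← div_div, ← sub_div, abs_div, abs_two, add_sub_right_comm]
    push_cast
    linarith

theorem exists_small_level (K C κ δ : ℝ) (hκ : 0 < κ) (hδ : 0 < δ) :
    ∃ M : ℕ, ∀ i ≥ M, K * (C ^ 2 * ((1 / 2 : ℝ) ^ i) ^ κ) ≤ δ ^ 2 := by
  have h1 : Filter.Tendsto (fun i : ℕ => K * (C ^ 2 * ((1 / 2 : ℝ) ^ i) ^ κ)) Filter.atTop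
      (nhds (K * (C ^ 2 * 0))) := by
    refine Filter.Tendsto.const_mul _ (Filter.Tendsto.const_mul _ ?_)
    have := (tendsto_pow_atTop_nhds_zero_of_lt_one (r := (1 / 2 : ℝ)) (by norm_num)
      (by norm_num)).rpow_const (p := κ) (Or.inr hκ.le)
    rwa [Real.zero_rpow hκ.ne'] at this
  have h2 := h1.eventually_le_const (u := δ ^ 2) (by simp only [mul_zero]; positivity)
  exact Filter.eventually_atTop.mp h2

/-- `M` precedes N, the weights and the vectors: the number of conditions per level is bounded in
terms of n and R only. -/
theorem exists_balanced_signs (R n : ℕ) {C κ δ : ℝ} (hC : 0 ≤ C) (hκ : 0 < κ) (hδ : 0 < δ) :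
    ∃ M : ℕ, ∀ (N : ℕ) (V : Type*) [AddCommGroup V] [Module ℝ V] (ι : Type) [Fintype ι],
      Fintype.card ι ≤ R → ∀ (k : ℕ) (g : ℕ → ℕ),
      (∀ s < n, g s < g (s + 1)) → (∀ s < n, g s < k) → (∀ s < n, M ≤ g s) →
      ∀ (w : Fin N → ℝ), (∀ l, 0 ≤ w l) → ∑ l, w l = 1 →
      ∀ (e : ℕ → Fin N × ℕ → V) (β : V →ₗ[ℝ] V →ₗ[ℝ] ℝ) (x y : ℝ), κ ≤ x → κ ≤ y → x + y = 1 →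
      FormBound k w e β C x y → ∀ Λ : ι → V →ₗ[ℝ] ℝ, (∀ r, FunctionalBound k w e (Λ r) C κ) →
      ∃ ε, BalancedSigns n g e β Λ δ n ε := by
  obtain ⟨M, hM⟩ := exists_small_level ((2 ^ n * (R + (n * 2 ^ n + n * 2 ^ n) + n) : ℕ) +
    2 * (2 ^ n * 2 ^ n : ℕ)) C κ δ hκ hδ
  refine ⟨M, fun N V _ _ ι _ hR k g hg hgk hgM w hw hw1 e β x y hx hy hxy hβ Λ hΛ => ?_⟩
  suffices ∀ s ≤ n, ∃ ε, BalancedSigns n g e β Λ δ s ε from this n le_rfl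
  intro s
  induction s with
  | zero =>
    intro _
    -- At s = 0 a single block carries the whole diagonal, with error 0.
    refine ⟨fun _ _ => 1, ⟨by simp, by simp, by simp, fun t _ _ j hj => ?_⟩⟩
    have : j = 0 := by simpa using hj
    subst this
    simp [blockDiagSum, label, diagSum]
  | succ s ih =>
    intro hs
    obtain ⟨ε, hε⟩ := ih (by omega)
    refine hε.exists_succ hg hgk hw hw1 hC hκ.le hx hy hxy hβ hΛ hδ.le (by omega) ?_
    refine le_trans ?_ (hM (g s) (hgM s (by omega)))
    gcongr

end Core

/-! ### Haar functions in terms of binary digits -/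

/-- The index of the dyadic interval of level `i` containing `x ≥ 0`. -/
noncomputable def dyadicIndex (i : ℕ) (x : ℝ) : ℕ := ⌊2 ^ i * x⌋₊

theorem measurable_dyadicIndex (i : ℕ) : Measurable (dyadicIndex i) :=
  Nat.measurable_floor.comp (measurable_const_mul _)

theorem mem_dyadic_iff {i j : ℕ} {x : ℝ} (hx : 0 ≤ x) : x ∈ dyadic i j ↔ dyadicIndex i x = j := by
  have h2 : (0 : ℝ) < 2 ^ i := by positivity
  rw [dyadicIndex, Nat.floor_eq_iff (by positivity), dyadic, Set.mem_Ico, div_le_iff₀ h2,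
    lt_div_iff₀ h2, mul_comm x]

theorem dyadicIndex_div (i d : ℕ) (x : ℝ) : dyadicIndex (i + d) x / 2 ^ d = dyadicIndex i x := by
  rw [dyadicIndex, dyadicIndex]
  have := Nat.floor_div_natCast (2 ^ (i + d) * x) (2 ^ d)
  rw [← this]
  congr 1
  push_cast
  rw [pow_add]
  field_simp

theorem ae_mem_Ico : ∀ᵐ x ∂leb01, 0 ≤ x ∧ x < 1 := by
  have h1 : ∀ᵐ x ∂leb01, x ∈ Set.Icc (0 : ℝ) 1 := ae_restrict_mem measurableSet_Icc
  have h2 : ∀ᵐ x ∂leb01, x ≠ 1 :=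
    ae_restrict_of_ae (Measure.ae_ne volume 1)
  filter_upwards [h1, h2] with x hx hx1
  exact ⟨hx.1, lt_of_le_of_ne hx.2 hx1⟩

theorem dyadicIndex_lt {i : ℕ} {x : ℝ} (hx : 0 ≤ x ∧ x < 1) : dyadicIndex i x < 2 ^ i := by
  have h2 : (0 : ℝ) < 2 ^ i := by positivity
  rw [dyadicIndex, Nat.floor_lt (by have := hx.1; positivity)]
  push_cast
  nlinarith [hx.2]

instance : IsProbabilityMeasure leb01 := ⟨by simp⟩

theorem leb01_dyadic {i j : ℕ} (hj : j < 2 ^ i) :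
    leb01.real (dyadic i j) = (1 / 2 : ℝ) ^ i := by
  have h2 : (0 : ℝ) < 2 ^ i := by positivity
  have hsub : dyadic i j ⊆ Set.Icc (0 : ℝ) 1 := by
    intro x hx
    have hj' : (j : ℝ) + 1 ≤ 2 ^ i := by exact_mod_cast hj
    rw [dyadic, Set.mem_Ico] at hx
    refine ⟨le_trans (by positivity) hx.1, hx.2.le.trans ?_⟩
    rw [div_le_one h2]; exact hj'
  rw [show leb01 = volume.restrict (Set.Icc (0 : ℝ) 1) from rfl,
    measureReal_restrict_apply (show MeasurableSet (dyadic i j) from measurableSet_Ico),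
    Set.inter_eq_left.mpr hsub, dyadic,
    Real.volume_real_Ico_of_le (by gcongr; linarith)]
  rw [one_div, inv_pow]
  field_simp
  ring

theorem leb01_dyadicIndex {i j : ℕ} (hj : j < 2 ^ i) :
    leb01.real {x | dyadicIndex i x = j} = (1 / 2 : ℝ) ^ i := by
  rw [← leb01_dyadic hj]
  refine measureReal_congr ?_
  filter_upwards [ae_mem_Ico] with x hx
  exact propext (mem_dyadic_iff hx.1).symm

section Haar

variable {p : ℝ≥0∞}

theorem coeFn_dyadicChi (i j : ℕ) :
    (dyadicChi p i j : ℝ → ℝ) =ᵐ[leb01] fun x => if dyadicIndex i x = j then 1 else 0 := by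
  have h : (dyadicChi p i j : ℝ → ℝ) =ᵐ[leb01] _ :=
    indicatorConstLp_coeFn (p := p) (s := dyadic i j) (μ := leb01) (c := (1 : ℝ))
      (hs := measurableSet_Ico) (hμs := measure_ne_top _ _)
  filter_upwards [h, ae_mem_Ico] with x hx h01
  rw [hx]
  by_cases h : dyadicIndex i x = j
  · rw [if_pos h, Set.indicator_of_mem ((mem_dyadic_iff h01.1).mpr h)]
  · rw [if_neg h, Set.indicator_of_notMem fun h' => h ((mem_dyadic_iff h01.1).mp h')]

theorem coeFn_haar (i j : ℕ) :
    (haar p i j : ℝ → ℝ) =ᵐ[leb01]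
      fun x => if dyadicIndex i x = j then (-1) ^ dyadicIndex (i + 1) x else 0 := by
  have h : (haar p i j : ℝ → ℝ) =ᵐ[leb01]
    dyadicChi p (i + 1) (2 * j) - dyadicChi p (i + 1) (2 * j + 1) := Lp.coeFn_sub _ _
  filter_upwards [h, coeFn_dyadicChi (p := p) (i + 1) (2 * j),
    coeFn_dyadicChi (p := p) (i + 1) (2 * j + 1)] with x hx h1 h2
  rw [hx, Pi.sub_apply, h1, h2]
  have hd := dyadicIndex_div i 1 x
  rw [pow_one] at hd
  rcases Nat.mod_two_eq_zero_or_one (dyadicIndex (i + 1) x) with hm | hm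
  · have he : Even (dyadicIndex (i + 1) x) := Nat.even_iff.mpr hm
    rw [he.neg_one_pow, if_neg (show ¬ dyadicIndex (i + 1) x = 2 * j + 1 by omega), sub_zero]
    exact if_congr (by omega) rfl rfl
  · have he : Odd (dyadicIndex (i + 1) x) := Nat.odd_iff.mpr hm
    rw [he.neg_one_pow, if_neg (show ¬ dyadicIndex (i + 1) x = 2 * j by omega), zero_sub]
    by_cases h : dyadicIndex i x = j
    · rw [if_pos h, if_pos (by omega)]
    · rw [if_neg h, if_neg (by omega), neg_zero]

/-- The value of the Haar function `h_{[j/2^t,(j+1)/2^t)}` on the dyadic interval of level `t + 1`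
with index `L`. -/
def haarValue (j L : ℕ) : ℝ := if L = 2 * j then 1 else if L = 2 * j + 1 then -1 else 0

/-- The last letter of a label encodes +1 as 0 and -1 as 1, in accordance with the left and right
halves, so the Haar function reads the sign back. -/
theorem haarValue_two_mul_add (j q : ℕ) (e : ℤˣ) :
    haarValue j (2 * q + if e = 1 then 0 else 1) = if q = j then realSign e else 0 := by
  rcases Int.units_eq_one_or e with rfl | rfl
  · simp only [haarValue, if_true, realSign_one]
    by_cases h : q = j
    · simp [h]
    · rw [if_neg (by omega), if_neg (by omega), if_neg h]
  · have : ¬ ((-1 : ℤˣ) = 1) := by decide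
    simp only [haarValue, if_neg this, realSign_neg, realSign_one]
    by_cases h : q = j
    · simp [h]
    · rw [if_neg (by omega), if_neg (by omega), if_neg h]

theorem coeFn_haar_eq_haarValue (i j : ℕ) :
    (haar p i j : ℝ → ℝ) =ᵐ[leb01] fun x => haarValue j (dyadicIndex (i + 1) x) := by
  filter_upwards [coeFn_haar (p := p) i j] with x hx
  rw [hx]
  have hd := dyadicIndex_div i 1 x
  rw [pow_one] at hd
  have h2 : dyadicIndex (i + 1) x =
      2 * dyadicIndex i x + if (-1 : ℤˣ) ^ dyadicIndex (i + 1) x = 1 then 0 else 1 := by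
    rcases Nat.even_or_odd (dyadicIndex (i + 1) x) with he | ho
    · rw [he.neg_one_pow, if_pos rfl]; rw [Nat.even_iff] at he; omega
    · rw [ho.neg_one_pow, if_neg (by decide)]; rw [Nat.odd_iff] at ho; omega
  have h3 := haarValue_two_mul_add j (dyadicIndex i x) ((-1) ^ dyadicIndex (i + 1) x)
  rw [← h2] at h3
  rw [h3]
  simp [realSign]

theorem integral_haar [Fact (1 ≤ p)] {i j : ℕ} (hj : j < 2 ^ i) :
    ∫ x, (haar p i j : ℝ → ℝ) x ∂leb01 = 0 := by
  have h : (haar p i j : ℝ → ℝ) =ᵐ[leb01]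
    dyadicChi p (i + 1) (2 * j) - dyadicChi p (i + 1) (2 * j + 1) := Lp.coeFn_sub _ _
  have hi : ∀ u : LpI p, Integrable u leb01 := fun u => (Lp.memLp u).integrable Fact.out
  have hc : ∀ j' < 2 ^ (i + 1), ∫ x, (dyadicChi p (i + 1) j' : ℝ → ℝ) x ∂leb01 =
      (1 / 2 : ℝ) ^ (i + 1) := by
    intro j' hj'
    rw [integral_congr_ae (coeFn_dyadicChi (p := p) (i + 1) j'), ← leb01_dyadicIndex hj']
    have hm : MeasurableSet {x | dyadicIndex (i + 1) x = j'} :=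
      measurable_dyadicIndex (i + 1) (measurableSet_singleton j')
    rw [← integral_indicator_one hm]
    refine integral_congr_ae (ae_of_all _ fun x => ?_)
    by_cases h : dyadicIndex (i + 1) x = j' <;> simp [h]
  rw [integral_congr_ae h]
  simp only [Pi.sub_apply]
  rw [integral_sub (hi _) (hi _), hc _ (by rw [pow_succ]; omega), hc _ (by rw [pow_succ]; omega),
    sub_self]

theorem LpHaar_le_LpZero [Fact (1 ≤ p)] (n : ℕ) : LpHaar p n ≤ LpZero p := by
  refine Submodule.span_le.mpr ?_
  rintro _ ⟨i, j, -, hj, rfl⟩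
  exact integral_haar hj

/-- The Haar function of level `i` and index `K` in `L_p^{k,0}`, and zero if it does not belong to
this space. -/
noncomputable def haarMem (p : ℝ≥0∞) (k i K : ℕ) : LpHaar p k :=
  if h : i < k ∧ K < 2 ^ i then ⟨haar p i K, Submodule.subset_span ⟨i, K, h.1, h.2, rfl⟩⟩ else 0

theorem coe_haarMem {k i K : ℕ} (hi : i < k) (hK : K < 2 ^ i) :
    (haarMem p k i K : LpI p) = haar p i K := by
  rw [haarMem, dif_pos ⟨hi, hK⟩]

/-- The Haar functions in `N` copies of `L_p^{k,0}`. -/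
noncomputable def haarFamily (p : ℝ≥0∞) (k N : ℕ) (i : ℕ) (a : Fin N × ℕ) :
    Fin N → LpHaar p k :=
  Pi.single a.1 (haarMem p k i a.2)

theorem coeFn_sum {ι : Type*} (s : Finset ι) (f : ι → LpI p) :
    ((∑ i ∈ s, f i : LpI p) : ℝ → ℝ) =ᵐ[leb01] fun x => ∑ i ∈ s, (f i : ℝ → ℝ) x := by
  classical
  induction s using Finset.induction_on with
  | empty =>
    filter_upwards [Lp.coeFn_zero ℝ p leb01] with x hx
    simp
  | insert a s ha ih =>
    rw [Finset.sum_insert ha]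
    filter_upwards [Lp.coeFn_add (f a) (∑ i ∈ s, f i), ih] with x h1 h2
    rw [h1, Pi.add_apply, h2, Finset.sum_insert ha]

theorem coeFn_nodeComb_haarFamily {k N i : ℕ} (hi : i < k) {B : Finset (Fin N × ℕ)}
    (hB : B ⊆ nodes N i) (ξ : Fin N × ℕ → ℝ) (l : Fin N) :
    ((nodeComb (haarFamily p k N) i B ξ l : LpI p) : ℝ → ℝ) =ᵐ[leb01]
      fun x => if (l, dyadicIndex i x) ∈ B then
        ξ (l, dyadicIndex i x) * (-1) ^ dyadicIndex (i + 1) x else 0 := by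
  classical
  have h1 : (nodeComb (haarFamily p k N) i B ξ l : LpI p) =
      ∑ a ∈ B, (if a.1 = l then ξ a else 0) • haar p i a.2 := by
    rw [nodeComb, Finset.sum_apply, AddSubmonoidClass.coe_finsetSum]
    refine Finset.sum_congr rfl fun a ha => ?_
    rw [Pi.smul_apply, haarFamily]
    by_cases hl : a.1 = l
    · subst hl
      rw [Pi.single_eq_same, if_pos rfl, Submodule.coe_smul,
        coe_haarMem hi (mem_nodes.mp (hB ha))]
    · rw [Pi.single_eq_of_ne (Ne.symm hl), if_neg hl, zero_smul, smul_zero,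
        Submodule.coe_zero]
  have h2 : ∀ᵐ x ∂leb01, ∀ a ∈ B, ((if a.1 = l then ξ a else 0) • haar p i a.2 : LpI p) x =
      (if a.1 = l then ξ a else 0) *
        if dyadicIndex i x = a.2 then (-1) ^ dyadicIndex (i + 1) x else 0 := by
    refine (Filter.eventually_all_finset B).mpr fun a _ => ?_
    filter_upwards [Lp.coeFn_smul (if a.1 = l then ξ a else 0) (haar p i a.2),
      coeFn_haar (p := p) i a.2] with x h3 h4
    rw [h3, Pi.smul_apply, h4, smul_eq_mul]
  rw [h1]
  filter_upwards [coeFn_sum B fun a => (if a.1 = l then ξ a else 0) • haar p i a.2, h2]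
    with x h3 h4
  rw [h3, Finset.sum_congr rfl h4, ← Finset.sum_ite_eq B (l, dyadicIndex i x)
    fun a => ξ a * (-1) ^ dyadicIndex (i + 1) x]
  refine Finset.sum_congr rfl fun a _ => ?_
  obtain ⟨l', K⟩ := a
  by_cases h : l = l'
  · subst h
    by_cases h' : dyadicIndex i x = K <;> simp [h']
  · have h' : l' ≠ l := Ne.symm h
    simp [h, h']

/-- The label of an ancestor is a prefix of the binary word; integer division by a power of 2
deletes the last letters. -/
theorem label_ancestor {N n : ℕ} {g : ℕ → ℕ} (hg : ∀ s < n, g s < g (s + 1))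
    (ε : ℕ → Fin N × ℕ → ℤˣ) {s s' : ℕ} (h : s ≤ s') (hn : s' ≤ n) (a : Fin N × ℕ) :
    label g ε s (ancestor (g s' - g s) a) = label g ε s' a / 2 ^ (s' - s) := by
  have hmono : ∀ t, s ≤ t → t ≤ n → g s ≤ g t := by
    intro t ht
    induction t, ht using Nat.le_induction with
    | base => intro _; exact le_rfl
    | succ t _ ih => intro ht; exact (ih (by omega)).trans (hg t (by omega)).le
  induction s', h using Nat.le_induction generalizing a with
  | base => simp
  | succ t hst ih =>
    have h1 := ih (by omega) (ancestor (g (t + 1) - g t) a)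
    have h2 := hg t (by omega)
    have h3 := hmono t hst (by omega)
    rw [ancestor_ancestor, show g (t + 1) - g t + (g t - g s) = g (t + 1) - g s by omega] at h1
    rw [h1, show t + 1 - s = 1 + (t - s) by omega, pow_add, ← Nat.div_div_eq_div_mul, pow_one]
    congr 1
    simp only [label]
    split_ifs <;> omega

theorem ancestor_dyadicIndex {N i i' : ℕ} (h : i ≤ i') (l : Fin N) (x : ℝ) :
    ancestor (i' - i) (l, dyadicIndex i' x) = (l, dyadicIndex i x) := by
  obtain ⟨d, rfl⟩ := Nat.exists_eq_add_of_le h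
  rw [show i + d - i = d by omega, ancestor, dyadicIndex_div]

/-- The label of the dyadic interval of level `g s` containing `x`, in the `l`-th copy of the
dyadic tree. -/
noncomputable def pointLabel {N : ℕ} (g : ℕ → ℕ) (ε : ℕ → Fin N × ℕ → ℤˣ) (s : ℕ) (l : Fin N)
    (x : ℝ) : ℕ := label g ε s (l, dyadicIndex (g s) x)

theorem measurable_pointLabel {N : ℕ} (g : ℕ → ℕ) (ε : ℕ → Fin N × ℕ → ℤˣ) (s : ℕ) (l : Fin N) :
    Measurable (pointLabel g ε s l) :=
  (measurable_from_nat (f := fun K => label g ε s (l, K))).comp (measurable_dyadicIndex _)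

theorem pointLabel_div {N n : ℕ} {g : ℕ → ℕ} (hg : ∀ s < n, g s < g (s + 1))
    (ε : ℕ → Fin N × ℕ → ℤˣ) {s s' : ℕ} (h : s ≤ s') (hn : s' ≤ n) (l : Fin N) (x : ℝ) :
    pointLabel g ε s' l x / 2 ^ (s' - s) = pointLabel g ε s l x := by
  have hmono : ∀ t, s ≤ t → t ≤ n → g s ≤ g t := by
    intro t ht
    induction t, ht using Nat.le_induction with
    | base => intro _; exact le_rfl
    | succ t _ ih => intro ht; exact (ih (by omega)).trans (hg t (by omega)).le
  rw [pointLabel, pointLabel, ← label_ancestor hg ε h hn, ancestor_dyadicIndex (hmono s' h hn)]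

/-- On its block, the signed Haar sum takes precisely the sign that the label of length t + 1
records as its last letter. Block vectors are thus Haar functions composed with the label, as if the
label were the dyadic index. -/
theorem coeFn_blockVec_haarFamily {k N : ℕ} {g : ℕ → ℕ} (ε : ℕ → Fin N × ℕ → ℤˣ) {t : ℕ}
    (ht : g t < k) (hg : g t < g (t + 1)) (j : ℕ) (l : Fin N) :
    ((blockVec g ε (haarFamily p k N) t j l : LpI p) : ℝ → ℝ) =ᵐ[leb01]
      fun x => haarValue j (pointLabel g ε (t + 1) l x) := by
  have hB : block g ε t j ⊆ nodes N (g t) := Finset.filter_subset _ _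
  filter_upwards [coeFn_nodeComb_haarFamily (p := p) ht hB (fun a => realSign (ε t a)) l,
    ae_mem_Ico] with x hx h01
  rw [blockVec, hx]
  have hmem : (l, dyadicIndex (g t) x) ∈ block g ε t j ↔
      label g ε t (l, dyadicIndex (g t) x) = j := by
    rw [block, Finset.mem_filter, mem_nodes]
    exact and_iff_right (dyadicIndex_lt h01)
  have hhs : halfSign (g (t + 1) - g t - 1) (l, dyadicIndex (g (t + 1)) x) =
      (-1) ^ dyadicIndex (g t + 1) x := by
    rw [halfSign]
    congr 1
    have := dyadicIndex_div (g t + 1) (g (t + 1) - g t - 1) x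
    rwa [show g t + 1 + (g (t + 1) - g t - 1) = g (t + 1) by omega] at this
  simp only [pointLabel, label, ancestor_dyadicIndex hg.le, hhs, haarValue_two_mul_add]
  refine if_congr hmem ?_ rfl
  rw [realSign_mul, mul_comm]
  simp [realSign]

/-- By induction: the set with label q splits into those with labels 2q and 2q + 1. The difference
of their measures is the integral of a block vector, which vanishes because block vectors lie in the
span of the Haar functions. -/
theorem leb01_pointLabel [Fact (1 ≤ p)] {k n N : ℕ} {g : ℕ → ℕ} (hg : ∀ s < n, g s < g (s + 1))
    (hgk : ∀ s < n, g s < k) (ε : ℕ → Fin N × ℕ → ℤˣ) (l : Fin N) {s : ℕ} (hs : s ≤ n) {j : ℕ}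
    (hj : j < 2 ^ s) : leb01.real {x | pointLabel g ε s l x = j} = (1 / 2 : ℝ) ^ s := by
  induction s generalizing j with
  | zero =>
    have : j = 0 := by simpa using hj
    subst this
    simp [pointLabel, label]
  | succ s ih =>
    have hj2 : j / 2 < 2 ^ s := by rw [pow_succ] at hj; omega
    have h1 := ih (by omega) hj2
    set q := j / 2
    have hm : ∀ j, MeasurableSet {x | pointLabel g ε (s + 1) l x = j} := fun j =>
      measurable_pointLabel g ε (s + 1) l (measurableSet_singleton j)
    have hd : ∀ x, pointLabel g ε (s + 1) l x / 2 = pointLabel g ε s l x := fun x => by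
      have := pointLabel_div hg ε (s := s) (s' := s + 1) (by omega) hs l x
      rwa [show s + 1 - s = 1 by omega, pow_one] at this
    have h2 : leb01.real {x | pointLabel g ε (s + 1) l x = 2 * q} +
        leb01.real {x | pointLabel g ε (s + 1) l x = 2 * q + 1} = (1 / 2 : ℝ) ^ s := by
      rw [← h1, ← measureReal_union _ (hm _)]
      · congr 1
        ext x
        have := hd x
        simp only [Set.mem_union, Set.mem_ofPred_eq]
        omega
      · rw [Set.disjoint_left]
        intro x hx hx'
        simp only [Set.mem_ofPred_eq] at hx hx'
        omega
    have h3 : leb01.real {x | pointLabel g ε (s + 1) l x = 2 * q} -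
        leb01.real {x | pointLabel g ε (s + 1) l x = 2 * q + 1} = 0 := by
      have h4 := LpHaar_le_LpZero k (blockVec g ε (haarFamily p k N) s q l).2
      have h5 : ∫ x, haarValue q (pointLabel g ε (s + 1) l x) ∂leb01 = 0 := by
        rw [← integral_congr_ae (coeFn_blockVec_haarFamily (p := p) ε (hgk s (by omega))
          (hg s (by omega)) q l)]
        exact h4
      rw [← h5, ← integral_indicator_one (hm _), ← integral_indicator_one (hm _),
        ← integral_sub]
      · refine integral_congr_ae (ae_of_all _ fun x => ?_)
        simp only [haarValue]
        by_cases ha : pointLabel g ε (s + 1) l x = 2 * q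
        · simp [ha]
        · by_cases hb : pointLabel g ε (s + 1) l x = 2 * q + 1 <;> simp [ha, hb]
      · exact (integrable_const (1 : ℝ)).indicator (hm _)
      · exact (integrable_const (1 : ℝ)).indicator (hm _)
    have h6 : j = 2 * q ∨ j = 2 * q + 1 := by omega
    rw [pow_succ]
    rcases h6 with h6 | h6 <;> rw [h6] <;> linarith

section Relabel

/-- The average of a function over a dyadic interval. -/
noncomputable def dyadicAverage (n L : ℕ) (f : LpI p) : ℝ :=
  2 ^ n * ∫ x in dyadic n L, (f : ℝ → ℝ) x ∂leb01

theorem dyadicAverage_smul (n L : ℕ) (c : ℝ) (f : LpI p) :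
    dyadicAverage n L (c • f) = c * dyadicAverage n L f := by
  rw [dyadicAverage, integral_congr_ae (ae_restrict_of_ae (Lp.coeFn_smul c f))]
  simp only [Pi.smul_apply, smul_eq_mul]
  rw [integral_const_mul, dyadicAverage]
  ring

theorem dyadicAverage_eq {n L : ℕ} (hL : L < 2 ^ n) {f : LpI p} {φ : ℕ → ℝ}
    (h : (f : ℝ → ℝ) =ᵐ[leb01] fun x => φ (dyadicIndex n x)) : dyadicAverage n L f = φ L := by
  have h1 : ∫ x in dyadic n L, (f : ℝ → ℝ) x ∂leb01 = ∫ _ in dyadic n L, φ L ∂leb01 := by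
    refine setIntegral_congr_ae measurableSet_Ico ?_
    filter_upwards [h, ae_mem_Ico] with x hx h01 hxL
    rw [hx, (mem_dyadic_iff h01.1).mp hxL]
  rw [dyadicAverage, h1, setIntegral_const, leb01_dyadic hL, smul_eq_mul, one_div, inv_pow]
  field_simp

theorem coeFn_haar_eq_of_lt {t n j : ℕ} (ht : t < n) :
    (haar p t j : ℝ → ℝ) =ᵐ[leb01]
      fun x => haarValue j (dyadicIndex n x / 2 ^ (n - (t + 1))) := by
  filter_upwards [coeFn_haar_eq_haarValue (p := p) t j] with x hx
  have := dyadicIndex_div (t + 1) (n - (t + 1)) x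
  rw [show t + 1 + (n - (t + 1)) = n by omega] at this
  rw [hx, this]

/-- Members of the span are constant on dyadic intervals of level n, so they coincide there with
their averages. -/
theorem LpHaar_eq_dyadicAverage {n : ℕ} {f : LpI p} (hf : f ∈ LpHaar p n) :
    (f : ℝ → ℝ) =ᵐ[leb01] fun x => dyadicAverage n (dyadicIndex n x) f := by
  have h : ∃ φ : ℕ → ℝ, (f : ℝ → ℝ) =ᵐ[leb01] fun x => φ (dyadicIndex n x) := by
    induction hf using Submodule.span_induction with
    | mem f hf =>
      obtain ⟨t, j, ht, -, rfl⟩ := hf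
      exact ⟨fun L => haarValue j (L / 2 ^ (n - (t + 1))), coeFn_haar_eq_of_lt ht⟩
    | zero => exact ⟨fun _ => 0, Lp.coeFn_zero ℝ p leb01⟩
    | add f g _ _ hf hg =>
      obtain ⟨φ, hφ⟩ := hf
      obtain ⟨ψ, hψ⟩ := hg
      refine ⟨fun L => φ L + ψ L, ?_⟩
      filter_upwards [hφ, hψ, Lp.coeFn_add f g] with x h1 h2 h3
      rw [h3, Pi.add_apply, h1, h2]
    | smul c f _ hf =>
      obtain ⟨φ, hφ⟩ := hf
      refine ⟨fun L => c * φ L, ?_⟩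
      filter_upwards [hφ, Lp.coeFn_smul c f] with x h1 h3
      rw [h3, Pi.smul_apply, h1, smul_eq_mul]
  obtain ⟨φ, hφ⟩ := h
  filter_upwards [hφ, ae_mem_Ico] with x hx h01
  rw [hx, dyadicAverage_eq (dyadicIndex_lt h01) hφ]

variable [Fact (1 ≤ p)]

theorem integrable_coeFn (f : LpI p) : Integrable f leb01 := (Lp.memLp f).integrable Fact.out

theorem dyadicAverage_add (n L : ℕ) (f g : LpI p) :
    dyadicAverage n L (f + g) = dyadicAverage n L f + dyadicAverage n L g := by
  rw [dyadicAverage, integral_congr_ae (ae_restrict_of_ae (Lp.coeFn_add f g))]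
  simp only [Pi.add_apply]
  rw [integral_add (integrable_coeFn f).integrableOn (integrable_coeFn g).integrableOn, mul_add]
  rfl

/-- The operator that moves the average of `f` over the dyadic interval of level `n` and index `L`
to the set of all `x` with label `L`. -/
noncomputable def relabel (n : ℕ) (lb : ℝ → ℕ) (hlb : Measurable lb) : LpI p →ₗ[ℝ] LpI p where
  toFun f := ∑ L ∈ Finset.range (2 ^ n), dyadicAverage n L f •
    indicatorConstLp p (s := {x | lb x = L}) (μ := leb01) (hlb (measurableSet_singleton L))
      (measure_ne_top _ _) (1 : ℝ)
  map_add' f g := by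
    simp only [dyadicAverage_add, add_smul, Finset.sum_add_distrib]
  map_smul' c f := by
    simp only [dyadicAverage_smul, mul_smul, Finset.smul_sum, RingHom.id_apply]

theorem coeFn_relabel {n : ℕ} {lb : ℝ → ℕ} (hlb : Measurable lb) (hlt : ∀ x, lb x < 2 ^ n)
    (f : LpI p) : (relabel n lb hlb f : ℝ → ℝ) =ᵐ[leb01] fun x => dyadicAverage n (lb x) f := by
  set u : ℕ → LpI p := fun L =>
    indicatorConstLp p (s := {x | lb x = L}) (μ := leb01) (hlb (measurableSet_singleton L))
      (measure_ne_top _ _) (1 : ℝ)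
  have h2 : ∀ᵐ x ∂leb01, ∀ L ∈ Finset.range (2 ^ n), (dyadicAverage n L f • u L : LpI p) x =
      if lb x = L then dyadicAverage n L f else 0 := by
    refine (Filter.eventually_all_finset _).mpr fun L _ => ?_
    have h : (u L : ℝ → ℝ) =ᵐ[leb01] _ := indicatorConstLp_coeFn
    filter_upwards [Lp.coeFn_smul (dyadicAverage n L f) (u L), h] with x h3 h4
    rw [h3, Pi.smul_apply, h4, smul_eq_mul]
    by_cases hx : lb x = L <;> simp [hx]
  filter_upwards [coeFn_sum (Finset.range (2 ^ n)) fun L => dyadicAverage n L f • u L, h2]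
    with x h3 h4
  refine h3.trans ?_
  rw [Finset.sum_congr rfl h4, Finset.sum_ite_eq, if_pos (Finset.mem_range.mpr (hlt x))]

theorem map_label_eq {n : ℕ} {lb : ℝ → ℕ} (hlb : Measurable lb) (hlt : ∀ x, lb x < 2 ^ n)
    (hμ : ∀ L < 2 ^ n, leb01.real {x | lb x = L} = (1 / 2 : ℝ) ^ n) :
    leb01.map lb = leb01.map (dyadicIndex n) := by
  refine Measure.ext_of_singleton fun L => ?_
  rw [Measure.map_apply hlb (measurableSet_singleton L),
    Measure.map_apply (measurable_dyadicIndex n) (measurableSet_singleton L)]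
  by_cases hL : L < 2 ^ n
  · have := (hμ L hL).trans (leb01_dyadicIndex hL).symm
    exact (measureReal_eq_measureReal_iff (measure_ne_top _ _) (measure_ne_top _ _)).mp this
  · have h1 : lb ⁻¹' {L} = ∅ := by
      ext x
      simp only [Set.mem_preimage, Set.mem_singleton_iff, Set.mem_empty_iff_false, iff_false]
      exact fun h => hL (h ▸ hlt x)
    rw [h1, measure_empty]
    symm
    rw [measure_eq_zero_iff_ae_notMem]
    filter_upwards [ae_mem_Ico] with x hx h
    exact hL (h ▸ dyadicIndex_lt hx)

/-- Both functions are the same function of an index, evaluated at the label and at the dyadic index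
respectively, and the two indices are equally distributed. -/
theorem distr_relabel {n : ℕ} {lb : ℝ → ℕ} (hlb : Measurable lb) (hlt : ∀ x, lb x < 2 ^ n)
    (hμ : ∀ L < 2 ^ n, leb01.real {x | lb x = L} = (1 / 2 : ℝ) ^ n) {f : LpI p}
    (hf : f ∈ LpHaar p n) : distr (relabel n lb hlb f) = distr f := by
  rw [distr, distr, Measure.map_congr (coeFn_relabel hlb hlt f),
    Measure.map_congr (LpHaar_eq_dyadicAverage hf)]
  have hφ : Measurable fun L => dyadicAverage n L f := measurable_from_nat
  have h1 := Measure.map_map (μ := leb01) hφ hlb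
  have h2 := Measure.map_map (μ := leb01) hφ (measurable_dyadicIndex n)
  rw [map_label_eq hlb hlt hμ] at h1
  exact h1.symm.trans h2

theorem relabel_haar {n k N : ℕ} {g : ℕ → ℕ} (hg : ∀ s < n, g s < g (s + 1))
    (hgk : ∀ s < n, g s < k) (ε : ℕ → Fin N × ℕ → ℤˣ) (l : Fin N) {t j : ℕ} (ht : t < n) :
    relabel n (pointLabel g ε n l) (measurable_pointLabel g ε n l) (haar p t j) =
      (blockVec g ε (haarFamily p k N) t j l : LpI p) := by
  refine Lp.ext ?_
  filter_upwards [coeFn_relabel (measurable_pointLabel g ε n l)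
    (fun x => label_lt g ε n _) (haar p t j),
    coeFn_blockVec_haarFamily (p := p) ε (hgk t ht) (hg t ht) j l] with x h1 h2
  have h3 : pointLabel g ε n l x < 2 ^ n := label_lt g ε n _
  rw [h1, h2, dyadicAverage_eq (φ := fun L => haarValue j (L / 2 ^ (n - (t + 1)))) h3
      (coeFn_haar_eq_of_lt ht),
    pointLabel_div hg ε (show t + 1 ≤ n by omega) le_rfl]

/-- Defining the embedding by averages on all of L_p, rather than on the Haar basis, makes linearity
immediate; Haar functions enter only to see where the image lies. -/
theorem exists_distEmbedding {n k N : ℕ} {g : ℕ → ℕ} (hg : ∀ s < n, g s < g (s + 1))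
    (hgk : ∀ s < n, g s < k) (ε : ℕ → Fin N × ℕ → ℤˣ) (l : Fin N) :
    ∃ J : LpHaar p n →ₗ[ℝ] LpHaar p k, IsDistEmbedding J ∧
      ∀ t < n, ∀ j < 2 ^ t,
        J (haarMem p n t j) = blockVec g ε (haarFamily p k N) t j l := by
  set J₀ : LpI p →ₗ[ℝ] LpI p :=
    relabel n (pointLabel g ε n l) (measurable_pointLabel g ε n l) with hJ
  have hle : LpHaar p n ≤ (LpHaar p k).comap J₀ := by
    refine Submodule.span_le.mpr ?_
    rintro _ ⟨t, j, ht, -, rfl⟩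
    rw [SetLike.mem_coe, Submodule.mem_comap, hJ, relabel_haar hg hgk ε l ht]
    exact Subtype.property _
  refine ⟨J₀.restrict hle, fun f => ?_, fun t ht j hj => ?_⟩
  · exact distr_relabel (measurable_pointLabel g ε n l) (fun x => label_lt g ε n _)
      (fun L hL => leb01_pointLabel (p := p) hg hgk ε l le_rfl hL) f.2
  · refine Subtype.ext ?_
    rw [LinearMap.coe_restrict_apply, coe_haarMem ht hj]
    exact relabel_haar hg hgk ε l ht

end Relabel

end Haar

/-! ### Sums of compressions with disjoint supports -/

section Compressions

variable {p : ℝ≥0∞} {k N : ℕ} {X : Submodule ℝ (LpI p)}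

/-- The operator `(F_l)_l ↦ ∑_l S_l F_l`. -/
noncomputable def joint {V : Submodule ℝ (LpI p)} (S : Fin N → (V →ₗ[ℝ] X)) : (Fin N → V) →ₗ[ℝ] X :=
  ∑ l, S l ∘ₗ LinearMap.proj l

theorem joint_apply {V : Submodule ℝ (LpI p)} (S : Fin N → (V →ₗ[ℝ] X)) (F : Fin N → V) :
    joint S F = ∑ l, S l (F l) := by
  simp [joint]

theorem assembled_apply {U V : Submodule ℝ (LpI p)} (S : Fin N → (V →ₗ[ℝ] X))
    (J : Fin N → (U →ₗ[ℝ] V)) (f : U) : assembled S J f = joint S fun l => J l f := by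
  simp [assembled, joint_apply]

theorem measurable_coeFn (u : LpI p) : Measurable (u : ℝ → ℝ) :=
  (Lp.stronglyMeasurable u).measurable

theorem distr_apply (u : LpI p) {B : Set ℝ} (hB : MeasurableSet B) :
    distr u B = leb01 {x | (u : ℝ → ℝ) x ∈ B} :=
  Measure.map_apply (measurable_coeFn u) hB

variable {V : Submodule ℝ (LpI p)} {S : Fin N → (V →ₗ[ℝ] X)}

theorem DisjointRanges.ae_eq_zero (hS : DisjointRanges S) (F : Fin N → V) :
    ∀ᵐ x ∂leb01, ∀ l l', l ≠ l' →
      ((S l (F l) : LpI p) : ℝ → ℝ) x = 0 ∨ ((S l' (F l') : LpI p) : ℝ → ℝ) x = 0 := by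
  obtain ⟨A, hA, hd⟩ := hS
  have h1 : ∀ l, ∀ᵐ x ∂leb01, ((S l (F l) : LpI p) : ℝ → ℝ) x ≠ 0 → x ∈ A l := fun l =>
    (hA l).2.1 _ ⟨F l, rfl⟩
  have h2 : ∀ l l', ∀ᵐ x ∂leb01, l ≠ l' → x ∉ A l ∩ A l' := fun l l' => by
    by_cases h : l = l'
    · simp [h]
    · filter_upwards [measure_eq_zero_iff_ae_notMem.mp (hd l l' h)] with x hx _
      exact hx
  filter_upwards [ae_all_iff.mpr h1, ae_all_iff.mpr fun l => ae_all_iff.mpr (h2 l)]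
    with x hx1 hx2 l l' hll
  by_contra! h
  exact hx2 l l' hll ⟨hx1 l h.1, hx1 l' h.2⟩

theorem coeFn_joint (F : Fin N → V) : ((joint S F : LpI p) : ℝ → ℝ) =ᵐ[leb01]
    fun x => ∑ l, ((S l (F l) : LpI p) : ℝ → ℝ) x := by
  rw [joint_apply, AddSubmonoidClass.coe_finsetSum]
  exact coeFn_sum Finset.univ fun l => (S l (F l) : LpI p)

/-- Almost everywhere at most one summand is nonzero, so the preimage of a set without 0 is an
almost disjoint union of the preimages for the summands. Such a set does not see the atoms at 0. -/
theorem distr_joint (hd : DisjointRanges S) {θ : Fin N → ℝ}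
    (hS : ∀ l, IsCompression (θ l) (S l)) (F : Fin N → V) {B : Set ℝ} (hB : MeasurableSet B)
    (h0 : (0 : ℝ) ∉ B) :
    distr (joint S F : LpI p) B = ∑ l, ENNReal.ofReal (θ l) * distr (F l : LpI p) B := by
  have h1 : {x | ((joint S F : LpI p) : ℝ → ℝ) x ∈ B} =ᵐ[leb01]
      ⋃ l, {x | ((S l (F l) : LpI p) : ℝ → ℝ) x ∈ B} := by
    filter_upwards [hd.ae_eq_zero F, coeFn_joint F] with x hx hs
    refine propext ?_
    change ((joint S F : LpI p) : ℝ → ℝ) x ∈ B ↔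
      x ∈ ⋃ l, {x | ((S l (F l) : LpI p) : ℝ → ℝ) x ∈ B}
    rw [hs, Set.mem_iUnion]
    by_cases h : ∃ l, ((S l (F l) : LpI p) : ℝ → ℝ) x ≠ 0
    · obtain ⟨l, hl⟩ := h
      have hz : ∀ l', l' ≠ l → ((S l' (F l') : LpI p) : ℝ → ℝ) x = 0 := fun l' hl' =>
        (hx l' l hl').resolve_right hl
      rw [Finset.sum_eq_single l (fun l' _ hl' => hz l' hl') (by simp)]
      refine ⟨fun h => ⟨l, h⟩, fun ⟨l', h'⟩ => ?_⟩
      by_cases hl' : l' = l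
      · subst hl'; exact h'
      · rw [Set.mem_ofPred_eq, hz l' hl'] at h'
        exact absurd h' h0
    · push Not at h
      simp only [h, Finset.sum_const_zero, Set.mem_ofPred_eq, exists_const_iff]
      simp [h0]
  rw [distr_apply _ hB, measure_congr h1, measure_iUnion₀, tsum_fintype]
  · refine Finset.sum_congr rfl fun l _ => ?_
    rw [← distr_apply _ hB, (hS l).2.2 (F l)]
    simp [Measure.dirac_apply' _ hB, h0]
  · intro l l' hll
    refine measure_eq_zero_iff_ae_notMem.mpr ?_
    filter_upwards [hd.ae_eq_zero F] with x hx hx'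
    obtain ⟨ha, hb⟩ := hx'
    rw [Set.mem_ofPred_eq] at ha hb
    rcases hx l l' hll with h | h
    · rw [h] at ha; exact h0 ha
    · rw [h] at hb; exact h0 hb
  · exact fun l => (measurable_coeFn _ hB).nullMeasurableSet

theorem joint_ae_abs_le_one (hd : DisjointRanges S) {θ : Fin N → ℝ}
    (hS : ∀ l, IsCompression (θ l) (S l)) {F : Fin N → V}
    (hF : ∀ l, ∀ᵐ x ∂leb01, |((F l : LpI p) : ℝ → ℝ) x| ≤ 1) :
    ∀ᵐ x ∂leb01, |((joint S F : LpI p) : ℝ → ℝ) x| ≤ 1 := by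
  have hB : MeasurableSet {y : ℝ | 1 < |y|} := measurableSet_lt measurable_const measurable_abs
  have h := distr_joint hd hS F hB (by simp)
  have h2 : ∀ l, distr (F l : LpI p) {y : ℝ | 1 < |y|} = 0 := fun l => by
    rw [distr_apply _ hB, measure_eq_zero_iff_ae_notMem]
    filter_upwards [hF l] with x hx
    simpa using hx
  simp only [h2, mul_zero, Finset.sum_const_zero] at h
  rw [distr_apply _ hB, measure_eq_zero_iff_ae_notMem] at h
  filter_upwards [h] with x hx
  simpa using hx

theorem joint_measureReal_support (hd : DisjointRanges S) {θ : Fin N → ℝ}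
    (hS : ∀ l, IsCompression (θ l) (S l)) (F : Fin N → V) :
    leb01.real {x | ((joint S F : LpI p) : ℝ → ℝ) x ≠ 0} =
      ∑ l, θ l * leb01.real {x | ((F l : LpI p) : ℝ → ℝ) x ≠ 0} := by
  have hB : MeasurableSet ({0}ᶜ : Set ℝ) := (measurableSet_singleton 0).compl
  have h := distr_joint hd hS F hB (by simp)
  simp only [distr_apply _ hB] at h
  have h2 := congrArg ENNReal.toReal h
  rw [ENNReal.toReal_sum fun l _ => ENNReal.mul_ne_top ENNReal.ofReal_ne_top (measure_ne_top _ _)]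
    at h2
  simp only [ENNReal.toReal_mul] at h2
  refine h2.trans (Finset.sum_congr rfl fun l _ => ?_)
  rw [ENNReal.toReal_ofReal (hS l).1.le]
  rfl

/-- The Haar function of [0, 1) vanishes almost nowhere, so its images under the `S l` have disjoint
supports of measures θ_l. It belongs to the domain because k ≥ 1. -/
theorem sum_le_one_of_disjointRanges {k : ℕ} (hk : 1 ≤ k) {S : Fin N → (LpHaar p k →ₗ[ℝ] X)}
    (hd : DisjointRanges S) {θ : Fin N → ℝ} (hS : ∀ l, IsCompression (θ l) (S l)) :
    ∑ l, θ l ≤ 1 := by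
  have h := joint_measureReal_support hd hS fun _ => haarMem p k 0 0
  have h1 : leb01.real {x | ((haarMem p k 0 0 : LpI p) : ℝ → ℝ) x ≠ 0} = 1 := by
    rw [← probReal_univ (μ := leb01)]
    refine measureReal_congr ?_
    filter_upwards [coeFn_haar (p := p) 0 0, ae_mem_Ico] with x hx h01
    refine propext ?_
    change ((haarMem p k 0 0 : LpI p) : ℝ → ℝ) x ≠ 0 ↔ x ∈ Set.univ
    have h0 := dyadicIndex_lt (i := 0) h01
    rw [coe_haarMem (by omega) (by norm_num), hx, if_pos (by simpa using h0)]
    simp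
  simp only [h1, mul_one] at h
  rw [← h]
  exact measureReal_le_one

/-- Both sides are probability measures, so it suffices to compare them on sets that do not contain
0; the others follow by complements. -/
theorem isCompression_assembled {U : Submodule ℝ (LpI p)} (hd : DisjointRanges S)
    {θ : Fin N → ℝ} (hS : ∀ l, IsCompression (θ l) (S l)) (hθ0 : 0 < ∑ l, θ l)
    (hθ1 : ∑ l, θ l ≤ 1) {J : Fin N → (U →ₗ[ℝ] V)} (hJ : ∀ l, IsDistEmbedding (J l)) :
    IsCompression (∑ l, θ l) (assembled S J) := by
  refine ⟨hθ0, hθ1, fun f => ?_⟩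
  have hpr : ∀ u : LpI p, IsProbabilityMeasure (distr u) := fun u =>
    Measure.isProbabilityMeasure_map (measurable_coeFn u).aemeasurable
  have key : ∀ B : Set ℝ, MeasurableSet B → (0 : ℝ) ∉ B →
      distr (assembled S J f : LpI p) B = ENNReal.ofReal (∑ l, θ l) * distr (f : LpI p) B := by
    intro B hB h0
    rw [assembled_apply, distr_joint hd hS _ hB h0,
      ENNReal.ofReal_sum_of_nonneg fun l _ => (hS l).1.le, Finset.sum_mul]
    exact Finset.sum_congr rfl fun l _ => by rw [hJ l f]
  set ν : Measure ℝ := ENNReal.ofReal (∑ l, θ l) • distr (f : LpI p) +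
    ENNReal.ofReal (1 - ∑ l, θ l) • Measure.dirac 0 with hν
  have hνp : IsProbabilityMeasure ν := by
    refine ⟨?_⟩
    have := (hpr (f : LpI p)).measure_univ
    simp only [hν, Measure.add_apply, Measure.smul_apply, this, smul_eq_mul, mul_one, measure_univ]
    rw [← ENNReal.ofReal_add hθ0.le (by linarith)]
    simp
  have hνB : ∀ B : Set ℝ, MeasurableSet B → (0 : ℝ) ∉ B →
      ν B = ENNReal.ofReal (∑ l, θ l) * distr (f : LpI p) B := by
    intro B hB h0
    simp [hν, Measure.dirac_apply' _ hB, h0]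
  have := hpr (assembled S J f : LpI p)
  refine Measure.ext fun B hB => ?_
  by_cases h0 : (0 : ℝ) ∈ B
  · have h1 := key Bᶜ hB.compl (by simpa using h0)
    rw [← hνB Bᶜ hB.compl (by simpa using h0)] at h1
    rw [prob_compl_eq_one_sub hB, prob_compl_eq_one_sub hB] at h1
    have h2 := ENNReal.sub_right_inj ENNReal.one_ne_top (prob_le_one (μ := distr
      (assembled S J f : LpI p)) (s := B)) (prob_le_one (μ := ν) (s := B))
    exact h2.mp h1
  · rw [key B hB h0, hνB B hB h0]

end Compressions

/-! ### Hölder bounds for bounded functions of small support -/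

section Bounds

variable {p : ℝ≥0∞}

/-- Functions bounded by one and supported by a set of measure at most `M`. -/
def UnitSupported (u : LpI p) (M : ℝ) : Prop :=
  (∀ᵐ x ∂leb01, |(u : ℝ → ℝ) x| ≤ 1) ∧ leb01.real {x | (u : ℝ → ℝ) x ≠ 0} ≤ M

theorem measurableSet_coeFn_ne_zero (u : LpI p) : MeasurableSet {x | (u : ℝ → ℝ) x ≠ 0} :=
  measurable_coeFn u (measurableSet_singleton 0).compl

theorem UnitSupported.norm_le {u : LpI p} {M : ℝ}
    (h : UnitSupported u M) : ‖u‖ ≤ M ^ (1 / p.toReal) := by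
  set A := {x | (u : ℝ → ℝ) x ≠ 0}
  have hA : MeasurableSet A := measurableSet_coeFn_ne_zero u
  have h1 : eLpNorm u p leb01 = eLpNorm u p (leb01.restrict A) := by
    rw [← eLpNorm_indicator_eq_eLpNorm_restrict hA]
    congr 1
    ext x
    by_cases hx : (u : ℝ → ℝ) x = 0
    · simp [hx, Set.indicator_apply]
    · rw [Set.indicator_of_mem (show x ∈ A from hx)]
  have h2 := eLpNorm_le_of_ae_bound (p := p) (μ := leb01.restrict A) (f := (u : ℝ → ℝ)) (C := 1)
    (ae_restrict_of_ae h.1)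
  rw [← h1] at h2
  have h3 : ‖u‖ ≤ (leb01.real A) ^ (1 / p.toReal) := by
    rw [Lp.norm_def]
    refine (ENNReal.toReal_mono ?_ h2).trans (le_of_eq ?_)
    · exact ENNReal.mul_ne_top (ENNReal.rpow_ne_top_of_nonneg (by positivity)
        (measure_ne_top _ _)) ENNReal.ofReal_ne_top
    · simp [← ENNReal.toReal_rpow, measureReal_def]
  exact h3.trans (Real.rpow_le_rpow measureReal_nonneg h.2 (by positivity))

theorem UnitSupported.integrable_mul [Fact (1 ≤ p)] {u : LpI p} {M : ℝ} (h : UnitSupported u M)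
    (f : LpI p) :
    Integrable (fun x => (f : ℝ → ℝ) x * (u : ℝ → ℝ) x) leb01 := by
  refine (integrable_coeFn f).mul_bdd (c := 1) (measurable_coeFn u).aestronglyMeasurable ?_
  simpa using h.1

/-- The pairing is at most the L_1 norm of `f` on the support of `u`; comparing L_1 with L_p there
costs the power 1 - 1/p of its measure. -/
theorem UnitSupported.abs_pairing_le [Fact (1 ≤ p)] (hp1 : 1 < p) (hp : p ≠ ∞) {u : LpI p}
    {M : ℝ} (h : UnitSupported u M) (f : LpI p) :
    |pairing f u| ≤ M ^ (1 - 1 / p.toReal) * ‖f‖ := by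
  set A := {x | (u : ℝ → ℝ) x ≠ 0}
  have hA : MeasurableSet A := measurableSet_coeFn_ne_zero u
  have hpr : 1 < p.toReal := by
    rw [← ENNReal.toReal_one]
    exact (ENNReal.toReal_lt_toReal ENNReal.one_ne_top hp).mpr hp1
  have h1 : |pairing f u| ≤ ∫ x in A, |(f : ℝ → ℝ) x| ∂leb01 := by
    rw [pairing, ← Real.norm_eq_abs]
    refine (norm_integral_le_integral_norm _).trans ?_
    rw [← integral_indicator hA]
    refine integral_mono_ae (h.integrable_mul f).norm ((integrable_coeFn f).abs.indicator hA) ?_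
    filter_upwards [h.1] with x hx
    by_cases hu : (u : ℝ → ℝ) x = 0
    · rw [hu, mul_zero, norm_zero]
      exact Set.indicator_nonneg (fun _ _ => abs_nonneg _) x
    · rw [Set.indicator_of_mem (show x ∈ A from hu), Real.norm_eq_abs, abs_mul]
      exact mul_le_of_le_one_right (abs_nonneg _) hx
  have h2 : ∫ x in A, |(f : ℝ → ℝ) x| ∂leb01 =
      (eLpNorm f 1 (leb01.restrict A)).toReal := by
    rw [eLpNorm_one_eq_lintegral_enorm, ← integral_norm_eq_lintegral_enorm
      (measurable_coeFn f).aestronglyMeasurable]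
    rfl
  have h3 := eLpNorm_le_eLpNorm_mul_rpow_measure_univ (μ := leb01.restrict A) hp1.le
    (measurable_coeFn f).aestronglyMeasurable
  have h4 : eLpNorm f p (leb01.restrict A) ≤ eLpNorm f p leb01 := eLpNorm_restrict_le _ _ _ _
  have h5 : (eLpNorm f 1 (leb01.restrict A)).toReal ≤
      ‖f‖ * (leb01.real A) ^ (1 - 1 / p.toReal) := by
    rw [Lp.norm_def, measureReal_def, ENNReal.toReal_rpow, ← ENNReal.toReal_mul]
    have h6 : (0 : ℝ) ≤ 1 - 1 / p.toReal := by
      rw [sub_nonneg, div_le_one (by linarith)]; exact hpr.le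
    refine ENNReal.toReal_mono (ENNReal.mul_ne_top (Lp.eLpNorm_ne_top f)
      (ENNReal.rpow_ne_top_of_nonneg h6 (measure_ne_top _ _))) (h3.trans ?_)
    rw [Measure.restrict_apply_univ, ENNReal.toReal_one, div_one]
    gcongr
  rw [h2] at h1
  refine h1.trans (h5.trans ?_)
  rw [mul_comm]
  refine mul_le_mul_of_nonneg_right (Real.rpow_le_rpow measureReal_nonneg h.2 ?_) (norm_nonneg _)
  rw [sub_nonneg, div_le_one (by linarith)]; exact hpr.le

theorem unitSupported_joint_nodeComb {k N : ℕ} {X : Submodule ℝ (LpI p)}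
    {S : Fin N → (LpHaar p k →ₗ[ℝ] X)} (hd : DisjointRanges S) {θ : Fin N → ℝ}
    (hS : ∀ l, IsCompression (θ l) (S l)) {i : ℕ} (hi : i < k) {B : Finset (Fin N × ℕ)}
    (hB : B ⊆ nodes N i) {ξ : Fin N × ℕ → ℝ} (hξ : ∀ a, |ξ a| ≤ 1) :
    UnitSupported (joint S (nodeComb (haarFamily p k N) i B ξ) : LpI p) (nodeWeight θ i B) := by
  refine ⟨joint_ae_abs_le_one hd hS fun l => ?_, ?_⟩
  · filter_upwards [coeFn_nodeComb_haarFamily (p := p) hi hB ξ l] with x hx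
    rw [hx]
    split_ifs
    · rw [abs_mul, abs_pow]; simpa using hξ _
    · simp
  · rw [joint_measureReal_support hd hS, nodeWeight,
      ← Finset.sum_fiberwise B Prod.fst]
    refine Finset.sum_le_sum fun l _ => ?_
    set A := {x | ((nodeComb (haarFamily p k N) i B ξ l : LpI p) : ℝ → ℝ) x ≠ 0}
    set A' := ⋃ a ∈ B.filter fun a => a.1 = l, {x | dyadicIndex i x = a.2}
    have h0 : A ≤ᵐ[leb01] A' := by
      filter_upwards [coeFn_nodeComb_haarFamily (p := p) hi hB ξ l] with x hx hne
      change x ∈ A'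
      have hne' : ((nodeComb (haarFamily p k N) i B ξ l : LpI p) : ℝ → ℝ) x ≠ 0 := hne
      rw [hx] at hne'
      by_cases hm : (l, dyadicIndex i x) ∈ B
      · simp only [A', Set.mem_iUnion]
        exact ⟨_, Finset.mem_filter.mpr ⟨hm, rfl⟩, rfl⟩
      · rw [if_neg hm] at hne'; exact absurd rfl hne'
    have h1 : leb01.real A ≤ leb01.real A' :=
      ENNReal.toReal_mono (measure_ne_top _ _) (measure_mono_ae h0)
    have h2 := h1.trans (measureReal_biUnion_finset_le _ _)
    have h3 : ∑ a ∈ B.filter fun a => a.1 = l, leb01.real {x | dyadicIndex i x = a.2} =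
        ∑ a ∈ B.filter fun a => a.1 = l, (1 / 2 : ℝ) ^ i := by
      refine Finset.sum_congr rfl fun a ha => ?_
      exact leb01_dyadicIndex (mem_nodes.mp (hB (Finset.mem_filter.mp ha).1))
    rw [h3] at h2
    refine (mul_le_mul_of_nonneg_left h2 (hS l).1.le).trans (le_of_eq ?_)
    rw [Finset.mul_sum]
    refine Finset.sum_congr rfl fun a ha => ?_
    rw [(Finset.mem_filter.mp ha).2, one_div, inv_pow]
    rfl

end Bounds

/-! ### The pairing on bounded functions, and orthogonality of Haar functions -/

section Pairing

variable {p : ℝ≥0∞}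

/-- Essentially bounded elements of `L_p`. -/
def EssBounded (u : LpI p) : Prop := ∃ C : ℝ, ∀ᵐ x ∂leb01, |(u : ℝ → ℝ) x| ≤ C

theorem EssBounded.add {u v : LpI p} (hu : EssBounded u) (hv : EssBounded v) :
    EssBounded (u + v) := by
  obtain ⟨C, hC⟩ := hu
  obtain ⟨D, hD⟩ := hv
  refine ⟨C + D, ?_⟩
  filter_upwards [hC, hD, Lp.coeFn_add u v] with x h1 h2 h3
  rw [h3, Pi.add_apply]
  exact (abs_add_le _ _).trans (add_le_add h1 h2)

theorem UnitSupported.essBounded {u : LpI p} {M : ℝ} (h : UnitSupported u M) : EssBounded u :=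
  ⟨1, h.1⟩

theorem essBounded_of_mem_LpHaar {n : ℕ} {f : LpI p} (hf : f ∈ LpHaar p n) : EssBounded f := by
  refine ⟨∑ L ∈ Finset.range (2 ^ n), |dyadicAverage n L f|, ?_⟩
  filter_upwards [LpHaar_eq_dyadicAverage hf, ae_mem_Ico] with x hx h01
  rw [hx]
  exact Finset.single_le_sum (f := fun L => |dyadicAverage n L f|) (fun _ _ => abs_nonneg _)
    (Finset.mem_range.mpr (dyadicIndex_lt h01))

theorem EssBounded.integrable_mul [Fact (1 ≤ p)] {u v : LpI p} (hu : EssBounded u) :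
    Integrable (fun x => (v : ℝ → ℝ) x * (u : ℝ → ℝ) x) leb01 := by
  obtain ⟨C, hC⟩ := hu
  exact (integrable_coeFn v).mul_bdd (c := C) (measurable_coeFn u).aestronglyMeasurable
    (by simpa using hC)

theorem EssBounded.memLp {u : LpI p} (hu : EssBounded u) (q : ℝ≥0∞) : MemLp u q leb01 := by
  obtain ⟨C, hC⟩ := hu
  exact MemLp.of_bound (measurable_coeFn u).aestronglyMeasurable C (by simpa using hC)

theorem pairing_comm (u v : LpI p) : pairing u v = pairing v u := by
  simp only [pairing, mul_comm]

theorem pairing_add_left [Fact (1 ≤ p)] {u : LpI p} (hu : EssBounded u) (f g : LpI p) :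
    pairing (f + g) u = pairing f u + pairing g u := by
  rw [pairing, pairing, pairing, ← integral_add hu.integrable_mul hu.integrable_mul]
  refine integral_congr_ae ?_
  filter_upwards [Lp.coeFn_add f g] with x hx
  rw [hx, Pi.add_apply, add_mul]

theorem pairing_smul_left (c : ℝ) (f u : LpI p) : pairing (c • f) u = c * pairing f u := by
  rw [pairing, pairing, ← integral_const_mul]
  refine integral_congr_ae ?_
  filter_upwards [Lp.coeFn_smul c f] with x hx
  rw [hx, Pi.smul_apply, smul_eq_mul, mul_assoc]

theorem pairing_add_self [Fact (1 ≤ p)] {u v : LpI p} (hu : EssBounded u) (hv : EssBounded v) :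
    pairing (u + v) (u + v) = pairing u u + 2 * pairing u v + pairing v v := by
  rw [pairing_add_left (hu.add hv), pairing_comm u, pairing_comm v, pairing_add_left hu,
    pairing_add_left hv, pairing_comm v u]
  ring

theorem pairing_self_eq_integral_distr (u : LpI p) :
    pairing u u = ∫ y, y ^ 2 ∂(distr u) := by
  rw [distr, integral_map (measurable_coeFn u).aemeasurable
    (by fun_prop)]
  simp only [pairing, sq]

section Compression

variable {n : ℕ} {X : Submodule ℝ (LpI p)} {θ : ℝ} {S : LpHaar p n →ₗ[ℝ] X}

theorem IsCompression.essBounded (hS : IsCompression θ S) (f : LpHaar p n) :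
    EssBounded (S f : LpI p) := by
  obtain ⟨C, hC⟩ := essBounded_of_mem_LpHaar f.2
  have hB : MeasurableSet {y : ℝ | |C| < |y|} := measurableSet_lt measurable_const measurable_abs
  refine ⟨|C|, ?_⟩
  have h1 : distr (f : LpI p) {y : ℝ | |C| < |y|} = 0 := by
    rw [distr_apply _ hB, measure_eq_zero_iff_ae_notMem]
    filter_upwards [hC] with x hx
    simpa using hx.trans (le_abs_self C)
  have h2 : distr (S f : LpI p) {y : ℝ | |C| < |y|} = 0 := by
    rw [hS.2.2 f]
    simp [h1, Measure.dirac_apply' _ hB]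
  rw [distr_apply _ hB, measure_eq_zero_iff_ae_notMem] at h2
  filter_upwards [h2] with x hx
  simpa using hx

theorem IsCompression.pairing_self [Fact (1 ≤ p)] (hS : IsCompression θ S) (f : LpHaar p n) :
    pairing (S f : LpI p) (S f) = θ * pairing (f : LpI p) f := by
  have hsq : AEStronglyMeasurable (fun y : ℝ => y ^ 2) (distr (f : LpI p)) := by fun_prop
  have hint : Integrable (fun y : ℝ => y ^ 2) (distr (f : LpI p)) := by
    rw [distr, integrable_map_measure hsq (measurable_coeFn _).aemeasurable]
    have := (essBounded_of_mem_LpHaar f.2).integrable_mul (v := (f : LpI p))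
    simpa only [Function.comp_def, sq] using this
  rw [pairing_self_eq_integral_distr, pairing_self_eq_integral_distr, hS.2.2 f,
    integral_add_measure (hint.smul_measure ENNReal.ofReal_ne_top)
      ((integrable_dirac (by simp)).smul_measure ENNReal.ofReal_ne_top),
    integral_smul_measure, integral_smul_measure, integral_dirac,
    ENNReal.toReal_ofReal hS.1.le]
  simp

/-- Second moments depend on the distribution only; polarization passes from these to the pairing.
-/
theorem IsCompression.pairing_eq [Fact (1 ≤ p)] (hS : IsCompression θ S) (f g : LpHaar p n) :
    pairing (S f : LpI p) (S g) = θ * pairing (f : LpI p) g := by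
  have h := hS.pairing_self (f + g)
  rw [map_add, Submodule.coe_add, Submodule.coe_add,
    pairing_add_self (hS.essBounded f) (hS.essBounded g),
    pairing_add_self (essBounded_of_mem_LpHaar f.2) (essBounded_of_mem_LpHaar g.2),
    hS.pairing_self, hS.pairing_self] at h
  linarith

end Compression

/-- The coarser Haar function is constant on the support of the finer one, which has mean zero. -/
theorem pairing_haar_of_lt [Fact (1 ≤ p)] {t t' j j' : ℕ} (htt : t < t') (hj' : j' < 2 ^ t') :
    pairing (haar p t j) (haar p t' j') = 0 := by
  have h : pairing (haar p t j) (haar p t' j') =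
      ∫ x, haarValue j (j' / 2 ^ (t' - (t + 1))) * (haar p t' j' : ℝ → ℝ) x ∂leb01 := by
    refine integral_congr_ae ?_
    filter_upwards [coeFn_haar_eq_of_lt (p := p) (j := j) htt, coeFn_haar (p := p) t' j']
      with x h1 h2
    rw [h1, h2]
    by_cases hx : dyadicIndex t' x = j' <;> simp [hx]
  rw [h, integral_const_mul, integral_haar hj', mul_zero]

theorem pairing_haar [Fact (1 ≤ p)] {t t' j j' : ℕ} (hj : j < 2 ^ t) (hj' : j' < 2 ^ t') :
    pairing (haar p t j) (haar p t' j') = if (t, j) = (t', j') then (1 / 2 : ℝ) ^ t else 0 := by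
  rcases lt_trichotomy t t' with h | rfl | h
  · rw [pairing_haar_of_lt h hj', if_neg (by simp [h.ne])]
  · have hm : MeasurableSet {x | dyadicIndex t x = j} :=
      measurable_dyadicIndex t (measurableSet_singleton j)
    by_cases hjj : j = j'
    · subst hjj
      rw [if_pos rfl, ← leb01_dyadicIndex hj, ← integral_indicator_one hm]
      refine integral_congr_ae ?_
      filter_upwards [coeFn_haar (p := p) t j] with x hx
      rw [hx]
      by_cases h : dyadicIndex t x = j
      · simp [h, ← mul_pow]
      · simp [h]
    · rw [if_neg (by simp [hjj]), pairing, ← integral_zero ℝ ℝ (μ := leb01)]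
      refine integral_congr_ae ?_
      filter_upwards [coeFn_haar (p := p) t j, coeFn_haar (p := p) t j'] with x h1 h2
      rw [h1, h2]
      by_cases h : dyadicIndex t x = j
      · simp [h, hjj]
      · simp [h]
  · rw [pairing_comm, pairing_haar_of_lt h hj, if_neg (by simp [h.ne'])]

end Pairing

/-! ### The orthogonal projection onto the span of an orthogonal system -/

section Projection

variable {p : ℝ≥0∞} [Fact (1 ≤ p)]

/-- The functional `f ↦ ⟨f, u⟩` for a bounded function `u`. -/
noncomputable def pairingCLM (u : LpI p) (C : ℝ) (hu : EssBounded u)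
    (hC : ∀ f, |pairing f u| ≤ C * ‖f‖) : LpI p →L[ℝ] ℝ :=
  LinearMap.mkContinuous
    { toFun := fun f => pairing f u
      map_add' := pairing_add_left hu
      map_smul' := fun c f => pairing_smul_left c f u } C hC

/-- An orthogonal system of bounded functions. -/
structure OrthSystem {ι : Type*} (y : ι → LpI p) (c : ι → ℝ) (C : ℝ) : Prop where
  pos : ∀ i, 0 < c i
  essBounded : ∀ i, EssBounded (y i)
  bound : ∀ i f, |pairing f (y i)| ≤ C * ‖f‖
  self : ∀ i, pairing (y i) (y i) = c i
  orth : ∀ i j, i ≠ j → pairing (y i) (y j) = 0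

variable {ι : Type*} [Fintype ι] {Y : Submodule ℝ (LpI p)} {y : ι → Y} {c : ι → ℝ} {C : ℝ}

/-- The orthogonal projection onto the span of an orthogonal system of bounded functions. -/
noncomputable def orthProj (h : OrthSystem (fun i => (y i : LpI p)) c C) : LpI p →L[ℝ] Y :=
  ∑ i, (c i)⁻¹ • (pairingCLM (y i : LpI p) C (h.essBounded i) (h.bound i)).smulRight (y i)

theorem orthProj_apply (h : OrthSystem (fun i => (y i : LpI p)) c C) (f : LpI p) :
    orthProj h f = ∑ i, (pairing f (y i) / c i) • y i := by
  rw [orthProj, sum_apply]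
  refine Finset.sum_congr rfl fun i _ => ?_
  rw [smul_apply, ContinuousLinearMap.smulRight_apply, smul_smul,
    div_eq_inv_mul]
  rfl

theorem orthProj_coe (h : OrthSystem (fun i => (y i : LpI p)) c C)
    (hY : ∀ v : Y, v ∈ Submodule.span ℝ (Set.range y)) (v : Y) : orthProj h v = v := by
  classical
  induction hY v using Submodule.span_induction with
  | mem v hv =>
    obtain ⟨j, rfl⟩ := hv
    rw [orthProj_apply, Finset.sum_eq_single j]
    · rw [h.self, div_self (h.pos j).ne', one_smul]
    · intro i _ hij
      rw [h.orth j i hij.symm, zero_div, zero_smul]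
    · simp
  | zero => simp
  | add u v _ _ hu hv => rw [Submodule.coe_add, map_add, hu, hv]
  | smul a v _ hv => rw [Submodule.coe_smul, map_smul, hv]

theorem inner_eq_integral_mul (f g : LpI 2) :
    inner ℝ f g = ∫ x, (g : ℝ → ℝ) x * (f : ℝ → ℝ) x ∂leb01 := by
  rw [L2.inner_def]
  simp [mul_comm]

/-- The `y i` are bounded, so they also define elements of L_2, where the same formula gives the
self-adjoint idempotent. -/
theorem isOrthProj_orthProj (h : OrthSystem (fun i => (y i : LpI p)) c C)
    (hY : ∀ v : Y, v ∈ Submodule.span ℝ (Set.range y)) : IsOrthProj Y (orthProj h) := by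
  classical
  refine ⟨fun v => ⟨v, orthProj_coe h hY v⟩, ?_⟩
  set z : ι → LpI 2 := fun i => ((h.essBounded i).memLp 2).toLp _
  have hz : ∀ i, (z i : ℝ → ℝ) =ᵐ[leb01] (y i : LpI p) := fun i => MemLp.coeFn_toLp _
  have hzz : ∀ i j, inner ℝ (z i) (z j) = if i = j then c i else 0 := by
    intro i j
    have : inner ℝ (z i) (z j) = pairing (y j : LpI p) (y i) := by
      rw [inner_eq_integral_mul]
      refine integral_congr_ae ?_
      filter_upwards [hz i, hz j] with x h1 h2
      rw [h1, h2]
    rw [this]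
    split_ifs with hij
    · subst hij; exact h.self i
    · exact h.orth j i (Ne.symm hij)
  set P : LpI 2 →L[ℝ] LpI 2 := ∑ i, (c i)⁻¹ • (innerSL ℝ (z i)).smulRight (z i) with hP
  have hPa : ∀ f, P f = ∑ i, (inner ℝ (z i) f / c i) • z i := by
    intro f
    rw [hP, sum_apply]
    refine Finset.sum_congr rfl fun i _ => ?_
    rw [smul_apply, ContinuousLinearMap.smulRight_apply, smul_smul,
      div_eq_inv_mul]
    rfl
  refine ⟨P, ⟨?_, ?_⟩, ?_⟩
  · refine ContinuousLinearMap.ext fun f => ?_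
    change P (P f) = P f
    have hPz : ∀ i, P (z i) = z i := by
      intro i
      rw [hPa, Finset.sum_eq_single i]
      · rw [hzz, if_pos rfl, div_self (h.pos i).ne', one_smul]
      · intro j _ hji
        rw [hzz, if_neg hji, zero_div, zero_smul]
      · simp
    rw [hPa f, map_sum]
    exact Finset.sum_congr rfl fun i _ => by rw [map_smul, hPz]
  · rw [ContinuousLinearMap.isSelfAdjoint_iff_isSymmetric]
    intro f g
    change inner ℝ (P f) g = inner ℝ f (P g)
    rw [hPa, hPa, sum_inner, inner_sum]
    refine Finset.sum_congr rfl fun i _ => ?_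
    rw [real_inner_smul_left, real_inner_smul_right, real_inner_comm f (z i)]
    ring
  · intro f g hfg
    rw [orthProj_apply, hPa, AddSubmonoidClass.coe_finsetSum]
    have hco : ∀ i, inner ℝ (z i) g = pairing f (y i : LpI p) := by
      intro i
      rw [inner_eq_integral_mul]
      refine integral_congr_ae ?_
      filter_upwards [hz i, hfg] with x h1 h2
      rw [h1, h2]
    have h1 : ∀ᵐ x ∂leb01, ∀ i,
        (((pairing f (y i : LpI p) / c i) • y i : Y) : LpI p) x =
          ((inner ℝ (z i) g / c i) • z i : LpI 2) x := by
      refine ae_all_iff.mpr fun i => ?_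
      filter_upwards [hz i, Lp.coeFn_smul (pairing f (y i : LpI p) / c i) (y i : LpI p),
        Lp.coeFn_smul (inner ℝ (z i) g / c i) (z i)] with x h1 h2 h3
      rw [h3, Submodule.coe_smul, h2, Pi.smul_apply, Pi.smul_apply, h1, hco]
    filter_upwards [h1, coeFn_sum Finset.univ fun i =>
        (((pairing f (y i : LpI p) / c i) • y i : Y) : LpI p),
      coeFn_sum Finset.univ fun i => ((inner ℝ (z i) g / c i) • z i : LpI 2)] with x h2 h3 h4
    refine h3.trans (Eq.trans ?_ h4.symm)
    exact Finset.sum_congr rfl fun i _ => h2 i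

end Projection

/-! ### Operators of finite rank as sums of rank one operators -/

section FiniteRank

variable {Z F : Type*} [NormedAddCommGroup Z] [NormedSpace ℝ Z] [NormedAddCommGroup F]
  [NormedSpace ℝ F]

/-- Rank one pieces are split off one at a time by a Hahn–Banach functional `ψ` norming a unit
vector `f₁` of the range. Each step at most doubles the norm, whence the factor 2^m. -/
theorem exists_decomposition_of_finrank_le (m : ℕ) (Q : Z →L[ℝ] F)
    [FiniteDimensional ℝ (LinearMap.range (Q : Z →ₗ[ℝ] F))]
    (h : Module.finrank ℝ (LinearMap.range (Q : Z →ₗ[ℝ] F)) ≤ m) :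
    ∃ (φ : Fin m → Z →L[ℝ] ℝ) (f : Fin m → F), (∀ z, Q z = ∑ j, φ j z • f j) ∧
      ∀ j, ‖φ j‖ ≤ 2 ^ m * ‖Q‖ ∧ ‖f j‖ ≤ 1 := by
  induction m generalizing Q with
  | zero =>
    have h0 : LinearMap.range (Q : Z →ₗ[ℝ] F) = ⊥ := Submodule.finrank_eq_zero.mp (by omega)
    refine ⟨fun _ => 0, fun _ => 0, fun z => ?_, fun j => j.elim0⟩
    have := LinearMap.congr_fun (LinearMap.range_eq_bot.mp h0) z
    simpa using this
  | succ m ih =>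
    by_cases hQ : ∃ z, Q z ≠ 0
    swap
    · push Not at hQ
      exact ⟨fun _ => 0, fun _ => 0, fun z => by simp [hQ z], fun j => by simp⟩
    obtain ⟨z₀, hz₀⟩ := hQ
    have hn : ‖Q z₀‖ ≠ 0 := norm_ne_zero_iff.mpr hz₀
    obtain ⟨ψ, hψ1, hψ2⟩ := exists_dual_vector ℝ (Q z₀) hn
    set f₁ : F := ‖Q z₀‖⁻¹ • Q z₀ with hf₁
    have hψf : ψ f₁ = 1 := by
      rw [hf₁, map_smul, hψ2, smul_eq_mul]
      exact inv_mul_cancel₀ hn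
    have hf1 : ‖f₁‖ = 1 := by
      rw [hf₁, norm_smul, norm_inv, norm_norm, inv_mul_cancel₀ hn]
    set Q' : Z →L[ℝ] F := Q - (ψ ∘L Q).smulRight f₁ with hQ'
    have hQ'a : ∀ z, Q' z = Q z - ψ (Q z) • f₁ := fun z => rfl
    have hf₁r : f₁ ∈ LinearMap.range (Q : Z →ₗ[ℝ] F) :=
      Submodule.smul_mem _ _ ⟨z₀, rfl⟩
    -- The range of `Q'` lies in the kernel of `ψ`, so it misses `f₁`.
    have hlt : LinearMap.range (Q' : Z →ₗ[ℝ] F) < LinearMap.range (Q : Z →ₗ[ℝ] F) := by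
      refine lt_of_le_of_ne ?_ fun heq => ?_
      · rintro _ ⟨z, rfl⟩
        exact Submodule.sub_mem _ ⟨z, rfl⟩ (Submodule.smul_mem _ _ hf₁r)
      · rw [← heq] at hf₁r
        obtain ⟨z, hz⟩ := hf₁r
        have h1 : Q z - ψ (Q z) • f₁ = f₁ := hz
        have h2 := congrArg ψ h1
        rw [map_sub, map_smul, hψf, smul_eq_mul, mul_one, sub_self] at h2
        exact zero_ne_one h2
    have hfd : FiniteDimensional ℝ (LinearMap.range (Q' : Z →ₗ[ℝ] F)) :=
      Submodule.finiteDimensional_of_le hlt.le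
    have hcard := Submodule.finrank_lt_finrank_of_lt hlt
    obtain ⟨φ, f, h1, h2⟩ := ih Q' (by omega)
    have hψQ : ‖ψ ∘L Q‖ ≤ ‖Q‖ := by
      refine (ContinuousLinearMap.opNorm_comp_le _ _).trans ?_
      rw [hψ1, one_mul]
    have hnorm : ‖Q'‖ ≤ 2 * ‖Q‖ := by
      refine (norm_sub_le _ _).trans ?_
      rw [ContinuousLinearMap.norm_smulRight_apply, hf1, mul_one]
      linarith
    refine ⟨Fin.cons (ψ ∘L Q) φ, Fin.cons f₁ f, fun z => ?_, fun j => ?_⟩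
    · rw [Fin.sum_univ_succ]
      simp only [Fin.cons_zero, Fin.cons_succ]
      rw [← h1 z, hQ'a]
      simp
    · refine Fin.cases ?_ (fun j => ?_) j
      · simp only [Fin.cons_zero]
        refine ⟨hψQ.trans ?_, hf1.le⟩
        have : (1 : ℝ) ≤ 2 ^ (m + 1) := one_le_pow₀ (by norm_num)
        nlinarith [norm_nonneg Q]
      · simp only [Fin.cons_succ]
        refine ⟨(h2 j).1.trans ?_, (h2 j).2⟩
        rw [pow_succ, mul_assoc]
        gcongr

theorem exists_decomposition_of_rank_le {m : ℕ} {Q : Z →L[ℝ] F}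
    (h : LinearMap.rank (Q : Z →ₗ[ℝ] F) ≤ m) :
    ∃ (φ : Fin m → Z →L[ℝ] ℝ) (f : Fin m → F), (∀ z, Q z = ∑ j, φ j z • f j) ∧
      ∀ j, ‖φ j‖ ≤ 2 ^ m * ‖Q‖ ∧ ‖f j‖ ≤ 1 := by
  have hfd : FiniteDimensional ℝ (LinearMap.range (Q : Z →ₗ[ℝ] F)) :=
    Module.rank_lt_aleph0_iff.mp (lt_of_le_of_lt h (Cardinal.natCast_lt_aleph0))
  exact exists_decomposition_of_finrank_le m Q (Module.finrank_le_of_rank_le h)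

end FiniteRank

/-! ### Pigeonhole choice of the levels -/

/-- Among sufficiently many consecutive levels there are `n` at which a bounded sequence is nearly
constant. -/
theorem exists_nearly_constant_levels (n : ℕ) (C : ℝ) {δ : ℝ} (hδ : 0 < δ) :
    ∃ L : ℕ, ∀ (M k : ℕ), M + L ≤ k → ∀ d : ℕ → ℝ, (∀ i < k, |d i| ≤ C) →
      ∃ g : ℕ → ℕ, (∀ s < n, g s < g (s + 1)) ∧ (∀ s < n, g s < k) ∧ (∀ s < n, M ≤ g s) ∧
        ∀ s < n, |d (g s) - d (g 0)| ≤ δ := by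
  -- The number of cells of length δ needed to cover [-C, C]; among b * n levels some cell receives
  -- n.
  set b : ℕ := ⌊2 * C / δ⌋₊ + 1 with hb
  refine ⟨b * n, fun M k hk d hd => ?_⟩
  have hmaps : ∀ i ∈ Finset.Ico M (M + b * n), ⌊(d i + C) / δ⌋₊ ∈ Finset.range b := by
    intro i hi
    have h1 := abs_le.mp (hd i (by rw [Finset.mem_Ico] at hi; omega))
    rw [Finset.mem_range, hb, Nat.lt_succ_iff]
    refine Nat.floor_le_floor ?_
    gcongr
    linarith
  obtain ⟨q, -, hq⟩ := Finset.exists_le_card_fiber_of_mul_le_card_of_maps_to hmaps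
    (n := n) ⟨0, by simp [hb]⟩ (by simp)
  set A := (Finset.Ico M (M + b * n)).filter fun i => ⌊(d i + C) / δ⌋₊ = q
  obtain ⟨A', hA', hcard⟩ := Finset.exists_subset_card_eq hq
  set o := A'.orderEmbOfFin hcard
  have ho : ∀ s, o s ∈ A := fun s => hA' (Finset.orderEmbOfFin_mem A' hcard s)
  -- The value k at s = n keeps g (n-1) < g n: the labels of length n live on level g n, one level
  -- beyond those used.
  set g : ℕ → ℕ := fun s => if h : s < n then o ⟨s, h⟩ else k with hg
  have hgA : ∀ s < n, g s ∈ A := fun s hs => by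
    simp only [hg, dif_pos hs]; exact ho _
  have hgr : ∀ s < n, M ≤ g s ∧ g s < k := fun s hs => by
    have := Finset.mem_Ico.mp (Finset.mem_filter.mp (hgA s hs)).1
    omega
  refine ⟨g, fun s hs => ?_, fun s hs => (hgr s hs).2, fun s hs => (hgr s hs).1, fun s hs => ?_⟩
  · by_cases hs' : s + 1 < n
    · simp only [hg, dif_pos hs, dif_pos hs']
      exact o.strictMono (by simp)
    · have h2 : g (s + 1) = k := by simp only [hg, dif_neg hs']
      rw [h2]; exact (hgr s hs).2
  · have key : ∀ t < n, (q : ℝ) * δ ≤ d (g t) + C ∧ d (g t) + C < (q + 1) * δ := by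
      intro t ht
      have h1 := (Finset.mem_filter.mp (hgA t ht)).2
      have h0 : 0 ≤ (d (g t) + C) / δ := by
        have := abs_le.mp (hd (g t) (hgr t ht).2)
        exact div_nonneg (by linarith) hδ.le
      rw [Nat.floor_eq_iff h0, le_div_iff₀ hδ, div_lt_iff₀ hδ] at h1
      exact h1
    have h1 := key s hs
    have h2 := key 0 (by omega)
    rw [abs_le]
    constructor <;> linarith [h1.1, h1.2, h2.1, h2.2]

/-! ### Norm estimates through matrix entries -/

section Estimates

variable {p : ℝ≥0∞} [Fact (1 ≤ p)] {ι : Type*} [Fintype ι] {Y : Submodule ℝ (LpI p)} {y : ι → Y}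
  {c : ι → ℝ} {A B c₀ : ℝ}

theorem norm_orthProj_apply_le (h : OrthSystem (fun i => (y i : LpI p)) c A) (hB : ∀ i, ‖y i‖ ≤ B)
    (hc₀ : 0 < c₀) (hc : ∀ i, c₀ ≤ c i) {f : LpI p} {a : ℝ} (ha0 : 0 ≤ a)
    (ha : ∀ i, |pairing f (y i)| ≤ a) : ‖orthProj h f‖ ≤ Fintype.card ι * (a / c₀ * B) := by
  rw [orthProj_apply]
  refine (norm_sum_le _ _).trans ((Finset.sum_le_card_nsmul _ _ (a / c₀ * B) fun i _ => ?_).trans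
    (by rw [nsmul_eq_mul, Finset.card_univ]))
  rw [norm_smul, Real.norm_eq_abs, abs_div, abs_of_pos (h.pos i)]
  have := ha i
  have := hc i
  have := hB i
  gcongr

theorem norm_comp_orthProj_apply_le {W : Type*} [NormedAddCommGroup W] [NormedSpace ℝ W]
    (h : OrthSystem (fun i => (y i : LpI p)) c A) (hA : 0 ≤ A)
    (hc₀ : 0 < c₀) (hc : ∀ i, c₀ ≤ c i) (R : Y →L[ℝ] W) {a : ℝ}
    (ha : ∀ i, ‖R (y i)‖ ≤ a) (f : LpI p) :
    ‖R (orthProj h f)‖ ≤ Fintype.card ι * (A / c₀ * a) * ‖f‖ := by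
  rw [orthProj_apply, map_sum]
  refine (norm_sum_le _ _).trans ((Finset.sum_le_card_nsmul _ _ (A / c₀ * a * ‖f‖)
    fun i _ => ?_).trans (le_of_eq (by rw [nsmul_eq_mul, Finset.card_univ]; ring)))
  rw [map_smul, norm_smul, Real.norm_eq_abs, abs_div, abs_of_pos (h.pos i)]
  have h1 := h.bound i f
  have h2 := hc i
  have h3 := ha i
  calc |pairing f (y i)| / c i * ‖R (y i)‖ ≤ A * ‖f‖ / c₀ * a := by gcongr
    _ = A / c₀ * a * ‖f‖ := by ring

theorem norm_orthProj_comp_sub_le [DecidableEq ι] (h : OrthSystem (fun i => (y i : LpI p)) c A)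
    (hY : ∀ v : Y, v ∈ Submodule.span ℝ (Set.range y)) (hA : 0 ≤ A) (hB : ∀ i, ‖y i‖ ≤ B)
    (hB0 : 0 ≤ B) (hc₀ : 0 < c₀) (hc : ∀ i, c₀ ≤ c i) (R : Y →L[ℝ] LpI p) (r : ℝ) {a : ℝ}
    (ha0 : 0 ≤ a)
    (ha : ∀ i j, |pairing (R (y j)) (y i) - if i = j then r * c i else 0| ≤ a) :
    ‖orthProj h ∘L R - r • ContinuousLinearMap.id ℝ Y‖ ≤
      Fintype.card ι * (A / c₀ * (Fintype.card ι * (a / c₀ * B))) := by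
  set D : Y →L[ℝ] Y := orthProj h ∘L R - r • ContinuousLinearMap.id ℝ Y
  have hD : ∀ j, ‖D (y j)‖ ≤ Fintype.card ι * (a / c₀ * B) := by
    intro j
    have h1 : D (y j) =
        ∑ i, ((pairing (R (y j)) (y i) - if i = j then r * c i else 0) / c i) • y i := by
      change orthProj h (R (y j)) - r • y j = _
      rw [orthProj_apply]
      simp_rw [sub_div, sub_smul]
      rw [Finset.sum_sub_distrib]
      congr 1
      rw [Finset.sum_eq_single j]
      · rw [if_pos rfl, mul_div_cancel_right₀ _ (h.pos j).ne']
      · intro i _ hij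
        rw [if_neg hij, zero_div, zero_smul]
      · simp
    rw [h1]
    refine (norm_sum_le _ _).trans ((Finset.sum_le_card_nsmul _ _ (a / c₀ * B)
      fun i _ => ?_).trans (by rw [nsmul_eq_mul, Finset.card_univ]))
    rw [norm_smul, Real.norm_eq_abs, abs_div, abs_of_pos (h.pos i)]
    have := ha i j
    have := hc i
    have := hB i
    gcongr
  refine ContinuousLinearMap.opNorm_le_bound _ (by positivity) fun v => ?_
  -- As v is its own projection, a bound for `D` composed with the projection is a bound for `D`.
  have h2 := norm_comp_orthProj_apply_le h hA hc₀ hc D hD v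
  rwa [orthProj_coe h hY] at h2

end Estimates

/-! ### The normalized form and functionals on N copies of the Haar space -/

section Joint

variable {p : ℝ≥0∞} [Fact (1 ≤ p)] {k N : ℕ} {X : Submodule ℝ (LpI p)}
  {S : Fin N → (LpHaar p k →ₗ[ℝ] X)} {θ : Fin N → ℝ}

omit [Fact (1 ≤ p)] in
theorem essBounded_joint (hd : DisjointRanges S) (hS : ∀ l, IsCompression (θ l) (S l))
    (F : Fin N → LpHaar p k) : EssBounded (joint S F : LpI p) := by
  choose C hC using fun l => essBounded_of_mem_LpHaar (F l).2
  have hB : MeasurableSet {y : ℝ | ∑ l, |C l| < |y|} :=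
    measurableSet_lt measurable_const measurable_abs
  have h0 : (0 : ℝ) ∉ {y : ℝ | ∑ l, |C l| < |y|} := by
    simpa using Finset.sum_nonneg fun l _ => abs_nonneg (C l)
  have h := distr_joint hd hS F hB h0
  have h2 : ∀ l, distr (F l : LpI p) {y : ℝ | ∑ l, |C l| < |y|} = 0 := fun l => by
    rw [distr_apply _ hB, measure_eq_zero_iff_ae_notMem]
    filter_upwards [hC l] with x hx
    have := Finset.single_le_sum (f := fun l => |C l|) (fun l _ => abs_nonneg (C l))
      (Finset.mem_univ l)
    simpa using (hx.trans (le_abs_self _)).trans this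
  simp only [h2, mul_zero, Finset.sum_const_zero] at h
  rw [distr_apply _ hB, measure_eq_zero_iff_ae_notMem] at h
  refine ⟨∑ l, |C l|, ?_⟩
  filter_upwards [h] with x hx
  simpa using hx

theorem pairing_add_right {u v : LpI p} (hu : EssBounded u) (hv : EssBounded v) (f : LpI p) :
    pairing f (u + v) = pairing f u + pairing f v := by
  rw [pairing, pairing, pairing, ← integral_add hu.integrable_mul hv.integrable_mul]
  refine integral_congr_ae ?_
  filter_upwards [Lp.coeFn_add u v] with x hx
  rw [hx, Pi.add_apply, mul_add]

omit [Fact (1 ≤ p)] in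
theorem pairing_smul_right (c : ℝ) (f u : LpI p) : pairing f (c • u) = c * pairing f u := by
  rw [pairing_comm, pairing_smul_left, pairing_comm]

/-- The functional `F ↦ ⟨f, ∑_l S_l F_l⟩`. -/
noncomputable def jointPairing (hb : ∀ F, EssBounded (joint S F : LpI p)) (f : LpI p) :
    (Fin N → LpHaar p k) →ₗ[ℝ] ℝ where
  toFun F := pairing f (joint S F)
  map_add' F G := by rw [map_add, Submodule.coe_add, pairing_add_right (hb F) (hb G)]
  map_smul' c F := by rw [map_smul, Submodule.coe_smul, pairing_smul_right]; rfl

/-- The bilinear form `(F, G) ↦ ⟨∑_l S_l F_l, T ∑_l S_l G_l⟩`. -/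
noncomputable def jointForm (hb : ∀ F, EssBounded (joint S F : LpI p)) (T : X →L[ℝ] LpI p) :
    (Fin N → LpHaar p k) →ₗ[ℝ] (Fin N → LpHaar p k) →ₗ[ℝ] ℝ :=
  LinearMap.mk₂ ℝ (fun F G => pairing (joint S F : LpI p) (T (joint S G)))
    (fun F F' G => by
      rw [map_add, Submodule.coe_add, pairing_comm, pairing_add_right (hb F) (hb F'),
        pairing_comm, pairing_comm (T (joint S G))])
    (fun c F G => by rw [map_smul, Submodule.coe_smul, pairing_smul_left]; rfl)
    (fun F G G' => by
      rw [map_add, map_add, pairing_comm, pairing_add_left (hb F), pairing_comm,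
        pairing_comm (T (joint S G'))])
    (fun c F G => by rw [map_smul, map_smul, pairing_smul_right]; rfl)

theorem jointForm_apply (hb : ∀ F, EssBounded (joint S F : LpI p)) (T : X →L[ℝ] LpI p)
    (F G : Fin N → LpHaar p k) :
    jointForm hb T F G = pairing (joint S F : LpI p) (T (joint S G)) := rfl

omit [Fact (1 ≤ p)] in
theorem nodeWeight_eq_sum_mul (hΘ : 0 < ∑ l, θ l) (i : ℕ) (B : Finset (Fin N × ℕ)) :
    nodeWeight θ i B = (∑ l, θ l) * nodeWeight (fun l => θ l / ∑ l, θ l) i B := by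
  rw [nodeWeight, nodeWeight, Finset.mul_sum]
  refine Finset.sum_congr rfl fun a _ => ?_
  field_simp

/-- Hölder's inequality gives the exponent 1 - 1/p for the first argument, and the L_p norm gives
1/p for the argument of `T`. With weights normalized to sum 1 the two powers of Θ = Σ θ_l multiply
to Θ, which the factor Θ⁻¹ removes. -/
theorem formBound_jointForm (hp1 : 1 < p) (hp : p ≠ ∞) (hd : DisjointRanges S)
    (hS : ∀ l, IsCompression (θ l) (S l)) (hΘ : 0 < ∑ l, θ l)
    (hb : ∀ F, EssBounded (joint S F : LpI p)) {T : X →L[ℝ] LpI p} {Γ C : ℝ} (hT : ‖T‖ ≤ Γ)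
    (hΓ : Γ ≤ C) :
    FormBound k (fun l => θ l / ∑ l, θ l) (haarFamily p k N)
      ((∑ l, θ l)⁻¹ • jointForm hb T) C (1 - 1 / p.toReal) (1 / p.toReal) := by
  intro i hi i' hi' B hB B' hB' ξ ζ hξ hζ
  have hw : ∀ l, 0 ≤ θ l / ∑ l, θ l := fun l => div_nonneg (hS l).1.le hΘ.le
  have h1 := unitSupported_joint_nodeComb hd hS hi hB hξ
  have h2 := (unitSupported_joint_nodeComb hd hS hi' hB' hζ).norm_le
  have h3 := h1.abs_pairing_le hp1 hp (T (joint S (nodeComb (haarFamily p k N) i' B' ζ)))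
  rw [nodeWeight_eq_sum_mul hΘ] at h2 h3
  set W := nodeWeight (fun l => θ l / ∑ l, θ l) i B
  set W' := nodeWeight (fun l => θ l / ∑ l, θ l) i' B'
  have hW : 0 ≤ W := nodeWeight_nonneg hw i B
  have hW' : 0 ≤ W' := nodeWeight_nonneg hw i' B'
  set Θ := ∑ l, θ l
  have hT' : ‖T (joint S (nodeComb (haarFamily p k N) i' B' ζ))‖ ≤
      C * (Θ * W') ^ (1 / p.toReal) :=
    (T.le_opNorm _).trans (mul_le_mul (hT.trans hΓ) h2 (norm_nonneg _)
      ((norm_nonneg T).trans (hT.trans hΓ)))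
  rw [LinearMap.smul_apply, LinearMap.smul_apply, jointForm_apply, smul_eq_mul, abs_mul,
    pairing_comm, abs_inv, abs_of_pos hΘ, inv_mul_le_iff₀ hΘ]
  refine h3.trans ((mul_le_mul_of_nonneg_left hT' (by positivity)).trans (le_of_eq ?_))
  rw [Real.mul_rpow hΘ.le hW, Real.mul_rpow hΘ.le hW']
  have h4 : Θ ^ (1 - 1 / p.toReal) * Θ ^ (1 / p.toReal) = Θ := by
    rw [← Real.rpow_add hΘ, sub_add_cancel, Real.rpow_one]
  calc _ = (Θ ^ (1 - 1 / p.toReal) * Θ ^ (1 / p.toReal)) *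
        (C * W ^ (1 - 1 / p.toReal) * W' ^ (1 / p.toReal)) := by ring
    _ = _ := by rw [h4]

theorem FunctionalBound.of_le {V : Type*} [AddCommGroup V] [Module ℝ V] {w : Fin N → ℝ}
    (hw : ∀ l, 0 ≤ w l) (hw1 : ∑ l, w l = 1) {e : ℕ → Fin N × ℕ → V} {Λ : V →ₗ[ℝ] ℝ}
    {C D κ x : ℝ} (h : FunctionalBound k w e Λ D x) (hD : 0 ≤ D) (hC : D ≤ C) (hκ : 0 ≤ κ)
    (hx : κ ≤ x) : FunctionalBound k w e Λ C κ := by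
  intro i hi B hB ξ hξ
  refine (h i hi B hB ξ hξ).trans (mul_le_mul hC ?_ (Real.rpow_nonneg (nodeWeight_nonneg hw _ _) _)
    (hD.trans hC))
  exact Real.rpow_le_rpow_of_exponent_ge' (nodeWeight_nonneg hw _ _)
    (nodeWeight_le_one hw hw1 _ hB) hκ hx

/-- The functionals needed for `Q₁`. A pairing scales like the power 1 - 1/p of the support, so this
power of Σ θ_l is divided out. -/
theorem functionalBound_jointPairing (hp1 : 1 < p) (hp : p ≠ ∞) (hd : DisjointRanges S)
    (hS : ∀ l, IsCompression (θ l) (S l)) (hΘ : 0 < ∑ l, θ l)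
    (hb : ∀ F, EssBounded (joint S F : LpI p)) {f : LpI p} (hf : ‖f‖ ≤ 1) :
    FunctionalBound k (fun l => θ l / ∑ l, θ l) (haarFamily p k N)
      (((∑ l, θ l) ^ (1 - 1 / p.toReal))⁻¹ • jointPairing hb f) 1 (1 - 1 / p.toReal) := by
  intro i hi B hB ξ hξ
  have hw : ∀ l, 0 ≤ θ l / ∑ l, θ l := fun l => div_nonneg (hS l).1.le hΘ.le
  have h1 := (unitSupported_joint_nodeComb hd hS hi hB hξ).abs_pairing_le hp1 hp f
  rw [nodeWeight_eq_sum_mul hΘ, Real.mul_rpow hΘ.le (nodeWeight_nonneg hw i B)] at h1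
  have hpos : 0 < (∑ l, θ l) ^ (1 - 1 / p.toReal) := Real.rpow_pos_of_pos hΘ _
  rw [LinearMap.smul_apply, smul_eq_mul, abs_mul, abs_inv, abs_of_pos hpos,
    inv_mul_le_iff₀ hpos, one_mul]
  refine h1.trans (mul_le_of_le_one_right ?_ hf)
  exact mul_nonneg hpos.le (Real.rpow_nonneg (nodeWeight_nonneg hw i B) _)

/-- The functionals needed for `Q₂`. They scale like the L_p norm, that is, like the power 1/p of
the support. -/
theorem functionalBound_joint (hd : DisjointRanges S)
    (hS : ∀ l, IsCompression (θ l) (S l)) (hΘ : 0 < ∑ l, θ l) {φ : X →L[ℝ] ℝ} {D : ℝ}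
    (hφ : ‖φ‖ ≤ D) :
    FunctionalBound k (fun l => θ l / ∑ l, θ l) (haarFamily p k N)
      (((∑ l, θ l) ^ (1 / p.toReal))⁻¹ • ((φ : X →ₗ[ℝ] ℝ) ∘ₗ joint S)) D (1 / p.toReal) := by
  intro i hi B hB ξ hξ
  have hw : ∀ l, 0 ≤ θ l / ∑ l, θ l := fun l => div_nonneg (hS l).1.le hΘ.le
  have h1 := (unitSupported_joint_nodeComb hd hS hi hB hξ).norm_le
  rw [nodeWeight_eq_sum_mul hΘ, Real.mul_rpow hΘ.le (nodeWeight_nonneg hw i B)] at h1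
  have hpos : 0 < (∑ l, θ l) ^ (1 / p.toReal) := Real.rpow_pos_of_pos hΘ _
  rw [LinearMap.smul_apply, smul_eq_mul, abs_mul, abs_inv, abs_of_pos hpos,
    inv_mul_le_iff₀ hpos]
  have h2 : |φ (joint S (nodeComb (haarFamily p k N) i B ξ))| ≤
      D * ((∑ l, θ l) ^ (1 / p.toReal) *
        nodeWeight (fun l => θ l / ∑ l, θ l) i B ^ (1 / p.toReal)) :=
    (φ.le_opNorm _).trans (mul_le_mul hφ h1 (norm_nonneg _) ((norm_nonneg φ).trans hφ))
  exact h2.trans (le_of_eq (by ring))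

theorem diagSum_jointForm (hb : ∀ F, EssBounded (joint S F : LpI p)) (T : X →L[ℝ] LpI p)
    (a : ℝ) (i : Fin k) :
    diagSum (haarFamily p k N) (a⁻¹ • jointForm hb T) i = diagAverage T S a i := by
  rw [diagSum, diagAverage, nodes, Finset.sum_product, Finset.mul_sum]
  refine Finset.sum_congr rfl fun l _ => ?_
  rw [Finset.sum_range, Finset.mul_sum]
  refine Finset.sum_congr rfl fun j _ => ?_
  have h1 : joint S (haarFamily p k N i (l, j)) = S l (haarIn p k i j) := by
    have h2 : haarMem p k i j = haarIn p k i j := Subtype.ext (coe_haarMem i.2 j.2)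
    rw [joint_apply, haarFamily, Finset.sum_eq_single l]
    · rw [Pi.single_eq_same, h2]
    · intro l' _ hl
      rw [Pi.single_eq_of_ne hl, map_zero]
    · simp
  rw [LinearMap.smul_apply, LinearMap.smul_apply, jointForm_apply, smul_eq_mul, h1]

omit [Fact (1 ≤ p)] in
theorem mem_span_haarMem (n : ℕ) (f : LpHaar p n) :
    f ∈ Submodule.span ℝ (Set.range fun i : (Σ t : Fin n, Fin (2 ^ (t : ℕ))) =>
      haarMem p n i.1 i.2) := by
  obtain ⟨f, hf⟩ := f
  induction hf using Submodule.span_induction with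
  | mem f hf =>
    obtain ⟨t, j, ht, hj, rfl⟩ := hf
    refine Submodule.subset_span ⟨⟨⟨t, ht⟩, ⟨j, hj⟩⟩, Subtype.ext (coe_haarMem ht hj)⟩
  | zero => exact Submodule.zero_mem _
  | add f g hf hg h1 h2 => exact Submodule.add_mem _ h1 h2
  | smul c f hf h1 => exact Submodule.smul_mem _ c h1

theorem card_dyadicTree_le (n : ℕ) :
    Fintype.card (Σ t : Fin n, Fin (2 ^ (t : ℕ))) ≤ 2 ^ n := by
  rw [Fintype.card_sigma]
  simp only [Fintype.card_fin]
  rw [Fin.sum_univ_eq_sum_range (fun t => 2 ^ t) n]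
  have : ∑ t ∈ Finset.range n, 2 ^ t + 1 = 2 ^ n := by
    induction n with
    | zero => simp
    | succ n ih => rw [Finset.sum_range_succ, pow_succ]; omega
  omega

end Joint

/-! ### The range of the assembled operator -/

section Assembly

variable {p : ℝ≥0∞} [Fact (1 ≤ p)] {k n N : ℕ} {X : Submodule ℝ (LpI p)}

/-- The image of a Haar function, as an element of the range. -/
noncomputable def rangeHaar (S : LpHaar p n →ₗ[ℝ] X) (i : Σ t : Fin n, Fin (2 ^ (t : ℕ))) :
    rangeLp S :=
  (X.subtype ∘ₗ S).rangeRestrict (haarMem p n i.1 i.2)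

omit [Fact (1 ≤ p)] in
theorem coe_rangeHaar (S : LpHaar p n →ₗ[ℝ] X) (i : Σ t : Fin n, Fin (2 ^ (t : ℕ))) :
    (rangeHaar S i : LpI p) = S (haarMem p n i.1 i.2) := rfl

theorem rangeIncl_rangeHaar (S : LpHaar p n →ₗ[ℝ] X) (i : Σ t : Fin n, Fin (2 ^ (t : ℕ))) :
    rangeIncl S (rangeHaar S i) = S (haarMem p n i.1 i.2) := rfl

omit [Fact (1 ≤ p)] in
theorem mem_span_rangeHaar (S : LpHaar p n →ₗ[ℝ] X) (v : rangeLp S) :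
    v ∈ Submodule.span ℝ (Set.range (rangeHaar S)) := by
  obtain ⟨f, rfl⟩ := (X.subtype ∘ₗ S).surjective_rangeRestrict v
  have h := Submodule.mem_map_of_mem (f := (X.subtype ∘ₗ S).rangeRestrict) (mem_span_haarMem n f)
  rw [Submodule.map_span, ← Set.range_comp] at h
  exact h

theorem IsCompression.orthSystem (hp1 : 1 < p) (hp : p ≠ ∞) {S : LpHaar p n →ₗ[ℝ] X} {θ : ℝ}
    (hS : IsCompression θ S)
    (hu : ∀ i : (Σ t : Fin n, Fin (2 ^ (t : ℕ))), UnitSupported (rangeHaar S i : LpI p) θ) :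
    OrthSystem (fun i => (rangeHaar S i : LpI p)) (fun i => θ * (1 / 2 : ℝ) ^ (i.1 : ℕ))
      (θ ^ (1 - 1 / p.toReal)) where
  pos i := mul_pos hS.1 (by positivity)
  essBounded i := (hu i).essBounded
  bound i f := (hu i).abs_pairing_le hp1 hp f
  self i := by
    rw [coe_rangeHaar, hS.pairing_eq, coe_haarMem i.1.2 i.2.2, pairing_haar i.2.2 i.2.2,
      if_pos rfl]
  orth i j hij := by
    rw [coe_rangeHaar, coe_rangeHaar, hS.pairing_eq, coe_haarMem i.1.2 i.2.2,
      coe_haarMem j.1.2 j.2.2, pairing_haar i.2.2 j.2.2, if_neg, mul_zero]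
    intro h
    apply hij
    obtain ⟨⟨t, ht⟩, ⟨a, ha⟩⟩ := i
    obtain ⟨⟨t', ht'⟩, ⟨a', ha'⟩⟩ := j
    simp only [Prod.mk.injEq] at h
    obtain ⟨rfl, rfl⟩ := h
    rfl

omit [Fact (1 ≤ p)] in
theorem assembled_haarMem {S : Fin N → (LpHaar p k →ₗ[ℝ] X)}
    {J : Fin N → (LpHaar p n →ₗ[ℝ] LpHaar p k)} {g : ℕ → ℕ} {ε : ℕ → Fin N × ℕ → ℤˣ}
    (hJ : ∀ l, ∀ t < n, ∀ j < 2 ^ t,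
      J l (haarMem p n t j) = blockVec g ε (haarFamily p k N) t j l)
    {t j : ℕ} (ht : t < n) (hj : j < 2 ^ t) :
    assembled S J (haarMem p n t j) = joint S (blockVec g ε (haarFamily p k N) t j) := by
  rw [assembled_apply]
  congr 1
  funext l
  exact hJ l t ht j hj

omit [Fact (1 ≤ p)] in
theorem unitSupported_joint_blockVec {S : Fin N → (LpHaar p k →ₗ[ℝ] X)} {θ : Fin N → ℝ}
    (hd : DisjointRanges S) (hS : ∀ l, IsCompression (θ l) (S l)) (hΘ : 0 < ∑ l, θ l)
    (g : ℕ → ℕ) (ε : ℕ → Fin N × ℕ → ℤˣ) {t : ℕ} (ht : g t < k) (j : ℕ) :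
    UnitSupported (joint S (blockVec g ε (haarFamily p k N) t j) : LpI p) (∑ l, θ l) := by
  have hB : block g ε t j ⊆ nodes N (g t) := Finset.filter_subset _ _
  have h := unitSupported_joint_nodeComb hd hS ht hB (ξ := fun a => realSign (ε t a))
    fun a => (abs_realSign _).le
  refine ⟨h.1, h.2.trans ?_⟩
  rw [nodeWeight_eq_sum_mul hΘ]
  refine mul_le_of_le_one_right hΘ.le (nodeWeight_le_one ?_ ?_ _ hB)
  · exact fun l => div_nonneg (hS l).1.le hΘ.le
  · rw [← Finset.sum_div, div_self hΘ.ne']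

/-- A diagonal entry of level t is off by (t + 1) δ ≤ n δ from balancing, plus δ because the
diagonal sum of level g t is only nearly r. -/
theorem BalancedSigns.abs_jointForm_sub_le {ι : Type*} {S : Fin N → (LpHaar p k →ₗ[ℝ] X)}
    {g : ℕ → ℕ} {ε : ℕ → Fin N × ℕ → ℤˣ} {hb : ∀ F, EssBounded (joint S F : LpI p)}
    {T : X →L[ℝ] LpI p} {Θ δ : ℝ} (hΘ : 0 < Θ) (hδ : 0 ≤ δ)
    {Λ : ι → (Fin N → LpHaar p k) →ₗ[ℝ] ℝ}
    (h : BalancedSigns n g (haarFamily p k N) (Θ⁻¹ • jointForm hb T) Λ δ n ε) {r : ℝ}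
    (hr : ∀ s < n, |diagSum (haarFamily p k N) (Θ⁻¹ • jointForm hb T) (g s) - r| ≤ δ)
    (i j : Σ t : Fin n, Fin (2 ^ (t : ℕ))) :
    |jointForm hb T (blockVec g ε (haarFamily p k N) i.1 i.2)
        (blockVec g ε (haarFamily p k N) j.1 j.2) -
      if i = j then r * (Θ * (1 / 2 : ℝ) ^ (i.1 : ℕ)) else 0| ≤ Θ * ((n + 1) * δ) := by
  set q := jointForm hb T (blockVec g ε (haarFamily p k N) i.1 i.2)
    (blockVec g ε (haarFamily p k N) j.1 j.2)
  have hq : q = Θ * ((Θ⁻¹ • jointForm hb T) (blockVec g ε (haarFamily p k N) i.1 i.2)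
      (blockVec g ε (haarFamily p k N) j.1 j.2)) := by
    rw [LinearMap.smul_apply, LinearMap.smul_apply, smul_eq_mul, mul_inv_cancel_left₀ hΘ.ne']
  have hn : (0 : ℝ) ≤ n := Nat.cast_nonneg n
  by_cases hij : i = j
  · subst hij
    rw [if_pos rfl, hq, show r * (Θ * (1 / 2 : ℝ) ^ (i.1 : ℕ)) =
      Θ * (r * (1 / 2 : ℝ) ^ (i.1 : ℕ)) by ring, ← mul_sub, abs_mul, abs_of_pos hΘ]
    refine mul_le_mul_of_nonneg_left ?_ hΘ.le
    have h1 := h.diag i.1 i.1.2 i.2 i.2.2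
    have h2 := hr i.1 i.1.2
    have h3 : |diagSum (haarFamily p k N) (Θ⁻¹ • jointForm hb T) (g i.1) / 2 ^ (i.1 : ℕ) -
        r * (1 / 2 : ℝ) ^ (i.1 : ℕ)| ≤ δ := by
      rw [one_div, inv_pow, ← div_eq_mul_inv, ← sub_div, abs_div,
        abs_of_pos (show (0 : ℝ) < 2 ^ (i.1 : ℕ) by positivity)]
      exact (div_le_self (abs_nonneg _) (one_le_pow₀ (by norm_num))).trans h2
    have h4 := (abs_add_le _ _).trans (add_le_add h1 h3)
    rw [sub_add_sub_cancel] at h4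
    refine h4.trans ?_
    have h5 : ((i.1 : ℕ) : ℝ) + 1 ≤ n := by exact_mod_cast i.1.2
    nlinarith
  · rw [if_neg hij, sub_zero, hq, abs_mul, abs_of_pos hΘ]
    refine mul_le_mul_of_nonneg_left ?_ hΘ.le
    refine (h.offDiag i.1 i.1.2 i.2 i.2.2 j.1 j.1.2 j.2 j.2.2 fun h' => hij ?_).trans
      (by nlinarith)
    obtain ⟨⟨t, ht⟩, ⟨a, ha⟩⟩ := i
    obtain ⟨⟨t', ht'⟩, ⟨a', ha'⟩⟩ := j
    simp only [Prod.mk.injEq] at h'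
    obtain ⟨rfl, rfl⟩ := h'
    rfl

end Assembly

/-! ### Proof of the proposition -/

set_option maxHeartbeats 2000000 in
theorem mainTheorem5 (p : ℝ≥0∞) [Fact (1 ≤ p)] (hp1 : 1 < p) (hp : p ≠ ∞)
    (n m : ℕ) (hn : 1 ≤ n) (hm : 1 ≤ m) (Γ ε : ℝ) (hΓ : 0 < Γ) (hε0 : 0 < ε) (hε1 : ε < 1) :
    ∃ k₀ : ℕ, ∀ k : ℕ, k₀ ≤ k →
      ∀ (X : Submodule ℝ (LpI p)) (T : X →L[ℝ] LpI p), ‖T‖ ≤ Γ →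
      ∀ (Z : Type*) [NormedAddCommGroup Z] [NormedSpace ℝ Z]
        (W : Type*) [NormedAddCommGroup W] [NormedSpace ℝ W]
        (Q₁ : Z →L[ℝ] LpZero p) (Q₂ : X →L[ℝ] W),
        ‖Q₁‖ ≤ Γ → ‖Q₂‖ ≤ Γ →
        LinearMap.rank (Q₁ : Z →ₗ[ℝ] LpZero p) ≤ m → LinearMap.rank (Q₂ : X →ₗ[ℝ] W) ≤ m →
      ∀ (N : ℕ), 1 ≤ N → ∀ (S : Fin N → (LpHaar p k →ₗ[ℝ] X)) (θ : Fin N → ℝ),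
        (∀ l, IsCompression (θ l) (S l)) → DisjointRanges S →
      ∃ J : Fin N → (LpHaar p n →ₗ[ℝ] LpHaar p k),
        (∀ l, IsDistEmbedding (J l)) ∧
        IsCompression (∑ l, θ l) (assembled S J) ∧
        ∃ E : LpI p →L[ℝ] rangeLp (assembled S J),
          IsOrthProj (rangeLp (assembled S J)) E ∧
          (∃ i : Fin k,
            ‖E ∘L T ∘L rangeIncl (assembled S J) -
              diagAverage T S (∑ l, θ l) i •
                ContinuousLinearMap.id ℝ (rangeLp (assembled S J))‖ < ε) ∧
          ‖E ∘L (LpZero p).subtypeL ∘L Q₁‖ < ε ∧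
          ‖Q₂ ∘L rangeIncl (assembled S J) ∘L E ∘L (LpZero p).subtypeL‖ < ε := by
  have hpr : 1 < p.toReal := by
    rw [← ENNReal.toReal_one]
    exact (ENNReal.toReal_lt_toReal ENNReal.one_ne_top hp).mpr hp1
  set y : ℝ := 1 / p.toReal with hy
  have hy0 : 0 < y := by positivity
  have hx0 : 0 < 1 - y := by
    rw [sub_pos, hy, div_lt_one (by linarith)]; exact hpr
  set κ : ℝ := min (1 - y) y with hκdef
  have hκ : 0 < κ := lt_min hx0 hy0
  -- The summands dominate, in this order, the constants of the functionals from `Q₂`, of the form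
  -- from `T` and of the functionals from `Q₁`.
  set C : ℝ := 2 ^ m * Γ + Γ + 1 with hC
  have hC0 : 0 < C := by positivity
  have h2mΓ : 0 < 2 ^ m * Γ := by positivity
  -- A common factor for the three final estimates. In (i), one pair of factors 2^n counts Haar
  -- functions twice and the other comes from dividing twice by `c₀`.
  set D : ℝ := 2 ^ n * 2 ^ n * (2 ^ n * 2 ^ n) * (n + 1) * (m + 1) * C with hD
  have hD0 : 0 < D := by positivity
  set δ : ℝ := ε / (2 * D) with hδdef
  have hδ : 0 < δ := by positivity
  have hDδ : D * δ < ε := by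
    have : D * δ = ε / 2 := by rw [hδdef]; field_simp
    linarith
  obtain ⟨M, hM⟩ := exists_balanced_signs (m + m) n hC0.le hκ hδ
  obtain ⟨L, hL⟩ := exists_nearly_constant_levels n C hδ
  -- The summand 1 ensures k ≥ 1, which is needed for Θ ≤ 1.
  refine ⟨M + L + 1, ?_⟩
  intro k hk X T hT Z _ _ W _ _ Q₁ Q₂ hQ₁ hQ₂ hr₁ hr₂ N hN S θ hS hd
  have hΘ : 0 < ∑ l, θ l :=
    Finset.sum_pos (fun l _ => (hS l).1) ⟨⟨0, hN⟩, Finset.mem_univ _⟩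
  have hΘ1 : ∑ l, θ l ≤ 1 := sum_le_one_of_disjointRanges (by omega) hd hS
  set Θ : ℝ := ∑ l, θ l with hΘdef
  obtain ⟨φ₁, f₁, hQ₁f, hφ₁⟩ := exists_decomposition_of_rank_le hr₁
  obtain ⟨φ₂, w₂, hQ₂f, hφ₂⟩ := exists_decomposition_of_rank_le hr₂
  have hb := essBounded_joint hd hS
  set w : Fin N → ℝ := fun l => θ l / ∑ l, θ l with hwdef
  have hw : ∀ l, 0 ≤ w l := fun l => div_nonneg (hS l).1.le hΘ.le
  have hw1 : ∑ l, w l = 1 := by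
    rw [hwdef, ← Finset.sum_div]; exact div_self hΘ.ne'
  set β := Θ⁻¹ • jointForm hb T with hβdef
  have hβ : FormBound k w (haarFamily p k N) β C (1 - y) y :=
    formBound_jointForm hp1 hp hd hS hΘ hb hT (by linarith)
  set Λ : Fin m ⊕ Fin m → (Fin N → LpHaar p k) →ₗ[ℝ] ℝ :=
    Sum.elim (fun r => (Θ ^ (1 - y))⁻¹ • jointPairing hb (f₁ r : LpI p))
      (fun r => (Θ ^ y)⁻¹ • ((φ₂ r : X →ₗ[ℝ] ℝ) ∘ₗ joint S)) with hΛdef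
  have hΛ : ∀ r, FunctionalBound k w (haarFamily p k N) (Λ r) C κ := by
    rintro (r | r)
    · exact (functionalBound_jointPairing hp1 hp hd hS hΘ hb (hφ₁ r).2).of_le hw hw1 zero_le_one
        (by linarith) hκ.le (min_le_left _ _)
    · exact (functionalBound_joint hd hS hΘ ((hφ₂ r).1.trans
        (mul_le_mul_of_nonneg_left hQ₂ (by positivity)))).of_le hw hw1 h2mΓ.le
        (by linarith) hκ.le (min_le_right _ _)
  have hdiag : ∀ i < k, |diagSum (haarFamily p k N) β i| ≤ C := by
    intro i hi
    refine (Finset.abs_sum_le_sum_abs _ _).trans ?_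
    have := hβ.sum_abs_diag_le hw hx0.le hy0.le (by ring) hi subset_rfl
    rwa [nodeWeight_nodes hw1, mul_one] at this
  obtain ⟨g, hg, hgk, hgM, hgd⟩ := hL M k (by omega) _ hdiag
  obtain ⟨σ, hσ⟩ := hM N (Fin N → LpHaar p k) (Fin m ⊕ Fin m) (by simp) k g hg hgk hgM w hw hw1
    (haarFamily p k N) β (1 - y) y (min_le_left _ _) (min_le_right _ _) (by ring) hβ Λ hΛ
  choose J hJd hJ using exists_distEmbedding (p := p) hg hgk σ
  have hcomp : IsCompression Θ (assembled S J) :=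
    isCompression_assembled hd hS hΘ hΘ1 hJd
  have hval : ∀ i : (Σ t : Fin n, Fin (2 ^ (t : ℕ))),
      assembled S J (haarMem p n i.1 i.2) =
        joint S (blockVec g σ (haarFamily p k N) i.1 i.2) := fun i =>
    assembled_haarMem hJ i.1.2 i.2.2
  have hu : ∀ i, UnitSupported (rangeHaar (assembled S J) i : LpI p) Θ := fun i => by
    rw [coe_rangeHaar, hval]
    exact unitSupported_joint_blockVec hd hS hΘ g σ (hgk i.1 i.1.2) i.2
  have horth := hcomp.orthSystem hp1 hp hu
  have hspan := mem_span_rangeHaar (assembled S J)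
  have hA0 : 0 < Θ ^ (1 - y) := Real.rpow_pos_of_pos hΘ _
  have hB0 : 0 < Θ ^ y := Real.rpow_pos_of_pos hΘ _
  have hAB : Θ ^ (1 - y) * Θ ^ y = Θ := by
    rw [← Real.rpow_add hΘ, sub_add_cancel, Real.rpow_one]
  have hB : ∀ i, ‖rangeHaar (assembled S J) i‖ ≤ Θ ^ y := fun i => (hu i).norm_le
  -- A lower bound for the squared L_2 norms Θ 2^(-t), t < n, of the orthogonal system.
  set c₀ : ℝ := Θ * (1 / 2 : ℝ) ^ n with hc₀def
  have hc₀ : 0 < c₀ := by positivity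
  have hc : ∀ i : (Σ t : Fin n, Fin (2 ^ (t : ℕ))), c₀ ≤ Θ * (1 / 2 : ℝ) ^ (i.1 : ℕ) := fun i =>
    mul_le_mul_of_nonneg_left
      (pow_le_pow_of_le_one (by norm_num) (by norm_num) i.1.2.le) hΘ.le
  have hcinv : c₀⁻¹ = Θ⁻¹ * 2 ^ n := by
    rw [hc₀def, mul_inv, one_div, inv_pow, inv_inv]
  have hcard : (Fintype.card (Σ t : Fin n, Fin (2 ^ (t : ℕ))) : ℝ) ≤ 2 ^ n := by
    exact_mod_cast card_dyadicTree_le n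
  have hC1 : 1 ≤ C := by rw [hC]; linarith
  have hm0 : (0 : ℝ) ≤ m := Nat.cast_nonneg m
  have hn0 : (0 : ℝ) ≤ n := Nat.cast_nonneg n
  have h2n : (1 : ℝ) ≤ 2 ^ n := one_le_pow₀ (by norm_num)
  refine ⟨J, hJd, hcomp, orthProj horth, isOrthProj_orthProj horth hspan, ?_, ?_, ?_⟩
  -- The level in (i) is g 0, with whose diagonal sum those of all the chosen levels were compared.
  · refine ⟨⟨g 0, hgk 0 (by omega)⟩, ?_⟩
    have ha := hσ.abs_jointForm_sub_le hΘ hδ.le hgd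
    have h1 := norm_orthProj_comp_sub_le horth hspan hA0.le hB hB0.le hc₀ hc
      (T ∘L rangeIncl (assembled S J)) (diagSum (haarFamily p k N) β (g 0))
      (a := Θ * ((n + 1) * δ)) (by positivity) fun i j => by
        have h2 := ha i j
        rw [jointForm_apply, ← hval, ← hval, pairing_comm] at h2
        exact h2
    rw [hβdef, diagSum_jointForm hb T Θ ⟨g 0, hgk 0 (by omega)⟩] at h1
    refine (h1.trans ?_).trans_lt hDδ
    -- All powers of Θ cancel, so the estimate is uniform in the θ_l; the same happens in both parts
    -- of (ii).
    have h3 : Θ ^ (1 - y) / c₀ * (Θ * ((n + 1) * δ) / c₀ * Θ ^ y) =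
        2 ^ n * 2 ^ n * (n + 1) * δ := by
      rw [div_eq_mul_inv, div_eq_mul_inv, hcinv]
      calc _ = (Θ ^ (1 - y) * Θ ^ y) * Θ⁻¹ * (Θ * Θ⁻¹) * (2 ^ n * 2 ^ n * (n + 1) * δ) := by ring
        _ = _ := by rw [hAB, mul_inv_cancel₀ hΘ.ne', one_mul, one_mul]
    have h4 : (1 : ℝ) ≤ (m + 1) * C := by nlinarith
    set q : ℝ := ((Fintype.card (Σ t : Fin n, Fin (2 ^ (t : ℕ))) : ℕ) : ℝ)
    have hq0 : 0 ≤ q := Nat.cast_nonneg _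
    calc q * (Θ ^ (1 - y) / c₀ * (q * (Θ * ((n + 1) * δ) / c₀ * Θ ^ y)))
        = q * q * (Θ ^ (1 - y) / c₀ * (Θ * ((n + 1) * δ) / c₀ * Θ ^ y)) := by ring
      _ = q * q * (2 ^ n * 2 ^ n * (n + 1) * δ) := by rw [h3]
      _ ≤ 2 ^ n * 2 ^ n * (2 ^ n * 2 ^ n * (n + 1) * δ) * 1 := by
        rw [mul_one]; gcongr
      _ ≤ 2 ^ n * 2 ^ n * (2 ^ n * 2 ^ n * (n + 1) * δ) * ((m + 1) * C) := by gcongr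
      _ = D * δ := by rw [hD]; ring
  · refine (ContinuousLinearMap.opNorm_le_bound _
      (M := 2 ^ n * (m * (2 ^ m * Γ * δ) * 2 ^ n)) (by positivity) fun z => ?_).trans_lt ?_
    · have hf : ∀ r i, |pairing (f₁ r : LpI p) (rangeHaar (assembled S J) i)| ≤
          Θ ^ (1 - y) * δ := by
        intro r i
        have h1 := hσ.functional i.1 i.1.2 i.2 i.2.2 (Sum.inl r)
        simp only [hΛdef, Sum.elim_inl, LinearMap.smul_apply, smul_eq_mul, abs_mul, abs_inv,
          abs_of_pos hA0, inv_mul_le_iff₀ hA0] at h1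
        rw [coe_rangeHaar, hval]
        exact h1
      have ha : ∀ i, |pairing (Q₁ z : LpI p) (rangeHaar (assembled S J) i)| ≤
          m * (2 ^ m * Γ * ‖z‖ * (Θ ^ (1 - y) * δ)) := by
        intro i
        have h1 : pairing (Q₁ z : LpI p) (rangeHaar (assembled S J) i) =
            ∑ r, φ₁ r z * pairing (f₁ r : LpI p) (rangeHaar (assembled S J) i) := by
          have h2 : (Q₁ z : LpI p) = ∑ r, φ₁ r z • (f₁ r : LpI p) := by
            rw [hQ₁f z, AddSubmonoidClass.coe_finsetSum]; rfl
          rw [h2]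
          change pairingCLM _ _ (horth.essBounded i) (horth.bound i) (∑ r, φ₁ r z • (f₁ r : LpI p))
            = _
          rw [map_sum]
          exact Finset.sum_congr rfl fun r _ => pairing_smul_left _ _ _
        rw [h1]
        refine (Finset.abs_sum_le_sum_abs _ _).trans ((Finset.sum_le_card_nsmul _ _
          (2 ^ m * Γ * ‖z‖ * (Θ ^ (1 - y) * δ)) fun r _ => ?_).trans (by simp))
        rw [abs_mul]
        have h3 : |φ₁ r z| ≤ 2 ^ m * Γ * ‖z‖ := ((φ₁ r).le_opNorm z).trans
          (mul_le_mul_of_nonneg_right ((hφ₁ r).1.trans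
            (mul_le_mul_of_nonneg_left hQ₁ (by positivity))) (norm_nonneg _))
        exact mul_le_mul h3 (hf r i) (abs_nonneg _) (by positivity)
      refine (norm_orthProj_apply_le horth hB hc₀ hc (by positivity) ha).trans ?_
      have h3 : m * (2 ^ m * Γ * ‖z‖ * (Θ ^ (1 - y) * δ)) / c₀ * Θ ^ y =
          m * (2 ^ m * Γ * δ) * 2 ^ n * ‖z‖ := by
        rw [div_eq_mul_inv, hcinv]
        calc _ = (Θ ^ (1 - y) * Θ ^ y) * Θ⁻¹ * (m * (2 ^ m * Γ * δ) * 2 ^ n * ‖z‖) := by ring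
          _ = _ := by rw [hAB, mul_inv_cancel₀ hΘ.ne', one_mul]
      rw [h3, mul_assoc (2 ^ n : ℝ)]
      gcongr
    · refine lt_of_le_of_lt ?_ hDδ
      have h4 : m * (2 ^ m * Γ) ≤ (m + 1) * C := by
        have : 2 ^ m * Γ ≤ C := by rw [hC]; linarith
        gcongr
        linarith
      calc 2 ^ n * (m * (2 ^ m * Γ * δ) * 2 ^ n) =
            2 ^ n * 2 ^ n * (1 * 1) * 1 * (m * (2 ^ m * Γ)) * δ := by ring
        _ ≤ 2 ^ n * 2 ^ n * (2 ^ n * 2 ^ n) * (n + 1) * ((m + 1) * C) * δ := by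
          gcongr
          linarith
        _ = D * δ := by rw [hD]; ring
  · refine (ContinuousLinearMap.opNorm_le_bound _
      (M := 2 ^ n * (2 ^ n * (m * δ))) (by positivity) fun f => ?_).trans_lt ?_
    · have ha : ∀ i, ‖(Q₂ ∘L rangeIncl (assembled S J)) (rangeHaar (assembled S J) i)‖ ≤
          m * (Θ ^ y * δ) := by
        intro i
        have h1 : (Q₂ ∘L rangeIncl (assembled S J)) (rangeHaar (assembled S J) i) =
            ∑ r, φ₂ r (joint S (blockVec g σ (haarFamily p k N) i.1 i.2)) • w₂ r := by
          rw [ContinuousLinearMap.comp_apply, rangeIncl_rangeHaar, hval, hQ₂f]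
        rw [h1]
        refine (norm_sum_le _ _).trans ((Finset.sum_le_card_nsmul _ _ (Θ ^ y * δ)
          fun r _ => ?_).trans (by simp))
        rw [norm_smul, Real.norm_eq_abs]
        have h2 := hσ.functional i.1 i.1.2 i.2 i.2.2 (Sum.inr r)
        simp only [hΛdef, Sum.elim_inr, LinearMap.smul_apply, smul_eq_mul, abs_mul, abs_inv,
          abs_of_pos hB0, inv_mul_le_iff₀ hB0] at h2
        exact (mul_le_of_le_one_right (abs_nonneg _) (hφ₂ r).2).trans h2
      refine (norm_comp_orthProj_apply_le horth hA0.le hc₀ hc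
        (Q₂ ∘L rangeIncl (assembled S J)) ha (f : LpI p)).trans ?_
      have h3 : Θ ^ (1 - y) / c₀ * (m * (Θ ^ y * δ)) = 2 ^ n * (m * δ) := by
        rw [div_eq_mul_inv, hcinv]
        calc _ = (Θ ^ (1 - y) * Θ ^ y) * Θ⁻¹ * (2 ^ n * (m * δ)) := by ring
          _ = _ := by rw [hAB, mul_inv_cancel₀ hΘ.ne', one_mul]
      rw [h3, Submodule.coe_norm]
      gcongr
    · refine lt_of_le_of_lt ?_ hDδ
      calc 2 ^ n * (2 ^ n * (m * δ)) = 2 ^ n * 2 ^ n * (1 * 1) * 1 * m * 1 * δ := by ring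
        _ ≤ 2 ^ n * 2 ^ n * (2 ^ n * 2 ^ n) * (n + 1) * (m + 1) * C * δ := by
          gcongr <;> linarith
        _ = D * δ := by rw [hD]
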